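/- **Theorem 1.3 (quantitative uniqueness of Bourgain–Kenig type).** Let $m\ge 1$, $k\ge 0$ be integers, $\gamma>0$, and write $(z,t)\in\mathbb R^m\times\mathbb R^k$. Let $X_i=\partial_{z_i}$ $(1\le i\le m)$, $X_{m+j}=|z|^\gamma\partial_{t_j}$ $(1\le j\le k)$, and $$\mathscr B_\gamma=\sum_{i=1}^{m+k}X_i^2=\Delta_z+|z|^{2\gamma}\Delta_t,\qquad \rho(z,t)=\bigl(|z|^{2(\gamma+1)}+(\gamma+1)^2|t|^2\bigr)^{\frac1{2(\gamma+1)}},\qquad \psi=\frac{|z|^{2\gamma}}{\rho^{2\gamma}},\qquad B_r=\{\rho<r\}.$$ Let $S^{2,2}(B_R)$ be the completion of $C^\infty(\overline{B_R})$ with respect to the norm controlling $f$, $X_if$ and $X_iX_jf$ $(1\le i,j\le m+k)$ in $L^2(B_R)$. There is $R_*>0$ depending only on $m,k,\gamma$, and for all $K_0>0$ and $J>0$ there are constants $C_1,C_2>0$ depending only on $m,k,\gamma,K_0,J$, such that the following holds for every $R>0$ with $R_0:=\min\{R_*,R/2\}\in(0,R/2]$, every $K\ge 0$, and all functions $u,V$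 on $B_R$. Suppose that $u\in S^{2,2}(B_R)$, that $|u|\le K_0$ a.e. in $B_R$, that $-\mathscr B_\gamma u=Vu$ a.e. in $B_R$, that $|V|\le K\psi$ a.e. in $B_R$, and that $\int_{B_{R_0/4}}u^2\psi\,dz\,dt=J$. Then for all $0<r<R_0/9$ $$\|u\|_{L^\infty(B_r)}\ \ge\ C_1\Bigl(\frac r{R_0}\Bigr)^{C_2\,(K^{2/3}+1)} .$$ Consequently, the vanishing order of $u$ at the origin is at most $C_2(K^{2/3}+1)$: if $\ell\in\mathbb R$ and $\|u\|_{L^\infty(B_r)}=O(r^\ell)$ as $r\to0^+$, then $\ell\le C_2(K^{2/3}+1)$. -/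

import Mathlib

open MeasureTheory Filter Topology

noncomputable section

/-- The space `ℝ^m × ℝ^k` of points `(z, t)`; its `volume` is Lebesgue measure `dz dt`. -/
abbrev GrushinSpace (m k : ℕ) : Type :=
  EuclideanSpace ℝ (Fin m) × EuclideanSpace ℝ (Fin k)

/-- The vector fields `X_i = ∂_{z_i}` (index `Sum.inl i`) and `X_{m+j} = |z|^γ ∂_{t_j}`
(index `Sum.inr j`), acting on functions by classical differentiation. For smooth `f`, the
functions `X_j f` are smooth where `z ≠ 0`, so `X_i X_j f` is the classical expression off the
null set `{z = 0}`. -/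
def grushinX {m k : ℕ} (γ : ℝ) :
    Fin m ⊕ Fin k → (GrushinSpace m k → ℝ) → GrushinSpace m k → ℝ
  | Sum.inl i, f, p => fderiv ℝ f p (EuclideanSpace.single i 1, 0)
  | Sum.inr j, f, p => ‖p.1‖ ^ γ * fderiv ℝ f p (0, EuclideanSpace.single j 1)

/-- The pseudo-gauge `ρ(z,t) = (|z|^{2(γ+1)} + (γ+1)^2 |t|^2)^{1/(2(γ+1))}`. -/
def grushinGauge {m k : ℕ} (γ : ℝ) (p : GrushinSpace m k) : ℝ :=
  (‖p.1‖ ^ (2 * (γ + 1)) + (γ + 1) ^ 2 * ‖p.2‖ ^ 2) ^ (1 / (2 * (γ + 1)))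

/-- The gauge pseudo-ball `B_r = {ρ < r}` centred at the origin. -/
def gaugeBall {m k : ℕ} (γ r : ℝ) : Set (GrushinSpace m k) :=
  {p | grushinGauge γ p < r}

/-- The angle function `ψ = |z|^{2γ} / ρ^{2γ}`. -/
def angleFn {m k : ℕ} (γ : ℝ) (p : GrushinSpace m k) : ℝ :=
  ‖p.1‖ ^ (2 * γ) / grushinGauge γ p ^ (2 * γ)

/-- `u` is the limit, in the norm of `S^{2,2}(Ω)`, of (restrictions to `Ω` of) smooth functions
`f n`, where `Du i` and `D2u i j` are the resulting `L²(Ω)` functions `X_i u` and `X_i X_j u`. -/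
structure IsS22Limit {m k : ℕ} (γ : ℝ) (Ω : Set (GrushinSpace m k)) (u : GrushinSpace m k → ℝ)
    (Du : Fin m ⊕ Fin k → GrushinSpace m k → ℝ)
    (D2u : Fin m ⊕ Fin k → Fin m ⊕ Fin k → GrushinSpace m k → ℝ) : Prop where
  memLp : MemLp u 2 (volume.restrict Ω)
  memLp_D : ∀ i, MemLp (Du i) 2 (volume.restrict Ω)
  memLp_D2 : ∀ i j, MemLp (D2u i j) 2 (volume.restrict Ω)
  exists_seq : ∃ f : ℕ → GrushinSpace m k → ℝ,
    (∀ n, ContDiff ℝ (⊤ : ℕ∞) (f n)) ∧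
    Tendsto (fun n => eLpNorm (f n - u) 2 (volume.restrict Ω)) atTop (𝓝 0) ∧
    (∀ i, Tendsto (fun n => eLpNorm (grushinX γ i (f n) - Du i) 2 (volume.restrict Ω))
      atTop (𝓝 0)) ∧
    (∀ i j, Tendsto
      (fun n => eLpNorm (grushinX γ i (grushinX γ j (f n)) - D2u i j) 2 (volume.restrict Ω))
      atTop (𝓝 0))

/-- The space `S^{2,2}(Ω)`: the completion of `C^∞(closure Ω)` in the norm controlling `f`, `X_i f`
and `X_i X_j f` in `L²(Ω)`, realized inside `L²(Ω)` (the fields `X_i` are closable there because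
they are formally skew-adjoint, so `u` determines the limits `Du`, `D2u` almost everywhere). -/
def MemS22 {m k : ℕ} (γ : ℝ) (Ω : Set (GrushinSpace m k)) (u : GrushinSpace m k → ℝ) : Prop :=
  ∃ Du D2u, IsS22Limit γ Ω u Du D2u

/-- `u ∈ S^{2,2}(Ω)` solves `-𝓑_γ u = V u` in `Ω`, where `𝓑_γ u = ∑_i X_i X_i u`; the equation
holds almost everywhere in `Ω`. -/
def IsGrushinSolution {m k : ℕ} (γ : ℝ) (Ω : Set (GrushinSpace m k))
    (V u : GrushinSpace m k → ℝ) : Prop :=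
  ∃ Du D2u, IsS22Limit γ Ω u Du D2u ∧
    ∀ᵐ p ∂(volume.restrict Ω), -∑ i, D2u i i p = V p * u p

end

/-! In the variable s = log ρ the anisotropic dilations δ_h become translations, and they preserve
the measure ψ ρ^{-Q} dz dt, where Q = m + (γ+1)k. Put q = (Q-2)/2, w = ρ^q u, and let ws = ρ^q (Zu +
q u) be the derivative of w along the dilations, Z being their generator. Then F = ρ^q (ρ²/ψ) 𝓑u
plays the role of w_ss - q² w plus an angular operator that is symmetric and commutes with
dilations. The hypothesis |V| ≤ Kψ becomes |F| ≤ K e^{2s} |w|: the factor ψ cancels the degenerate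
weight.

Since u has only two horizontal derivatives in L², the commutation is used in integrated form.
Testing the weak equation with G(s) · u∘δ_h, and with its mirror image under h ↦ -h, produces the
same energy term (`IsAnnulusSolution.flow_identity`). Differentiating at h = 0 yields the Rellich
identity `IsAnnulusSolution.rellich`, in which neither the angular energy nor q survives. Added to
an integration by parts along the flow (`IsHorizLimit.radial_ibp`), it becomes the Carleman estimate
`IsAnnulusSolution.carleman` with weight exp(2α(e^s - s)). The part -s makes the weight singular
like ρ^{-2α}, and the convexity of e^s yields a positive bulk term of size α³ e^s w². The potential
contributes K² e^{4s} w², which is absorbed once K² ≤ α³; this is the origin of the exponent 2/3.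

The estimate is applied with a cutoff whose inner layer lies inside B_r and whose outer layer lies
between B_{R₀} and B_{2R₀}. The Caccioppoli inequality turns the ws-errors into w-errors, and these
are controlled by N = sup over B_r of |u| on the inner layer and by K₀ on the outer one; the left
side controls the mass J on B_{R₀/4} up to the part on B_r (`exists_carleman_bounded`). The weight
at R₀/4 beats the weight at R₀ by e^{2α}, so a large multiple α of K^{2/3} + 1 absorbs the outer
error. What remains says that N² is at least a constant times (r/R₀)^{8α}
(`exists_lower_bound_of_carleman`). Powers of R₀ are harmless because a fixed J > 0 together with
|u| ≤ K₀ bounds R₀ from below. -/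

noncomputable section

/-! ### The gauge, the dilations and the dilation-invariant measure. -/

variable {m k : ℕ}

/-- The power `ρ^{2(γ+1)}` of the gauge. -/
def gaugePow (γ : ℝ) (p : GrushinSpace m k) : ℝ :=
  ‖p.1‖ ^ (2 * (γ + 1)) + (γ + 1) ^ 2 * ‖p.2‖ ^ 2

/-- The logarithm of the gauge. -/
def logGauge (γ : ℝ) (p : GrushinSpace m k) : ℝ := Real.log (grushinGauge γ p)

/-- The squared length `∑ (X_i log ρ)²`, which equals `ψ / ρ²`. -/
def gaugeWeight (γ : ℝ) (p : GrushinSpace m k) : ℝ := ‖p.1‖ ^ (2 * γ) / gaugePow γ p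

/-- The anisotropic dilations, parametrised by the logarithm of the ratio. -/
def dil (γ h : ℝ) (p : GrushinSpace m k) : GrushinSpace m k :=
  (Real.exp h • p.1, Real.exp ((γ + 1) * h) • p.2)

/-- The infinitesimal generator of the dilations. -/
def dilField (γ : ℝ) (p : GrushinSpace m k) : GrushinSpace m k := (p.1, (γ + 1) • p.2)

/-- The homogeneous dimension. -/
def homDim (m k : ℕ) (γ : ℝ) : ℝ := m + (γ + 1) * k

/-- The horizontal gradient of `log ρ`. -/
def gradLogGauge (γ : ℝ) : Fin m ⊕ Fin k → GrushinSpace m k → ℝ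
  | Sum.inl i, p => ‖p.1‖ ^ (2 * γ) * p.1 i / gaugePow γ p
  | Sum.inr j, p => ‖p.1‖ ^ γ * ((γ + 1) * p.2 j) / gaugePow γ p

variable {γ : ℝ}

lemma gaugePow_nonneg (hγ : 0 < γ) (p : GrushinSpace m k) : 0 ≤ gaugePow γ p := by
  unfold gaugePow; positivity

lemma gaugePow_pos (hγ : 0 < γ) {p : GrushinSpace m k} (hp : p ≠ 0) : 0 < gaugePow γ p := by
  unfold gaugePow
  by_cases h1 : p.1 = 0
  · have h2 : p.2 ≠ 0 := fun h2 => hp (Prod.ext h1 h2)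
    have := norm_pos_iff.2 h2
    positivity
  · have := norm_pos_iff.2 h1
    positivity

lemma grushinGauge_eq (p : GrushinSpace m k) :
    grushinGauge γ p = gaugePow γ p ^ (1 / (2 * (γ + 1))) := rfl

lemma grushinGauge_zero (hγ : 0 < γ) : grushinGauge γ (0 : GrushinSpace m k) = 0 := by
  have h1 : 2 * (γ + 1) ≠ 0 := by positivity
  have h2 : (γ + 1) ≠ 0 := by positivity
  simp [grushinGauge, Real.zero_rpow, h2]

lemma grushinGauge_pos (hγ : 0 < γ) {p : GrushinSpace m k} (hp : p ≠ 0) :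
    0 < grushinGauge γ p := Real.rpow_pos_of_pos (gaugePow_pos hγ hp) _

lemma grushinGauge_nonneg (hγ : 0 < γ) (p : GrushinSpace m k) :
    0 ≤ grushinGauge γ p := Real.rpow_nonneg (gaugePow_nonneg hγ p) _

lemma grushinGauge_pow (hγ : 0 < γ) (p : GrushinSpace m k) :
    grushinGauge γ p ^ (2 * (γ + 1)) = gaugePow γ p := by
  rw [grushinGauge_eq, ← Real.rpow_mul (gaugePow_nonneg hγ p), one_div,
    inv_mul_cancel₀ (by positivity), Real.rpow_one]

lemma logGauge_eq (hγ : 0 < γ) {p : GrushinSpace m k} (hp : p ≠ 0) :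
    logGauge γ p = Real.log (gaugePow γ p) / (2 * (γ + 1)) := by
  rw [logGauge, grushinGauge_eq, Real.log_rpow (gaugePow_pos hγ hp)]; ring

lemma exp_logGauge (hγ : 0 < γ) {p : GrushinSpace m k} (hp : p ≠ 0) :
    Real.exp (logGauge γ p) = grushinGauge γ p := Real.exp_log (grushinGauge_pos hγ hp)

lemma gaugePow_dil (h : ℝ) (p : GrushinSpace m k) :
    gaugePow γ (dil γ h p) = Real.exp (2 * (γ + 1) * h) * gaugePow γ p := by
  simp only [gaugePow, dil, norm_smul, Real.norm_eq_abs, Real.abs_exp]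
  rw [Real.mul_rpow (Real.exp_nonneg _) (norm_nonneg _), ← Real.exp_mul, mul_pow,
    ← Real.exp_nat_mul]
  rw [show h * (2 * (γ + 1)) = 2 * (γ + 1) * h by ring,
    show ((2 : ℕ) : ℝ) * ((γ + 1) * h) = 2 * (γ + 1) * h by push_cast; ring]
  ring

lemma dil_ne_zero (h : ℝ) {p : GrushinSpace m k} (hp : p ≠ 0) : dil γ h p ≠ 0 := by
  intro h0
  apply hp
  have h1 := congrArg Prod.fst h0
  have h2 := congrArg Prod.snd h0
  simp only [dil, Prod.fst_zero, Prod.snd_zero, smul_eq_zero, Real.exp_ne_zero, false_or] at h1 h2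
  exact Prod.ext h1 h2

lemma dil_zero_right (h : ℝ) : dil γ h (0 : GrushinSpace m k) = 0 := by
  simp [dil]

lemma dil_add (h h' : ℝ) (p : GrushinSpace m k) : dil γ h (dil γ h' p) = dil γ (h + h') p := by
  simp [dil, smul_smul, ← Real.exp_add, mul_add]

lemma dil_zero (p : GrushinSpace m k) : dil γ 0 p = p := by
  simp [dil]

lemma dil_neg_dil (h : ℝ) (p : GrushinSpace m k) : dil γ (-h) (dil γ h p) = p := by
  rw [dil_add]; simp [dil_zero]

lemma dil_dil_neg (h : ℝ) (p : GrushinSpace m k) : dil γ h (dil γ (-h) p) = p := by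
  rw [dil_add]; simp [dil_zero]

lemma logGauge_dil (hγ : 0 < γ) (h : ℝ) {p : GrushinSpace m k} (hp : p ≠ 0) :
    logGauge γ (dil γ h p) = logGauge γ p + h := by
  rw [logGauge_eq hγ (dil_ne_zero h hp), logGauge_eq hγ hp, gaugePow_dil,
    Real.log_mul (Real.exp_ne_zero _) (gaugePow_pos hγ hp).ne', Real.log_exp]
  have : γ + 1 ≠ 0 := by positivity
  field_simp
  ring

lemma gaugeWeight_dil (h : ℝ) (p : GrushinSpace m k) :
    gaugeWeight γ (dil γ h p) = Real.exp (-2 * h) * gaugeWeight γ p := by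
  unfold gaugeWeight
  rw [gaugePow_dil]
  simp only [dil, norm_smul, Real.norm_eq_abs, Real.abs_exp]
  rw [Real.mul_rpow (Real.exp_nonneg _) (norm_nonneg _), ← Real.exp_mul, mul_div_mul_comm,
    ← Real.exp_sub]
  congr 2; ring

lemma gaugeWeight_nonneg (hγ : 0 < γ) (p : GrushinSpace m k) : 0 ≤ gaugeWeight γ p := by
  unfold gaugeWeight
  have := gaugePow_nonneg hγ p
  positivity

lemma gaugeWeight_pos (hγ : 0 < γ) {p : GrushinSpace m k} (hp : p.1 ≠ 0) :
    0 < gaugeWeight γ p := by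
  unfold gaugeWeight
  have := gaugePow_pos hγ (p := p) (fun h => hp (by simp [h]))
  have := norm_pos_iff.2 hp
  positivity

lemma norm_fst_le_gauge (hγ : 0 < γ) (p : GrushinSpace m k) : ‖p.1‖ ≤ grushinGauge γ p := by
  have h : (‖p.1‖ ^ (2 * (γ + 1))) ≤ grushinGauge γ p ^ (2 * (γ + 1)) := by
    rw [grushinGauge_pow hγ, gaugePow]
    have : 0 ≤ (γ + 1) ^ 2 * ‖p.2‖ ^ 2 := by positivity
    linarith
  exact (Real.rpow_le_rpow_iff (norm_nonneg _) (grushinGauge_nonneg hγ p) (by positivity)).1 h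

lemma norm_snd_le_gauge (hγ : 0 < γ) (p : GrushinSpace m k) :
    ‖p.2‖ ≤ grushinGauge γ p ^ (γ + 1) := by
  have h : ‖p.2‖ ^ 2 ≤ (grushinGauge γ p ^ (γ + 1)) ^ 2 := by
    rw [← Real.rpow_natCast (grushinGauge γ p ^ (γ + 1)), ← Real.rpow_mul (grushinGauge_nonneg hγ p),
      show (γ + 1) * ((2 : ℕ) : ℝ) = 2 * (γ + 1) by push_cast; ring, grushinGauge_pow hγ, gaugePow]
    have h1 : 0 ≤ ‖p.1‖ ^ (2 * (γ + 1)) := by positivity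
    have h2 : 0 ≤ (γ ^ 2 + 2 * γ) * ‖p.2‖ ^ 2 := by positivity
    nlinarith
  exact (sq_le_sq₀ (norm_nonneg _) (Real.rpow_nonneg (grushinGauge_nonneg hγ p) _)).1 h

lemma angleFn_eq (hγ : 0 < γ) {p : GrushinSpace m k} (hp : p ≠ 0) :
    angleFn γ p = gaugeWeight γ p * Real.exp (2 * logGauge γ p) := by
  have h0 := grushinGauge_pos hγ hp
  rw [angleFn, gaugeWeight, ← grushinGauge_pow hγ, mul_comm (2 : ℝ) (logGauge γ p), Real.exp_mul,
    exp_logGauge hγ hp, show 2 * (γ + 1) = 2 * γ + 2 by ring, Real.rpow_add h0]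
  field_simp

lemma angleFn_nonneg (hγ : 0 < γ) (p : GrushinSpace m k) : 0 ≤ angleFn γ p := by
  unfold angleFn
  have := grushinGauge_nonneg hγ p
  positivity

lemma angleFn_le_one (hγ : 0 < γ) (p : GrushinSpace m k) : angleFn γ p ≤ 1 := by
  unfold angleFn
  have h := grushinGauge_nonneg hγ p
  apply div_le_one_of_le₀ _ (by positivity)
  exact Real.rpow_le_rpow (norm_nonneg _) (norm_fst_le_gauge hγ p) (by positivity)

lemma gaugeWeight_le (hγ : 0 < γ) {p : GrushinSpace m k} (hp : p ≠ 0) :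
    gaugeWeight γ p ≤ Real.exp (-2 * logGauge γ p) := by
  have h1 := angleFn_eq hγ hp
  have h2 := angleFn_le_one hγ p
  rw [h1] at h2
  have : Real.exp (-2 * logGauge γ p) = (Real.exp (2 * logGauge γ p))⁻¹ := by
    rw [← Real.exp_neg]; ring_nf
  rw [this, ← one_div, le_div_iff₀ (Real.exp_pos _)]
  exact h2

/-- The exponent 2(γ+1) exceeds 1, so this power of |z| is C¹ across z = 0 although |z|^γ itself
need not be differentiable there. -/
lemma contDiff_gaugePow (hγ : 0 < γ) : ContDiff ℝ 1 (gaugePow γ : GrushinSpace m k → ℝ) := by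
  unfold gaugePow
  apply ContDiff.add
  · exact contDiff_fst.norm_rpow (by linarith)
  · exact contDiff_const.mul (contDiff_snd.norm_sq ℝ)

lemma hasFDerivAt_gaugePow (hγ : 0 < γ) (p v : GrushinSpace m k) :
    fderiv ℝ (gaugePow γ) p v = 2 * (γ + 1) * (‖p.1‖ ^ (2 * γ) * inner ℝ p.1 v.1 +
      (γ + 1) * inner ℝ p.2 v.2) := by
  have h1 : HasFDerivAt (fun p : GrushinSpace m k => ‖p.1‖ ^ (2 * (γ + 1))) _ p :=
    (hasFDerivAt_norm_rpow p.1 (p := 2 * (γ + 1)) (by linarith)).comp p hasFDerivAt_fst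
  have h2 : HasFDerivAt (fun p : GrushinSpace m k => ‖p.2‖ ^ 2) _ p :=
    HasFDerivAt.norm_sq (x := p) (hasFDerivAt_snd (𝕜 := ℝ))
  have h3 := (h1.add (h2.const_mul ((γ + 1) ^ 2))).fderiv
  change fderiv ℝ (gaugePow γ) p = _ at h3
  rw [h3]
  simp
  rw [show 2 * (γ + 1) - 2 = 2 * γ by ring]
  ring

lemma continuous_gaugePow (hγ : 0 < γ) : Continuous (gaugePow γ : GrushinSpace m k → ℝ) :=
  (contDiff_gaugePow hγ).continuous

lemma continuous_grushinGauge (hγ : 0 < γ) :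
    Continuous (grushinGauge γ : GrushinSpace m k → ℝ) :=
  (continuous_gaugePow hγ).rpow_const fun _ => Or.inr (by positivity)

lemma measurable_logGauge (hγ : 0 < γ) : Measurable (logGauge γ : GrushinSpace m k → ℝ) :=
  Real.measurable_log.comp (continuous_grushinGauge hγ).measurable

lemma measurable_gaugeWeight (hγ : 0 < γ) : Measurable (gaugeWeight γ : GrushinSpace m k → ℝ) :=
  ((continuous_fst.norm.rpow_const fun _ => Or.inr (by positivity)).measurable).div
    (continuous_gaugePow hγ).measurable

lemma contDiffAt_logGauge (hγ : 0 < γ) {p : GrushinSpace m k} (hp : p ≠ 0) :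
    ContDiffAt ℝ 1 (logGauge γ) p := by
  have h : ContDiffAt ℝ 1 (fun p => Real.log (gaugePow γ p) / (2 * (γ + 1))) p :=
    ((contDiff_gaugePow hγ).contDiffAt.log (gaugePow_pos hγ hp).ne').div_const _
  apply h.congr_of_eventuallyEq
  filter_upwards [isOpen_ne.mem_nhds hp] with q hq using logGauge_eq hγ hq

lemma fderiv_logGauge (hγ : 0 < γ) {p : GrushinSpace m k} (hp : p ≠ 0) (v : GrushinSpace m k) :
    fderiv ℝ (logGauge γ) p v = (‖p.1‖ ^ (2 * γ) * inner ℝ p.1 v.1 +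
      (γ + 1) * inner ℝ p.2 v.2) / gaugePow γ p := by
  have h : logGauge γ =ᶠ[𝓝 p] fun p => Real.log (gaugePow γ p) * (2 * (γ + 1))⁻¹ := by
    filter_upwards [isOpen_ne.mem_nhds hp] with q hq
    rw [logGauge_eq hγ hq, div_eq_mul_inv]
  rw [h.fderiv_eq, fderiv_mul_const, fderiv.log]
  · have := gaugePow_pos hγ hp
    simp [hasFDerivAt_gaugePow hγ]
    field_simp
  · exact (contDiff_gaugePow hγ).differentiable one_ne_zero p
  · exact (gaugePow_pos hγ hp).ne'
  · exact ((contDiff_gaugePow hγ).differentiable one_ne_zero p).log (gaugePow_pos hγ hp).ne'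

lemma grushinX_logGauge (hγ : 0 < γ) {p : GrushinSpace m k} (hp : p ≠ 0) (i : Fin m ⊕ Fin k) :
    grushinX γ i (logGauge γ) p = gradLogGauge γ i p := by
  rcases i with i | j
  · simp only [grushinX, gradLogGauge]
    rw [fderiv_logGauge hγ hp]
    simp [EuclideanSpace.inner_single_right]
  · simp only [grushinX, gradLogGauge]
    rw [fderiv_logGauge hγ hp]
    simp [EuclideanSpace.inner_single_right]
    ring

lemma EuclideanSpace.sum_single_smul {n : ℕ} (x : EuclideanSpace ℝ (Fin n)) :
    ∑ i, x i • (EuclideanSpace.single i (1 : ℝ)) = x := by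
  ext j
  simp [Finset.sum_apply, Pi.single_apply]

lemma fderiv_dilField (f : GrushinSpace m k → ℝ) (p : GrushinSpace m k) :
    fderiv ℝ f p (dilField γ p) =
      ∑ i, p.1 i * fderiv ℝ f p (EuclideanSpace.single i 1, 0) +
      (γ + 1) * ∑ j, p.2 j * fderiv ℝ f p (0, EuclideanSpace.single j 1) := by
  have h : dilField γ p = ∑ i, p.1 i • ((EuclideanSpace.single i (1 : ℝ), 0) : GrushinSpace m k) +
      (γ + 1) • ∑ j, p.2 j • ((0, EuclideanSpace.single j (1 : ℝ)) : GrushinSpace m k) := by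
    ext1
    · simp [dilField, Prod.fst_sum, EuclideanSpace.sum_single_smul]
    · simp [dilField, Prod.snd_sum, EuclideanSpace.sum_single_smul]
  rw [h]
  simp only [map_add, map_sum, map_smul, smul_eq_mul]

/-- The horizontal gradient of log ρ is dual to the dilation generator, up to the weight. Hence a
radial function meets the horizontal gradient of f only through the derivative of f along dilations,
which is what separates radial from angular behaviour. -/
lemma sum_gradLogGauge_mul_grushinX (hγ : 0 < γ) (f : GrushinSpace m k → ℝ)
    (p : GrushinSpace m k) :
    ∑ i, gradLogGauge γ i p * grushinX γ i f p =
      gaugeWeight γ p * fderiv ℝ f p (dilField γ p) := by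
  have h2 : ‖p.1‖ ^ (2 * γ) = ‖p.1‖ ^ γ * ‖p.1‖ ^ γ := by
    rw [← Real.rpow_add_of_nonneg (norm_nonneg _) hγ.le hγ.le]; ring_nf
  rw [Fintype.sum_sum_type, fderiv_dilField, gaugeWeight, mul_add, Finset.mul_sum, Finset.mul_sum,
    Finset.mul_sum]
  congr 1
  · refine Finset.sum_congr rfl fun i _ => ?_
    simp only [gradLogGauge, grushinX]; ring
  · refine Finset.sum_congr rfl fun i _ => ?_
    simp only [gradLogGauge, grushinX]; rw [h2]; ring

lemma sum_gradLogGauge_sq (hγ : 0 < γ) (p : GrushinSpace m k) :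
    ∑ i, gradLogGauge γ i p ^ 2 = gaugeWeight γ p := by
  by_cases hp : p = 0
  · subst hp
    have : γ ≠ 0 := hγ.ne'
    simp [gradLogGauge, gaugeWeight, Real.zero_rpow, this]
  have h := sum_gradLogGauge_mul_grushinX hγ (logGauge γ) p
  have h1 : fderiv ℝ (logGauge γ) p (dilField γ p) = 1 := by
    rw [fderiv_logGauge hγ hp]
    have h0 := gaugePow_pos hγ hp
    rw [div_eq_one_iff_eq h0.ne', gaugePow]
    simp only [dilField, inner_smul_right, real_inner_self_eq_norm_sq]
    rw [show 2 * (γ + 1) = 2 * γ + (2 : ℕ) by push_cast; ring,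
      Real.rpow_add_of_nonneg (norm_nonneg _) (by positivity) (by positivity), Real.rpow_natCast]
    ring
  rw [h1, mul_one] at h
  rw [← h]
  refine Finset.sum_congr rfl fun i _ => ?_
  rw [grushinX_logGauge hγ hp, sq]

lemma hasDerivAt_dil (h : ℝ) (p : GrushinSpace m k) :
    HasDerivAt (fun h => dil γ h p) (dilField γ (dil γ h p)) h := by
  have h1 : HasDerivAt (fun h => Real.exp h • p.1) (Real.exp h • p.1) h :=
    (Real.hasDerivAt_exp h).smul_const _
  have h2 : HasDerivAt (fun h => Real.exp ((γ + 1) * h) • p.2)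
      ((γ + 1) • Real.exp ((γ + 1) * h) • p.2) h := by
    have e : HasDerivAt (fun h => Real.exp ((γ + 1) * h)) (Real.exp ((γ + 1) * h) * (γ + 1)) h := by
      simpa using ((hasDerivAt_id h).const_mul (γ + 1)).exp
    have := e.smul_const p.2
    rwa [mul_comm, mul_smul] at this
  exact h1.prodMk h2

lemma hasDerivAt_comp_dil {f : GrushinSpace m k → ℝ} (h : ℝ) (p : GrushinSpace m k)
    (hf : DifferentiableAt ℝ f (dil γ h p)) :
    HasDerivAt (fun h => f (dil γ h p)) (fderiv ℝ f (dil γ h p) (dilField γ (dil γ h p))) h :=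
  hf.hasFDerivAt.comp_hasDerivAt h (hasDerivAt_dil h p)

/-- A dilation as a continuous linear map. -/
def dilCLM (γ h : ℝ) : GrushinSpace m k →L[ℝ] GrushinSpace m k :=
  (Real.exp h • ContinuousLinearMap.fst ℝ _ _).prod
    (Real.exp ((γ + 1) * h) • ContinuousLinearMap.snd ℝ _ _)

lemma contDiff_dil (h : ℝ) {n : WithTop ℕ∞} :
    ContDiff ℝ n (dil γ h : GrushinSpace m k → GrushinSpace m k) :=
  (dilCLM γ h).contDiff

/-- All the fields are homogeneous of degree one: a t-derivative scales by e^{(γ+1)h}, and the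
coefficient |z|^γ takes up the excess e^{γh}. -/
lemma grushinX_comp_dil (h : ℝ) {f : GrushinSpace m k → ℝ} (hf : Differentiable ℝ f)
    (i : Fin m ⊕ Fin k) (p : GrushinSpace m k) :
    grushinX γ i (f ∘ dil γ h) p = Real.exp h * grushinX γ i f (dil γ h p) := by
  have h1 : ∀ v, fderiv ℝ (f ∘ dil γ h) p v = fderiv ℝ f (dil γ h p) (dil γ h v) := by
    intro v
    have := ((hf (dil γ h p)).hasFDerivAt.comp p (dilCLM γ h).hasFDerivAt).fderiv
    change fderiv ℝ (f ∘ dil γ h) p = _ at this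
    rw [this]; rfl
  rcases i with i | j
  · simp only [grushinX]
    rw [h1]
    have : dil γ h ((EuclideanSpace.single i 1, 0) : GrushinSpace m k) =
      Real.exp h • (EuclideanSpace.single i 1, 0) := by simp [dil]
    rw [this, map_smul, smul_eq_mul]
  · simp only [grushinX]
    rw [h1]
    have : dil γ h ((0, EuclideanSpace.single j 1) : GrushinSpace m k) =
      Real.exp ((γ + 1) * h) • (0, EuclideanSpace.single j 1) := by simp [dil]
    rw [this, map_smul, smul_eq_mul]
    simp only [dil, norm_smul, Real.norm_eq_abs, Real.abs_exp]
    rw [Real.mul_rpow (Real.exp_nonneg _) (norm_nonneg _), ← Real.exp_mul,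
      show (γ + 1) * h = h + h * γ by ring, Real.exp_add]
    ring

lemma map_dil_volume (h : ℝ) :
    Measure.map (dil γ h) (volume : Measure (GrushinSpace m k)) =
      ENNReal.ofReal (Real.exp (-(homDim m k γ) * h)) • volume := by
  have h1 : Measure.map (Real.exp h • ·) (volume : Measure (EuclideanSpace ℝ (Fin m))) = _ :=
    Measure.map_addHaar_smul _ (Real.exp_ne_zero h)
  have h2 : Measure.map (Real.exp ((γ + 1) * h) • ·)
      (volume : Measure (EuclideanSpace ℝ (Fin k))) = _ :=
    Measure.map_addHaar_smul _ (Real.exp_ne_zero _)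
  have h3 : (dil γ h : GrushinSpace m k → _) =
    Prod.map (Real.exp h • ·) (Real.exp ((γ + 1) * h) • ·) := by
    ext1 p; rfl
  have hs1 : SFinite (Measure.map (Real.exp h • ·) (volume : Measure (EuclideanSpace ℝ (Fin m)))) :=
    inferInstance
  rw [h3]
  change Measure.map _ (Measure.prod volume volume) = _
  rw [← Measure.map_prod_map _ _ (by fun_prop) (by fun_prop), h1, h2, Measure.prod_smul_left,
    Measure.prod_smul_right, smul_smul]
  congr 1
  rw [← ENNReal.ofReal_mul (by positivity)]
  congr 1
  simp only [finrank_euclideanSpace, Fintype.card_fin, abs_inv, abs_pow, Real.abs_exp]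
  rw [← Real.exp_nat_mul, ← Real.exp_nat_mul, ← Real.exp_neg, ← Real.exp_neg, ← Real.exp_add,
    homDim]
  ring_nf

lemma measurable_dil (h : ℝ) : Measurable (dil γ h : GrushinSpace m k → _) :=
  (contDiff_dil (n := 0) h).continuous.measurable

/-- A dilation as a measurable equivalence. -/
def dilEquiv (γ h : ℝ) : GrushinSpace m k ≃ᵐ GrushinSpace m k where
  toFun := dil γ h
  invFun := dil γ (-h)
  left_inv := dil_neg_dil h
  right_inv := dil_dil_neg h
  measurable_toFun := measurable_dil h
  measurable_invFun := measurable_dil (-h)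

lemma integral_comp_dil (h : ℝ) (Y : GrushinSpace m k → ℝ) :
    ∫ p, Y (dil γ h p) = Real.exp (-(homDim m k γ) * h) * ∫ p, Y p := by
  have := MeasureTheory.integral_map_equiv (μ := volume) (dilEquiv (m := m) (k := k) γ h) Y
  change ∫ y, Y y ∂(Measure.map (dil γ h) volume) = ∫ x, Y (dil γ h x) at this
  rw [← this, map_dil_volume, integral_smul_measure, ENNReal.toReal_ofReal (Real.exp_nonneg _),
    smul_eq_mul]

lemma lintegral_comp_dil (h : ℝ) (Y : GrushinSpace m k → ENNReal) :
    ∫⁻ p, Y (dil γ h p) = ENNReal.ofReal (Real.exp (-(homDim m k γ) * h)) * ∫⁻ p, Y p := by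
  have := MeasureTheory.lintegral_map_equiv (μ := volume) Y (dilEquiv (m := m) (k := k) γ h)
  change ∫⁻ y, Y y ∂(Measure.map (dil γ h) volume) = ∫⁻ x, Y (dil γ h x) at this
  rw [← this, map_dil_volume, lintegral_smul_measure, smul_eq_mul]

/-- Half the homogeneous dimension minus one. -/
def halfDim (m k : ℕ) (γ : ℝ) : ℝ := (homDim m k γ - 2) / 2

/-- The density `ψ ρ^{-Q}` of the dilation invariant measure. -/
def invDensity (γ : ℝ) (p : GrushinSpace m k) : ℝ :=
  gaugeWeight γ p * Real.exp (-2 * halfDim m k γ * logGauge γ p)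

/-- The dilation invariant measure `ψ ρ^{-Q} dz dt`. -/
def invMeasure (m k : ℕ) (γ : ℝ) : Measure (GrushinSpace m k) :=
  volume.withDensity fun p => ENNReal.ofReal (invDensity γ p)

lemma invDensity_nonneg (hγ : 0 < γ) (p : GrushinSpace m k) : 0 ≤ invDensity γ p :=
  mul_nonneg (gaugeWeight_nonneg hγ p) (Real.exp_nonneg _)

lemma measurable_invDensity (hγ : 0 < γ) : Measurable (invDensity γ : GrushinSpace m k → ℝ) :=
  (measurable_gaugeWeight hγ).mul
    (Real.measurable_exp.comp ((measurable_logGauge hγ).const_mul _))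

lemma invDensity_dil (hγ : 0 < γ) (h : ℝ) {p : GrushinSpace m k} (hp : p ≠ 0) :
    invDensity γ (dil γ h p) = Real.exp (-(homDim m k γ) * h) * invDensity γ p := by
  unfold invDensity
  rw [gaugeWeight_dil, logGauge_dil hγ h hp, mul_add, Real.exp_add, halfDim,
    show -(homDim m k γ) * h = -2 * h + -2 * ((homDim m k γ - 2) / 2) * h by ring, Real.exp_add]
  ring

/-- The set {z = 0} is where the weight vanishes and division by it loses its meaning; m ≥ 1 makes
it a null set. -/
lemma ae_fst_ne_zero (hm : 1 ≤ m) : ∀ᵐ p : GrushinSpace m k, p.1 ≠ 0 := by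
  have : Nonempty (Fin m) := ⟨⟨0, hm⟩⟩
  have : Nontrivial (EuclideanSpace ℝ (Fin m)) := inferInstance
  have h : ∀ᵐ z : EuclideanSpace ℝ (Fin m), z ≠ 0 := by
    simp [ae_iff]
  exact Measure.quasiMeasurePreserving_fst.ae h

lemma ae_ne_zero (hm : 1 ≤ m) : ∀ᵐ p : GrushinSpace m k, p ≠ 0 := by
  filter_upwards [ae_fst_ne_zero hm] with p hp h0
  exact hp (by simp [h0])

/-- The density has degree -2 from the weight and -(Q-2) from the power of ρ, in total -Q, which
cancels the Jacobian of the dilation. -/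
lemma measurePreserving_dil (hγ : 0 < γ) (hm : 1 ≤ m) (h : ℝ) :
    MeasurePreserving (dil γ h) (invMeasure m k γ) (invMeasure m k γ) := by
  refine ⟨measurable_dil h, ?_⟩
  ext s hs
  have hm1 : Measurable fun p : GrushinSpace m k => ENNReal.ofReal (invDensity γ p) :=
    (measurable_invDensity hγ).ennreal_ofReal
  rw [Measure.map_apply (measurable_dil h) hs, invMeasure, withDensity_apply _ hs,
    withDensity_apply _ (measurable_dil h hs), ← lintegral_indicator hs,
    ← lintegral_indicator (measurable_dil h hs)]
  have h1 := lintegral_comp_dil (m := m) (k := k) (γ := γ) h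
    (s.indicator fun p => ENNReal.ofReal (invDensity γ p))
  have h2 : ∫⁻ p, (s.indicator (fun p => ENNReal.ofReal (invDensity γ p)) (dil γ h p)) =
      ENNReal.ofReal (Real.exp (-(homDim m k γ) * h)) *
      ∫⁻ p, ((dil γ h ⁻¹' s).indicator (fun p => ENNReal.ofReal (invDensity γ p)) p) := by
    rw [← lintegral_const_mul]
    · apply lintegral_congr_ae
      filter_upwards [ae_ne_zero hm] with p hp
      by_cases hps : dil γ h p ∈ s
      · rw [Set.indicator_of_mem hps, Set.indicator_of_mem (show p ∈ dil γ h ⁻¹' s from hps),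
          invDensity_dil hγ h hp, ENNReal.ofReal_mul (Real.exp_nonneg _)]
      · rw [Set.indicator_of_notMem hps, Set.indicator_of_notMem (show p ∉ dil γ h ⁻¹' s from hps),
          mul_zero]
    · exact hm1.indicator (measurable_dil h hs)
  rw [h2] at h1
  rwa [ENNReal.mul_right_inj (by simp [Real.exp_pos]) ENNReal.ofReal_ne_top] at h1

lemma integral_invMeasure (hγ : 0 < γ) (Y : GrushinSpace m k → ℝ) :
    ∫ p, Y p ∂(invMeasure m k γ) = ∫ p, invDensity γ p * Y p := by
  rw [invMeasure, integral_withDensity_eq_integral_toReal_smul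
    (measurable_invDensity hγ).ennreal_ofReal (by simp)]
  simp [ENNReal.toReal_ofReal (invDensity_nonneg hγ _)]

end

/-! ### Integration by parts for the fields, and its passage to L² limits. -/

noncomputable section

variable {m k : ℕ} {γ : ℝ}

lemma contDiff_fderiv_apply {f : GrushinSpace m k → ℝ} (hf : ContDiff ℝ (⊤ : ℕ∞) f)
    (v : GrushinSpace m k) : ContDiff ℝ (⊤ : ℕ∞) fun p => fderiv ℝ f p v :=
  (hf.fderiv_right (m := (⊤ : ℕ∞)) (by simp)).clm_apply contDiff_const

lemma continuous_norm_fst_rpow (hγ : 0 < γ) :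
    Continuous fun p : GrushinSpace m k => ‖p.1‖ ^ γ :=
  continuous_fst.norm.rpow_const fun _ => Or.inr hγ.le

lemma continuous_grushinX (hγ : 0 < γ) {f : GrushinSpace m k → ℝ} (hf : ContDiff ℝ 1 f)
    (i : Fin m ⊕ Fin k) : Continuous (grushinX γ i f) := by
  have h : ∀ v, Continuous fun p => fderiv ℝ f p v := fun v =>
    (hf.continuous_fderiv one_ne_zero).clm_apply continuous_const
  rcases i with i | j
  · exact h _
  · exact (continuous_norm_fst_rpow hγ).mul (h _)

/-- The coefficient |z|^γ is constant in t and so passes through the outer derivative. Where z = 0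
it may fail to be differentiable, but there both sides vanish because γ > 0. -/
lemma grushinX_inr_grushinX_inr (hγ : 0 < γ) {f : GrushinSpace m k → ℝ}
    (hf : ContDiff ℝ (⊤ : ℕ∞) f) (j : Fin k) (p : GrushinSpace m k) :
    grushinX γ (Sum.inr j) (grushinX γ (Sum.inr j) f) p = ‖p.1‖ ^ γ * (‖p.1‖ ^ γ *
      fderiv ℝ (fun q => fderiv ℝ f q (0, EuclideanSpace.single j 1)) p
        (0, EuclideanSpace.single j 1)) := by
  simp only [grushinX]
  by_cases hp : p.1 = 0
  · simp [hp, Real.zero_rpow hγ.ne']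
  congr 1
  set e : GrushinSpace m k := (0, EuclideanSpace.single j 1)
  have hN : DifferentiableAt ℝ (fun q : GrushinSpace m k => ‖q.1‖ ^ γ) p :=
    (differentiableAt_fst.norm ℝ hp).rpow_const (Or.inl (norm_ne_zero_iff.2 hp))
  have hF : DifferentiableAt ℝ (fun q => fderiv ℝ f q e) p :=
    (contDiff_fderiv_apply hf e).differentiable (by simp) p
  have h0 : fderiv ℝ (fun q : GrushinSpace m k => ‖q.1‖ ^ γ) p e = 0 := by
    rw [← hN.lineDeriv_eq_fderiv, lineDeriv]
    simp [e]
  change fderiv ℝ (fun q => ‖q.1‖ ^ γ * fderiv ℝ f q e) p e = _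
  rw [fderiv_fun_mul hN hF]
  simp [h0]

lemma continuous_grushinX_grushinX (hγ : 0 < γ) {f : GrushinSpace m k → ℝ}
    (hf : ContDiff ℝ (⊤ : ℕ∞) f) (i : Fin m ⊕ Fin k) :
    Continuous (grushinX γ i (grushinX γ i f)) := by
  rcases i with i | j
  · exact continuous_grushinX hγ (f := grushinX γ (Sum.inl i) f)
      ((contDiff_fderiv_apply hf _).of_le (by exact_mod_cast le_top)) (Sum.inl i)
  · have : grushinX γ (Sum.inr j) (grushinX γ (Sum.inr j) f) = _ :=
      funext (grushinX_inr_grushinX_inr hγ hf j)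
    rw [this]
    have h2 := contDiff_fderiv_apply hf (0, EuclideanSpace.single j 1)
    exact (continuous_norm_fst_rpow hγ).mul ((continuous_norm_fst_rpow hγ).mul
      (contDiff_fderiv_apply h2 _).continuous)

instance isAddHaarMeasure_volume_grushinSpace :
    (volume : Measure (GrushinSpace m k)).IsAddHaarMeasure :=
  inferInstanceAs (Measure.prod (volume : Measure (EuclideanSpace ℝ (Fin m)))
    (volume : Measure (EuclideanSpace ℝ (Fin k)))).IsAddHaarMeasure

/-- Integration by parts along one of the fields `X_i`. -/
lemma integral_grushinX_grushinX_mul (hγ : 0 < γ) {f G : GrushinSpace m k → ℝ}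
    (hf : ContDiff ℝ (⊤ : ℕ∞) f) (hG : ContDiff ℝ 1 G) (hGc : HasCompactSupport G)
    (i : Fin m ⊕ Fin k) :
    ∫ p, grushinX γ i (grushinX γ i f) p * G p = -∫ p, grushinX γ i f p * grushinX γ i G p := by
  have hGf : ∀ v, Continuous fun p => fderiv ℝ G p v := fun v =>
    (hG.continuous_fderiv one_ne_zero).clm_apply continuous_const
  have hGfc : ∀ v, HasCompactSupport fun p => fderiv ℝ G p v := fun v =>
    hGc.fderiv_apply ℝ v
  rcases i with i | j
  · set e : GrushinSpace m k := (EuclideanSpace.single i 1, 0)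
    have h1 := contDiff_fderiv_apply hf e
    have h2 := contDiff_fderiv_apply h1 e
    have := integral_mul_fderiv_eq_neg_fderiv_mul_of_integrable (μ := volume) (𝕜 := ℝ)
      (f := fun p => fderiv ℝ f p e) (g := G) (v := e)
      ((h2.continuous.mul hG.continuous).integrable_of_hasCompactSupport hGc.mul_left)
      ((h1.continuous.mul (hGf e)).integrable_of_hasCompactSupport (hGfc e).mul_left)
      ((h1.continuous.mul hG.continuous).integrable_of_hasCompactSupport hGc.mul_left)
      (fun p _ => h1.differentiable (by simp) p) (fun p _ => hG.differentiable one_ne_zero p)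
    simp only [grushinX]
    rw [this, neg_neg]
    rfl
  · set e : GrushinSpace m k := (0, EuclideanSpace.single j 1) with he
    have h1 := contDiff_fderiv_apply hf e
    have h2 := contDiff_fderiv_apply h1 e
    have hz := continuous_norm_fst_rpow (m := m) (k := k) hγ
    -- Both factors |z|^γ are grouped with G. The product may fail to be differentiable at z = 0,
    -- but its line derivative in a t-direction exists everywhere, and that is all the integration
    -- by parts needs.
    have h := integral_bilinear_hasLineDerivAt_right_eq_neg_left_of_integrable
      (μ := (volume : Measure (GrushinSpace m k)))
      (f := fun p => fderiv ℝ f p e) (f' := fun p => fderiv ℝ (fun q => fderiv ℝ f q e) p e)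
      (g := fun p => ‖p.1‖ ^ γ * (‖p.1‖ ^ γ * G p))
      (g' := fun p => ‖p.1‖ ^ γ * (‖p.1‖ ^ γ * fderiv ℝ G p e)) (v := e)
      (B := ContinuousLinearMap.mul ℝ ℝ)
      ((h2.continuous.mul (hz.mul (hz.mul hG.continuous))).integrable_of_hasCompactSupport
        hGc.mul_left.mul_left.mul_left)
      ((h1.continuous.mul (hz.mul (hz.mul (hGf e)))).integrable_of_hasCompactSupport
        (hGfc e).mul_left.mul_left.mul_left)
      ((h1.continuous.mul (hz.mul (hz.mul hG.continuous))).integrable_of_hasCompactSupport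
        hGc.mul_left.mul_left.mul_left)
      (fun p _ => (h1.differentiable (by simp) p).hasFDerivAt.hasLineDerivAt e)
      (fun p _ => by
        have := (hG.differentiable one_ne_zero p).hasFDerivAt.hasLineDerivAt e
        unfold HasLineDerivAt at this ⊢
        have := (this.const_mul (‖p.1‖ ^ γ)).const_mul (‖p.1‖ ^ γ)
        simpa [he] using this)
    simp only [ContinuousLinearMap.mul_apply'] at h
    simp only [grushinX_inr_grushinX_inr hγ hf]
    simp only [grushinX, ← he]
    have e1 : ∀ p : GrushinSpace m k, ‖p.1‖ ^ γ * (‖p.1‖ ^ γ *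
      fderiv ℝ (fun q => fderiv ℝ f q e) p e) * G p =
        fderiv ℝ (fun q => fderiv ℝ f q e) p e * (‖p.1‖ ^ γ * (‖p.1‖ ^ γ * G p)) := by
      intro p; ring
    have e2 : ∀ p : GrushinSpace m k, ‖p.1‖ ^ γ * fderiv ℝ f p e * (‖p.1‖ ^ γ * fderiv ℝ G p e) =
        fderiv ℝ f p e * (‖p.1‖ ^ γ * (‖p.1‖ ^ γ * fderiv ℝ G p e)) := by
      intro p; ring
    simp only [e1, e2]
    rw [h, neg_neg]

lemma grushinX_mul {f g : GrushinSpace m k → ℝ} {p : GrushinSpace m k}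
    (hf : DifferentiableAt ℝ f p) (hg : DifferentiableAt ℝ g p) (i : Fin m ⊕ Fin k) :
    grushinX γ i (fun p => f p * g p) p = f p * grushinX γ i g p + g p * grushinX γ i f p := by
  rcases i with i | j
  · simp only [grushinX]
    rw [fderiv_fun_mul hf hg]
    simp
  · simp only [grushinX]
    rw [fderiv_fun_mul hf hg]
    simp
    ring

section L2

variable {X : Type*} [MeasurableSpace X] {ν : Measure X}

lemma MeasureTheory.MemLp.integrable_mul_two {F G : X → ℝ} (hF : MemLp F 2 ν) (hG : MemLp G 2 ν) :
    Integrable (fun x => F x * G x) ν :=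
  hF.integrable_mul hG

lemma eLpNorm_mul_one_le {F G : X → ℝ} (hF : AEStronglyMeasurable F ν)
    (hG : AEStronglyMeasurable G ν) :
    eLpNorm (fun x => F x * G x) 1 ν ≤ eLpNorm F 2 ν * eLpNorm G 2 ν := by
  have := eLpNorm_smul_le_mul_eLpNorm (p := 2) (q := 2) (r := 1) hG hF
  exact this

lemma eventually_memLp_of_tendsto {F : ℕ → X → ℝ} {F0 : X → ℝ}
    (hF : ∀ n, AEStronglyMeasurable (F n) ν) (hF0 : MemLp F0 2 ν)
    (h : Tendsto (fun n => eLpNorm (F n - F0) 2 ν) atTop (𝓝 0)) :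
    ∀ᶠ n in atTop, MemLp (F n) 2 ν := by
  filter_upwards [h.eventually (gt_mem_nhds ENNReal.zero_lt_top)] with n hn
  have : MemLp (F n - F0) 2 ν := ⟨(hF n).sub hF0.1, hn⟩
  simpa using this.add hF0

lemma tendsto_integral_mul_of_L2 {F G : ℕ → X → ℝ} {F0 G0 : X → ℝ}
    (hF : ∀ n, AEStronglyMeasurable (F n) ν) (hG : ∀ n, AEStronglyMeasurable (G n) ν)
    (hF0 : MemLp F0 2 ν) (hG0 : MemLp G0 2 ν)
    (hFl : Tendsto (fun n => eLpNorm (F n - F0) 2 ν) atTop (𝓝 0))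
    (hGl : Tendsto (fun n => eLpNorm (G n - G0) 2 ν) atTop (𝓝 0)) :
    Tendsto (fun n => ∫ x, F n x * G n x ∂ν) atTop (𝓝 (∫ x, F0 x * G0 x ∂ν)) := by
  refine tendsto_integral_of_L1' _ (hF0.integrable_mul_two hG0).1 ?_ ?_
  · filter_upwards [eventually_memLp_of_tendsto hF hF0 hFl,
      eventually_memLp_of_tendsto hG hG0 hGl] with n h1 h2 using h1.integrable_mul_two h2
  · have hb : ∀ n, eLpNorm ((fun x => F n x * G n x) - fun x => F0 x * G0 x) 1 ν ≤
        eLpNorm (F n - F0) 2 ν * (eLpNorm (G n - G0) 2 ν + eLpNorm G0 2 ν) +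
        eLpNorm F0 2 ν * eLpNorm (G n - G0) 2 ν := by
      intro n
      have e : ((fun x => F n x * G n x) - fun x => F0 x * G0 x) =
          (fun x => (F n - F0) x * G n x) + fun x => F0 x * (G n - G0) x := by
        ext x; simp; ring
      rw [e]
      refine (eLpNorm_add_le (((hF n).sub hF0.1).mul (hG n)) (hF0.1.mul ((hG n).sub hG0.1))
        le_rfl).trans (add_le_add ?_ ?_)
      · refine (eLpNorm_mul_one_le ((hF n).sub hF0.1) (hG n)).trans ?_
        gcongr
        have : G n = (G n - G0) + G0 := by simp
        conv_lhs => rw [this]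
        exact eLpNorm_add_le ((hG n).sub hG0.1) hG0.1 (by norm_num)
      · exact eLpNorm_mul_one_le hF0.1 ((hG n).sub hG0.1)
    have hlim : Tendsto (fun n => eLpNorm (F n - F0) 2 ν * (eLpNorm (G n - G0) 2 ν +
        eLpNorm G0 2 ν) + eLpNorm F0 2 ν * eLpNorm (G n - G0) 2 ν) atTop (𝓝 0) := by
      have h1 : Tendsto (fun n => eLpNorm (F n - F0) 2 ν * (eLpNorm (G n - G0) 2 ν +
          eLpNorm G0 2 ν)) atTop (𝓝 (0 * (0 + eLpNorm G0 2 ν))) :=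
        ENNReal.Tendsto.mul hFl (Or.inr (by simpa using hG0.2.ne)) (hGl.add tendsto_const_nhds)
          (Or.inr (by simp))
      have h2 : Tendsto (fun n => eLpNorm F0 2 ν * eLpNorm (G n - G0) 2 ν) atTop
          (𝓝 (eLpNorm F0 2 ν * 0)) :=
        ENNReal.Tendsto.const_mul hGl (Or.inr hF0.2.ne)
      simpa using h1.add h2
    exact tendsto_of_tendsto_of_tendsto_of_le_of_le tendsto_const_nhds hlim (fun _ => zero_le) hb

lemma tendsto_eLpNorm_mul_bounded {F : ℕ → X → ℝ} {F0 c : X → ℝ} {C : ℝ}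
    (hc : ∀ x, |c x| ≤ C)
    (h : Tendsto (fun n => eLpNorm (F n - F0) 2 ν) atTop (𝓝 0)) :
    Tendsto (fun n => eLpNorm ((fun x => c x * F n x) - fun x => c x * F0 x) 2 ν) atTop
      (𝓝 0) := by
  have hb : ∀ n, eLpNorm ((fun x => c x * F n x) - fun x => c x * F0 x) 2 ν ≤
      ENNReal.ofReal C * eLpNorm (F n - F0) 2 ν := by
    intro n
    apply eLpNorm_le_mul_eLpNorm_of_ae_le_mul
    filter_upwards with x
    simp only [Pi.sub_apply, ← mul_sub, norm_mul, Real.norm_eq_abs]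
    exact mul_le_mul_of_nonneg_right (hc x) (abs_nonneg _)
  have hlim := ENNReal.Tendsto.const_mul (a := ENNReal.ofReal C) h (Or.inr ENNReal.ofReal_ne_top)
  rw [mul_zero] at hlim
  exact tendsto_of_tendsto_of_tendsto_of_le_of_le tendsto_const_nhds hlim (fun _ => zero_le) hb

lemma tendsto_eLpNorm_restrict_mono {F : ℕ → X → ℝ} {F0 : X → ℝ} {s t : Set X} (hst : s ⊆ t)
    (h : Tendsto (fun n => eLpNorm (F n - F0) 2 (ν.restrict t)) atTop (𝓝 0)) :
    Tendsto (fun n => eLpNorm (F n - F0) 2 (ν.restrict s)) atTop (𝓝 0) :=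
  tendsto_of_tendsto_of_tendsto_of_le_of_le tendsto_const_nhds h (fun _ => zero_le)
    fun _ => eLpNorm_mono_measure _ (Measure.restrict_mono hst le_rfl)

end L2

/-- `u` is the limit of smooth functions in `L²(Ω)`, together with the horizontal gradient. -/
structure IsHorizLimit (γ : ℝ) (Ω : Set (GrushinSpace m k)) (u : GrushinSpace m k → ℝ)
    (Du : Fin m ⊕ Fin k → GrushinSpace m k → ℝ) : Prop where
  memLp : MemLp u 2 (volume.restrict Ω)
  memLp_D : ∀ i, MemLp (Du i) 2 (volume.restrict Ω)
  exists_seq : ∃ f : ℕ → GrushinSpace m k → ℝ,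
    (∀ n, ContDiff ℝ (⊤ : ℕ∞) (f n)) ∧
    Tendsto (fun n => eLpNorm (f n - u) 2 (volume.restrict Ω)) atTop (𝓝 0) ∧
    (∀ i, Tendsto (fun n => eLpNorm (grushinX γ i (f n) - Du i) 2 (volume.restrict Ω))
      atTop (𝓝 0))

lemma IsS22Limit.isHorizLimit {Ω : Set (GrushinSpace m k)} {u : GrushinSpace m k → ℝ}
    {Du : Fin m ⊕ Fin k → GrushinSpace m k → ℝ}
    {D2u : Fin m ⊕ Fin k → Fin m ⊕ Fin k → GrushinSpace m k → ℝ}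
    (h : IsS22Limit γ Ω u Du D2u) : IsHorizLimit γ Ω u Du := by
  obtain ⟨f, h1, h2, h3, _⟩ := h.exists_seq
  exact ⟨h.memLp, h.memLp_D, f, h1, h2, h3⟩

lemma tendsto_integral_mul_mul_of_L2 {X : Type*} [MeasurableSpace X] {ν : Measure X} {Ω : Set X}
    {F G : ℕ → X → ℝ} {F0 G0 c : X → ℝ} {C : ℝ} (hc : ∀ x, |c x| ≤ C) (hcm : Measurable c)
    (hcs : ∀ x, x ∉ Ω → c x = 0)
    (hF : ∀ n, AEStronglyMeasurable (F n) (ν.restrict Ω))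
    (hG : ∀ n, AEStronglyMeasurable (G n) (ν.restrict Ω))
    (hF0 : MemLp F0 2 (ν.restrict Ω)) (hG0 : MemLp G0 2 (ν.restrict Ω))
    (hFl : Tendsto (fun n => eLpNorm (F n - F0) 2 (ν.restrict Ω)) atTop (𝓝 0))
    (hGl : Tendsto (fun n => eLpNorm (G n - G0) 2 (ν.restrict Ω)) atTop (𝓝 0)) :
    Tendsto (fun n => ∫ x, c x * F n x * G n x ∂ν) atTop (𝓝 (∫ x, c x * F0 x * G0 x ∂ν)) := by
  have key : ∀ F G : X → ℝ, ∫ x, c x * F x * G x ∂ν = ∫ x in Ω, c x * F x * G x ∂ν := by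
    intro F G
    rw [setIntegral_eq_integral_of_forall_compl_eq_zero]
    intro x hx
    simp [hcs x hx]
  simp only [key]
  apply tendsto_integral_mul_of_L2 _ hG _ hG0 _ hGl
  · exact fun n => hcm.aestronglyMeasurable.mul (hF n)
  · exact hF0.of_le_mul (hcm.aestronglyMeasurable.mul hF0.1) (c := C)
      (Eventually.of_forall fun x => by
        rw [norm_mul]; exact mul_le_mul_of_nonneg_right (hc x) (norm_nonneg _))
  · exact tendsto_eLpNorm_mul_bounded hc hFl

/-- Weak form of `∑ X_i X_i u` against the limit of smooth functions. -/
lemma IsS22Limit.weak_form (hγ : 0 < γ) {Ω Ω' : Set (GrushinSpace m k)}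
    {u v : GrushinSpace m k → ℝ}
    {Du Dv : Fin m ⊕ Fin k → GrushinSpace m k → ℝ}
    {D2u : Fin m ⊕ Fin k → Fin m ⊕ Fin k → GrushinSpace m k → ℝ}
    (hu : IsS22Limit γ Ω u Du D2u) (hv : IsHorizLimit γ Ω' v Dv)
    {η : GrushinSpace m k → ℝ} (hη : ContDiff ℝ 1 η) (hηc : HasCompactSupport η)
    (hηs : tsupport η ⊆ Ω ∩ Ω') (i : Fin m ⊕ Fin k) :
    ∫ p, η p * D2u i i p * v p = -(∫ p, η p * Du i p * Dv i p) -
      ∫ p, grushinX γ i η p * Du i p * v p := by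
  obtain ⟨f, hf, hf0, hf1, hf2⟩ := hu.exists_seq
  obtain ⟨g, hg, hg0, hg1⟩ := hv.exists_seq
  have hX := continuous_grushinX hγ hη i
  have hXs : Function.support (grushinX γ i η) ⊆ tsupport η := by
    intro p hp
    by_contra h
    have h0 : fderiv ℝ η p = 0 := by
      by_contra h1
      exact h (support_fderiv_subset ℝ h1)
    apply hp
    rcases i with i | j <;> simp [grushinX, h0]
  have hXc : HasCompactSupport (grushinX γ i η) :=
    hηc.mono' hXs
  obtain ⟨C1, hC1⟩ := hη.continuous.bounded_above_of_compact_support hηc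
  obtain ⟨C2, hC2⟩ := hX.bounded_above_of_compact_support hXc
  have hs1 : ∀ x, x ∉ Ω ∩ Ω' → η x = 0 := fun x hx =>
    image_eq_zero_of_notMem_tsupport fun h => hx (hηs h)
  have hs2 : ∀ x, x ∉ Ω ∩ Ω' → grushinX γ i η x = 0 := fun x hx => by
    by_contra h
    exact hx (hηs (hXs h))
  have hL : Ω ∩ Ω' ⊆ Ω := Set.inter_subset_left
  have hR : Ω ∩ Ω' ⊆ Ω' := Set.inter_subset_right
  have hf1' : ∀ n, ContDiff ℝ 1 (f n) := fun n => (hf n).of_le (by exact_mod_cast le_top)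
  have hg1' : ∀ n, ContDiff ℝ 1 (g n) := fun n => (hg n).of_le (by exact_mod_cast le_top)
  have l1 := tendsto_integral_mul_mul_of_L2 (ν := volume) hC1 hη.continuous.measurable hs1
    (fun n => (continuous_grushinX_grushinX hγ (hf n) i).aestronglyMeasurable)
    (fun n => (hg n).continuous.aestronglyMeasurable)
    ((hu.memLp_D2 i i).mono_measure (Measure.restrict_mono hL le_rfl))
    (hv.memLp.mono_measure (Measure.restrict_mono hR le_rfl))
    (tendsto_eLpNorm_restrict_mono hL (hf2 i i)) (tendsto_eLpNorm_restrict_mono hR hg0)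
  have l2 := tendsto_integral_mul_mul_of_L2 (ν := volume) hC1 hη.continuous.measurable hs1
    (fun n => (continuous_grushinX hγ (hf1' n) i).aestronglyMeasurable)
    (fun n => (continuous_grushinX hγ (hg1' n) i).aestronglyMeasurable)
    ((hu.memLp_D i).mono_measure (Measure.restrict_mono hL le_rfl))
    ((hv.memLp_D i).mono_measure (Measure.restrict_mono hR le_rfl))
    (tendsto_eLpNorm_restrict_mono hL (hf1 i)) (tendsto_eLpNorm_restrict_mono hR (hg1 i))
  have l3 := tendsto_integral_mul_mul_of_L2 (ν := volume) hC2 hX.measurable hs2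
    (fun n => (continuous_grushinX hγ (hf1' n) i).aestronglyMeasurable)
    (fun n => (hg n).continuous.aestronglyMeasurable)
    ((hu.memLp_D i).mono_measure (Measure.restrict_mono hL le_rfl))
    (hv.memLp.mono_measure (Measure.restrict_mono hR le_rfl))
    (tendsto_eLpNorm_restrict_mono hL (hf1 i)) (tendsto_eLpNorm_restrict_mono hR hg0)
  -- For the approximants this is classical integration by parts against η g_n; the product rule for
  -- X_i(η g_n) gives the two terms on the right. Each of the three integrals converges as an L²
  -- pairing with a bounded, compactly supported factor.
  refine tendsto_nhds_unique l1 ((l2.neg.sub l3).congr fun n => ?_)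
  have hG : ContDiff ℝ 1 fun p => η p * g n p := hη.mul (hg1' n)
  have hb := integral_grushinX_grushinX_mul hγ (hf n) hG hηc.mul_right i
  have hcx := continuous_grushinX hγ (hf1' n) i
  have hcy := continuous_grushinX hγ (hg1' n) i
  have e1 : ∫ p, η p * grushinX γ i (grushinX γ i (f n)) p * g n p =
      ∫ p, grushinX γ i (grushinX γ i (f n)) p * (η p * g n p) := by
    congr 1; ext p; ring
  rw [e1, hb]
  have e2 : ∀ p, grushinX γ i (f n) p * grushinX γ i (fun p => η p * g n p) p =
      η p * grushinX γ i (f n) p * grushinX γ i (g n) p +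
      grushinX γ i η p * grushinX γ i (f n) p * g n p := by
    intro p
    rw [grushinX_mul (hη.differentiable one_ne_zero p) ((hg1' n).differentiable one_ne_zero p)]
    ring
  simp only [e2]
  rw [integral_add]
  · ring
  · exact ((hη.continuous.mul hcx).mul hcy).integrable_of_hasCompactSupport
      (hηc.mul_right.mul_right)
  · exact ((hX.mul hcx).mul (hg n).continuous).integrable_of_hasCompactSupport
      (hXc.mul_right.mul_right)

end

/-! ### Annuli, radial functions and differentiation along a measure-preserving flow. -/

noncomputable section

variable {m k : ℕ} {γ : ℝ}

/-- The open gauge annulus `e^a < ρ < e^b`. -/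
def annulus (γ a b : ℝ) : Set (GrushinSpace m k) :=
  {p | p ≠ 0 ∧ a < logGauge γ p ∧ logGauge γ p < b}

lemma measurableSet_annulus (hγ : 0 < γ) (a b : ℝ) :
    MeasurableSet (annulus γ a b : Set (GrushinSpace m k)) :=
  (MeasurableSet.singleton _).compl.inter
    ((measurableSet_lt measurable_const (measurable_logGauge hγ)).inter
      (measurableSet_lt (measurable_logGauge hγ) measurable_const))

lemma dil_mem_annulus (hγ : 0 < γ) {a b a' b' h : ℝ} (ha : a' ≤ a + h) (hb : b + h ≤ b')
    {p : GrushinSpace m k} (hp : p ∈ annulus γ a b) : dil γ h p ∈ annulus γ a' b' := by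
  refine ⟨dil_ne_zero h hp.1, ?_, ?_⟩ <;> rw [logGauge_dil hγ h hp.1]
  · linarith [hp.2.1]
  · linarith [hp.2.2]

lemma preimage_dil_annulus (hγ : 0 < γ) (a b h : ℝ) :
    dil γ h ⁻¹' (annulus γ a b : Set (GrushinSpace m k)) = annulus γ (a - h) (b - h) := by
  ext p
  constructor
  · intro hp
    have := dil_mem_annulus hγ (h := -h) (a' := a - h) (b' := b - h) (by linarith) (by linarith) hp
    rwa [dil_neg_dil] at this
  · intro hp
    exact dil_mem_annulus hγ (by linarith) (by linarith) hp

lemma isBounded_gaugeBall (hγ : 0 < γ) (r : ℝ) :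
    Bornology.IsBounded (gaugeBall γ r : Set (GrushinSpace m k)) := by
  rw [isBounded_iff_forall_norm_le]
  refine ⟨max r (r ^ (γ + 1)), fun p hp => ?_⟩
  have hp : grushinGauge γ p < r := hp
  rw [Prod.norm_def]
  refine max_le_max ((norm_fst_le_gauge hγ p).trans hp.le) ((norm_snd_le_gauge hγ p).trans ?_)
  exact Real.rpow_le_rpow (grushinGauge_nonneg hγ p) hp.le (by positivity)

lemma annulus_subset_gaugeBall (hγ : 0 < γ) (a b : ℝ) :
    (annulus γ a b : Set (GrushinSpace m k)) ⊆ gaugeBall γ (Real.exp b) := by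
  intro p hp
  change grushinGauge γ p < _
  rw [← exp_logGauge hγ hp.1]
  exact Real.exp_lt_exp.2 hp.2.2

lemma measurableSet_gaugeBall (hγ : 0 < γ) (r : ℝ) :
    MeasurableSet (gaugeBall γ r : Set (GrushinSpace m k)) :=
  (isOpen_lt (continuous_grushinGauge hγ) continuous_const).measurableSet

lemma volume_gaugeBall_lt_top (hγ : 0 < γ) (r : ℝ) :
    volume (gaugeBall γ r : Set (GrushinSpace m k)) < ⊤ :=
  (isBounded_gaugeBall hγ r).measure_lt_top

lemma isCompact_closedShell (hγ : 0 < γ) (a b : ℝ) :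
    IsCompact {p : GrushinSpace m k | Real.exp a ≤ grushinGauge γ p ∧
      grushinGauge γ p ≤ Real.exp b} := by
  apply Metric.isCompact_of_isClosed_isBounded
  · exact (isClosed_le continuous_const (continuous_grushinGauge hγ)).inter
      (isClosed_le (continuous_grushinGauge hγ) continuous_const)
  · apply (isBounded_gaugeBall hγ (Real.exp b + 1)).subset
    intro p hp
    exact lt_of_le_of_lt hp.2 (by linarith)

/-- Because log 0 is 0 by convention, the origin carries the value s = 0 of the unit gauge sphere.
This is why annuli exclude the origin explicitly and why radial cutoffs are required to be supported
in s ≤ b with b < 0. -/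
lemma logGauge_zero (hγ : 0 < γ) : logGauge γ (0 : GrushinSpace m k) = 0 := by
  rw [logGauge, grushinGauge_zero hγ, Real.log_zero]

section Radial

variable {H : ℝ → ℝ} {a b : ℝ}

lemma support_radial_subset (hγ : 0 < γ) (hb : b < 0) (hHs : ∀ s, s ∉ Set.Icc a b → H s = 0) :
    Function.support (fun p : GrushinSpace m k => H (logGauge γ p)) ⊆
      {p | Real.exp a ≤ grushinGauge γ p ∧ grushinGauge γ p ≤ Real.exp b} := by
  intro p hp
  have h1 : logGauge γ p ∈ Set.Icc a b := by
    by_contra h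
    exact hp (hHs _ h)
  have h0 : p ≠ 0 := by
    rintro rfl
    rw [logGauge_zero hγ] at h1
    linarith [h1.2]
  rw [Set.mem_ofPred_eq, ← exp_logGauge hγ h0]
  exact ⟨Real.exp_le_exp.2 h1.1, Real.exp_le_exp.2 h1.2⟩

lemma tsupport_radial_subset (hγ : 0 < γ) (hb : b < 0)
    (hHs : ∀ s, s ∉ Set.Icc a b → H s = 0) :
    tsupport (fun p : GrushinSpace m k => H (logGauge γ p)) ⊆
      {p | Real.exp a ≤ grushinGauge γ p ∧ grushinGauge γ p ≤ Real.exp b} :=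
  closure_minimal (support_radial_subset hγ hb hHs) (isCompact_closedShell hγ a b).isClosed

lemma closedShell_subset_annulus (hγ : 0 < γ) {a' b' : ℝ} (ha : a' < a) (hb : b < b') :
    {p : GrushinSpace m k | Real.exp a ≤ grushinGauge γ p ∧ grushinGauge γ p ≤ Real.exp b} ⊆
      annulus γ a' b' := by
  intro p hp
  have h0 : p ≠ 0 := by
    rintro rfl
    have := hp.1
    rw [grushinGauge_zero hγ] at this
    linarith [Real.exp_pos a]
  have hp1 := hp.1
  have hp2 := hp.2
  rw [← exp_logGauge hγ h0] at hp1 hp2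
  refine ⟨h0, ?_, ?_⟩
  · linarith [Real.exp_le_exp.1 hp1]
  · linarith [Real.exp_le_exp.1 hp2]

lemma hasCompactSupport_radial (hγ : 0 < γ) (hb : b < 0)
    (hHs : ∀ s, s ∉ Set.Icc a b → H s = 0) :
    HasCompactSupport (fun p : GrushinSpace m k => H (logGauge γ p)) :=
  (isCompact_closedShell hγ a b).of_isClosed_subset (isClosed_tsupport _)
    (tsupport_radial_subset hγ hb hHs)

lemma radial_eventually_zero (hγ : 0 < γ) (hb : b < 0)
    (hHs : ∀ s, s ∉ Set.Icc a b → H s = 0) :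
    (fun p : GrushinSpace m k => H (logGauge γ p)) =ᶠ[𝓝 0] fun _ => 0 := by
  refine notMem_tsupport_iff_eventuallyEq.1 fun h => ?_
  have := tsupport_radial_subset hγ hb hHs h
  have h1 := this.1
  rw [grushinGauge_zero hγ] at h1
  linarith [Real.exp_pos a]

/-- Off the origin log ρ is C¹, and near the origin the composition vanishes identically. -/
lemma contDiff_radial (hγ : 0 < γ) (hb : b < 0) (hH : ContDiff ℝ 1 H)
    (hHs : ∀ s, s ∉ Set.Icc a b → H s = 0) :
    ContDiff ℝ 1 (fun p : GrushinSpace m k => H (logGauge γ p)) := by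
  rw [contDiff_iff_contDiffAt]
  intro p
  by_cases hp : p = 0
  · subst hp
    exact contDiffAt_const.congr_of_eventuallyEq (radial_eventually_zero hγ hb hHs)
  · exact ContDiffAt.comp p hH.contDiffAt (contDiffAt_logGauge hγ hp)

lemma gradLogGauge_zero (i : Fin m ⊕ Fin k) :
    gradLogGauge γ i (0 : GrushinSpace m k) = 0 := by
  rcases i with i | j <;> simp [gradLogGauge]

lemma grushinX_radial (hγ : 0 < γ) (hb : b < 0) (hH : ContDiff ℝ 1 H)
    (hHs : ∀ s, s ∉ Set.Icc a b → H s = 0) (i : Fin m ⊕ Fin k) (p : GrushinSpace m k) :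
    grushinX γ i (fun p : GrushinSpace m k => H (logGauge γ p)) p =
      deriv H (logGauge γ p) * gradLogGauge γ i p := by
  by_cases hp : p = 0
  · subst hp
    have h := (radial_eventually_zero (m := m) (k := k) hγ hb hHs).fderiv_eq (𝕜 := ℝ)
    rw [gradLogGauge_zero]
    rcases i with i | j <;> simp [grushinX, h]
  · rw [← grushinX_logGauge hγ hp]
    have h1 : DifferentiableAt ℝ (logGauge γ) p :=
      (contDiffAt_logGauge hγ hp).differentiableAt one_ne_zero
    have h2 : HasDerivAt H (deriv H (logGauge γ p)) (logGauge γ p) :=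
      (hH.differentiable one_ne_zero _).hasDerivAt
    have h : fderiv ℝ (fun p : GrushinSpace m k => H (logGauge γ p)) p =
        deriv H (logGauge γ p) • fderiv ℝ (logGauge γ) p :=
      (h2.comp_hasFDerivAt p h1.hasFDerivAt).fderiv
    rcases i with i | j
    · simp [grushinX, h]
    · simp only [grushinX, h]
      simp
      ring

end Radial

/-- The dilation derivative under the integral sign, for limits in `L²` of differentiable
functions along a measure preserving flow. -/
lemma hasDerivAt_integral_mul_flow {X : Type*} [MeasurableSpace X] {μ : Measure X}
    {T : ℝ → X → X} (hT : ∀ h, MeasurePreserving (T h) μ μ) {A0 A1 : Set X}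
    (hA0 : MeasurableSet A0) {ε : ℝ}
    (hA : ∀ h ∈ Set.Ioo (-ε) ε, ∀ p ∈ A1, T h p ∈ A0) {Φ : X → ℝ} (hΦ : MemLp Φ 2 μ)
    (hΦ1 : Integrable Φ μ) (hΦ0 : ∀ p, p ∉ A1 → Φ p = 0) {Yn Zn : ℕ → X → ℝ}
    (hYm : ∀ n, Measurable (Yn n)) (hZm : ∀ n, Measurable (Zn n))
    (hYb : ∀ n, ∃ C, ∀ p ∈ A0, |Yn n p| ≤ C) (hZb : ∀ n, ∃ C, ∀ p ∈ A0, |Zn n p| ≤ C)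
    (hder : ∀ n, ∀ p ∈ A1, ∀ h ∈ Set.Ioo (-ε) ε,
      HasDerivAt (fun h => Yn n (T h p)) (Zn n (T h p)) h)
    {Y Ys : X → ℝ} (hY : MemLp Y 2 μ) (hYs : MemLp Ys 2 μ)
    (hYl : Tendsto (fun n => eLpNorm (Yn n - Y) 2 (μ.restrict A0)) atTop (𝓝 0))
    (hZl : Tendsto (fun n => eLpNorm (Zn n - Ys) 2 (μ.restrict A0)) atTop (𝓝 0))
    {h : ℝ} (hh : h ∈ Set.Ioo (-ε) ε) :
    HasDerivAt (fun h => ∫ x, Φ x * Y (T h x) ∂μ) (∫ x, Φ x * Ys (T h x) ∂μ) h := by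
  have hint : ∀ P : X → ℝ, Measurable P → (∃ C, ∀ p ∈ A0, |P p| ≤ C) → ∀ h ∈ Set.Ioo (-ε) ε,
      Integrable (fun x => Φ x * P (T h x)) μ := by
    rintro P hP ⟨C, hC⟩ h hh
    refine (hΦ1.norm.const_mul C).mono'
      (hΦ1.1.mul (hP.comp (hT h).measurable).aestronglyMeasurable) (Eventually.of_forall fun x => ?_)
    by_cases hx : x ∈ A1
    · rw [norm_mul, mul_comm]
      exact mul_le_mul_of_nonneg_right (hC _ (hA h hh x hx)) (norm_nonneg _)
    · simp [hΦ0 x hx]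
  -- Cauchy–Schwarz and invariance of the measure give a bound that does not depend on h. The
  -- derivatives of the approximating pairings therefore converge uniformly on (-ε, ε), which is
  -- what allows differentiation of the limit.
  have hest : ∀ P Q : X → ℝ, Measurable P → (∃ C, ∀ p ∈ A0, |P p| ≤ C) → MemLp Q 2 μ →
      eLpNorm (P - Q) 2 (μ.restrict A0) < ⊤ → ∀ h ∈ Set.Ioo (-ε) ε,
      |∫ x, Φ x * P (T h x) ∂μ - ∫ x, Φ x * Q (T h x) ∂μ| ≤
        (eLpNorm Φ 2 μ * eLpNorm (P - Q) 2 (μ.restrict A0)).toReal := by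
    intro P Q hP hPb hQ hfin h hh
    have hQi : Integrable (fun x => Φ x * Q (T h x)) μ :=
      hΦ.integrable_mul_two (hQ.comp_measurePreserving (hT h))
    rw [← integral_sub (hint P hP hPb h hh) hQi]
    -- Convergence is known only on A0. Since Φ lives on A1 and the flow sends A1 into A0, the
    -- difference may be cut off to A0 before the change of variables.
    set D : X → ℝ := A0.indicator (P - Q) with hD
    have e : ∀ x, Φ x * P (T h x) - Φ x * Q (T h x) = Φ x * (D ∘ T h) x := by
      intro x
      by_cases hx : x ∈ A1
      · simp [hD, Set.indicator_of_mem (hA h hh x hx), mul_sub]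
      · simp [hΦ0 x hx]
    simp only [e]
    have hDm : AEStronglyMeasurable D μ :=
      (hP.aestronglyMeasurable.sub hQ.1).indicator hA0
    have hDn : eLpNorm (D ∘ T h) 2 μ = eLpNorm (P - Q) 2 (μ.restrict A0) := by
      rw [eLpNorm_comp_measurePreserving hDm (hT h), hD,
        eLpNorm_indicator_eq_eLpNorm_restrict hA0]
    have hDm' : AEStronglyMeasurable (D ∘ T h) μ := hDm.comp_measurePreserving (hT h)
    have h1 : AEStronglyMeasurable (fun x => Φ x * (D ∘ T h) x) μ := hΦ.1.mul hDm'
    rw [← Real.norm_eq_abs]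
    refine (norm_integral_le_integral_norm _).trans ?_
    rw [integral_norm_eq_lintegral_enorm h1, ← eLpNorm_one_eq_lintegral_enorm]
    apply ENNReal.toReal_mono (ENNReal.mul_ne_top hΦ.2.ne hfin.ne)
    rw [← hDn]
    exact eLpNorm_mul_one_le hΦ.1 hDm'
  have hlim : ∀ {P : ℕ → X → ℝ} {Q : X → ℝ},
      Tendsto (fun n => eLpNorm (P n - Q) 2 (μ.restrict A0)) atTop (𝓝 0) →
      Tendsto (fun n => (eLpNorm Φ 2 μ * eLpNorm (P n - Q) 2 (μ.restrict A0)).toReal) atTop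
        (𝓝 0) := by
    intro P Q hPQ
    have := ENNReal.Tendsto.const_mul (a := eLpNorm Φ 2 μ) hPQ (Or.inr hΦ.2.ne)
    rw [mul_zero] at this
    exact (ENNReal.tendsto_toReal ENNReal.zero_ne_top).comp this
  refine hasDerivAt_of_tendstoUniformlyOn (l := atTop) (s := Set.Ioo (-ε) ε) isOpen_Ioo
    (f := fun n h => ∫ x, Φ x * Yn n (T h x) ∂μ) (f' := fun n h => ∫ x, Φ x * Zn n (T h x) ∂μ)
    (g' := fun h => ∫ x, Φ x * Ys (T h x) ∂μ) ?_ ?_ ?_ hh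
  · rw [Metric.tendstoUniformlyOn_iff]
    intro δ hδ
    filter_upwards [(hlim hZl).eventually (gt_mem_nhds hδ),
      hZl.eventually (gt_mem_nhds ENNReal.zero_lt_top)] with n hn hn2 h hh
    rw [dist_comm, Real.dist_eq]
    exact (hest _ _ (hZm n) (hZb n) hYs hn2 h hh).trans_lt hn
  · refine Eventually.of_forall fun n h hh => ?_
    obtain ⟨C, hC⟩ := hZb n
    have hn := isOpen_Ioo.mem_nhds hh
    refine (hasDerivAt_integral_of_dominated_loc_of_deriv_le (bound := fun x => C * ‖Φ x‖)
      (F := fun h x => Φ x * Yn n (T h x)) (F' := fun h x => Φ x * Zn n (T h x)) hn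
      ?_ ?_ ?_ ?_ ?_ ?_).2
    · filter_upwards [hn] with h' hh' using (hint _ (hYm n) (hYb n) h' hh').1
    · exact hint _ (hYm n) (hYb n) h hh
    · exact (hint _ (hZm n) (hZb n) h hh).1
    · refine Eventually.of_forall fun x h' hh' => ?_
      by_cases hx : x ∈ A1
      · rw [norm_mul, mul_comm]
        exact mul_le_mul_of_nonneg_right (hC _ (hA h' hh' x hx)) (norm_nonneg _)
      · simp [hΦ0 x hx]
    · exact hΦ1.norm.const_mul C
    · refine Eventually.of_forall fun x h' hh' => ?_
      by_cases hx : x ∈ A1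
      · exact (hder n x hx h' hh').const_mul _
      · simpa [hΦ0 x hx] using hasDerivAt_const h' (0 : ℝ)
  · intro h hh
    rw [tendsto_iff_dist_tendsto_zero]
    refine squeeze_zero' (Eventually.of_forall fun n => dist_nonneg) ?_ (hlim hYl)
    filter_upwards [hYl.eventually (gt_mem_nhds ENNReal.zero_lt_top)] with n hn2
    rw [Real.dist_eq]
    exact hest _ _ (hYm n) (hYb n) hY hn2 h hh

end

/-! ### Weighted L² bounds and the derivative along dilations. -/

noncomputable section

variable {m k : ℕ} {γ : ℝ}

lemma eLpNorm_invMeasure_restrict (hγ : 0 < γ) {A : Set (GrushinSpace m k)} (hA : MeasurableSet A)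
    (Y : GrushinSpace m k → ℝ) :
    eLpNorm Y 2 ((invMeasure m k γ).restrict A) =
      eLpNorm (fun p => √(invDensity γ p) * Y p) 2 (volume.restrict A) := by
  rw [eLpNorm_eq_lintegral_rpow_enorm_toReal (by norm_num) (by norm_num),
    eLpNorm_eq_lintegral_rpow_enorm_toReal (by norm_num) (by norm_num), invMeasure,
    restrict_withDensity hA, lintegral_withDensity_eq_lintegral_mul_non_measurable _
      (measurable_invDensity hγ).ennreal_ofReal (by simp)]
  congr 1
  apply lintegral_congr
  intro p
  simp only [Pi.mul_apply, enorm_mul, ENNReal.toReal_ofNat]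
  rw [ENNReal.mul_rpow_of_nonneg _ _ (by norm_num)]
  congr 1
  rw [Real.enorm_eq_ofReal (Real.sqrt_nonneg _), ENNReal.ofReal_rpow_of_nonneg (Real.sqrt_nonneg _)
    (by norm_num)]
  congr 1
  norm_num [Real.sq_sqrt (invDensity_nonneg hγ p)]

lemma eLpNorm_invMeasure_le (hγ : 0 < γ) {A : Set (GrushinSpace m k)} (hA : MeasurableSet A)
    {Y g : GrushinSpace m k → ℝ} {C : ℝ}
    (h : ∀ᵐ p ∂(volume.restrict A), √(invDensity γ p) * |Y p| ≤ C * |g p|) :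
    eLpNorm Y 2 ((invMeasure m k γ).restrict A) ≤
      ENNReal.ofReal C * eLpNorm g 2 (volume.restrict A) := by
  rw [eLpNorm_invMeasure_restrict hγ hA]
  apply eLpNorm_le_mul_eLpNorm_of_ae_le_mul
  filter_upwards [h] with p hp
  rwa [norm_mul, Real.norm_of_nonneg (Real.sqrt_nonneg _)]

lemma invMeasure_absolutelyContinuous :
    invMeasure m k γ ≪ (volume : Measure (GrushinSpace m k)) :=
  withDensity_absolutelyContinuous _ _

lemma memLp_invMeasure_indicator (hγ : 0 < γ) {A : Set (GrushinSpace m k)} (hA : MeasurableSet A)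
    {Y g : GrushinSpace m k → ℝ} {C : ℝ} (hY : AEStronglyMeasurable Y (volume.restrict A))
    (hg : MemLp g 2 (volume.restrict A))
    (h : ∀ᵐ p ∂(volume.restrict A), √(invDensity γ p) * |Y p| ≤ C * |g p|) :
    MemLp (A.indicator Y) 2 (invMeasure m k γ) := by
  rw [memLp_indicator_iff_restrict hA]
  refine ⟨hY.mono_ac (invMeasure_absolutelyContinuous.restrict A), ?_⟩
  exact (eLpNorm_invMeasure_le hγ hA h).trans_lt (ENNReal.mul_lt_top ENNReal.ofReal_lt_top hg.2)

lemma ae_annulus_mem (hγ : 0 < γ) (a b : ℝ) (ν : Measure (GrushinSpace m k)) :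
    ∀ᵐ p ∂(ν.restrict (annulus γ a b)), p ∈ (annulus γ a b : Set (GrushinSpace m k)) :=
  ae_restrict_mem (measurableSet_annulus hγ a b)

lemma exists_bound_radial {H : ℝ → ℝ} (hH : Continuous H) (a b : ℝ) :
    ∃ C, 0 ≤ C ∧ ∀ p ∈ (annulus γ a b : Set (GrushinSpace m k)), |H (logGauge γ p)| ≤ C := by
  obtain ⟨C, hC⟩ := (isCompact_Icc (a := a) (b := b)).exists_bound_of_continuousOn hH.continuousOn
  refine ⟨max C 0, le_max_right _ _, fun p hp => ?_⟩
  exact (hC _ ⟨hp.2.1.le, hp.2.2.le⟩).trans (le_max_left _ _)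

/-- On an annulus the powers of ρ are bounded. The factor √weight is kept instead of being bounded
as well, because it pays for the division by the weight in `dilDeriv`. -/
lemma exists_sqrt_invDensity_le (a b : ℝ) :
    ∃ C, 0 ≤ C ∧ ∀ p ∈ (annulus γ a b : Set (GrushinSpace m k)),
      √(invDensity γ p) ≤ C * √(gaugeWeight γ p) := by
  obtain ⟨C, hC0, hC⟩ := exists_bound_radial (m := m) (k := k) (γ := γ)
    (H := fun s => √(Real.exp (-2 * halfDim m k γ * s))) (by fun_prop) a b
  refine ⟨C, hC0, fun p hp => ?_⟩
  rw [invDensity, Real.sqrt_mul' _ (Real.exp_nonneg _), mul_comm]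
  exact mul_le_mul_of_nonneg_right ((le_abs_self _).trans (hC p hp)) (Real.sqrt_nonneg _)

lemma exists_sqrt_gaugeWeight_le (hγ : 0 < γ) (a b : ℝ) :
    ∃ C, 0 ≤ C ∧ ∀ p ∈ (annulus γ a b : Set (GrushinSpace m k)), √(gaugeWeight γ p) ≤ C := by
  refine ⟨√(Real.exp (-2 * a)), Real.sqrt_nonneg _, fun p hp => Real.sqrt_le_sqrt ?_⟩
  refine (gaugeWeight_le hγ hp.1).trans (Real.exp_le_exp.2 ?_)
  linarith [hp.2.1]

lemma abs_gradLogGauge_le (hγ : 0 < γ) (i : Fin m ⊕ Fin k) (p : GrushinSpace m k) :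
    |gradLogGauge γ i p| ≤ √(gaugeWeight γ p) := by
  rw [← sum_gradLogGauge_sq hγ]
  apply Real.abs_le_sqrt
  exact Finset.single_le_sum (f := fun i => gradLogGauge γ i p ^ 2) (fun i _ => sq_nonneg _)
    (Finset.mem_univ i)

lemma measurable_gradLogGauge (hγ : 0 < γ) (i : Fin m ⊕ Fin k) :
    Measurable (gradLogGauge γ i : GrushinSpace m k → ℝ) := by
  have h1 := (continuous_norm_fst_rpow (m := m) (k := k) hγ).measurable
  have h2 := (continuous_norm_fst_rpow (m := m) (k := k) (γ := 2 * γ) (by positivity)).measurable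
  have h3 := (continuous_gaugePow (m := m) (k := k) hγ).measurable
  rcases i with i | j
  · refine (h2.mul ?_).div h3
    exact Continuous.measurable (by fun_prop)
  · refine (h1.mul ?_).div h3
    exact Continuous.measurable (by fun_prop)

/-- The derivative along the dilations, expressed through the horizontal gradient. -/
def dilDeriv (γ : ℝ) (D : Fin m ⊕ Fin k → GrushinSpace m k → ℝ) (p : GrushinSpace m k) : ℝ :=
  (∑ i, gradLogGauge γ i p * D i p) / gaugeWeight γ p

/-- The gradient of log ρ has length √weight, so one such factor comes from the numerator of
`dilDeriv` and the other is supplied on the left. Where the weight is zero, division by zero makes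
the left side zero. -/
lemma sqrt_gaugeWeight_mul_dilDeriv_le (hγ : 0 < γ)
    (D : Fin m ⊕ Fin k → GrushinSpace m k → ℝ) (p : GrushinSpace m k) :
    √(gaugeWeight γ p) * |dilDeriv γ D p| ≤ ∑ i, |D i p| := by
  have hW := gaugeWeight_nonneg hγ p
  have h1 : |∑ i, gradLogGauge γ i p * D i p| ≤ √(gaugeWeight γ p) * ∑ i, |D i p| := by
    rw [Finset.mul_sum]
    refine (Finset.abs_sum_le_sum_abs _ _).trans (Finset.sum_le_sum fun i _ => ?_)
    rw [abs_mul]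
    exact mul_le_mul_of_nonneg_right (abs_gradLogGauge_le hγ i p) (abs_nonneg _)
  have h0 : 0 ≤ ∑ i, |D i p| := Finset.sum_nonneg fun _ _ => abs_nonneg _
  rw [dilDeriv, abs_div, abs_of_nonneg hW]
  rcases hW.eq_or_lt with h | h
  · simpa [← h] using h0
  · rw [mul_div_assoc', div_le_iff₀ h]
    calc _ ≤ √(gaugeWeight γ p) * (√(gaugeWeight γ p) * ∑ i, |D i p|) := by gcongr
      _ = _ := by rw [← mul_assoc, Real.mul_self_sqrt hW, mul_comm]

/-- Cauchy–Schwarz: the left side is the energy of the component of the horizontal gradient along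
the gradient of log ρ. -/
lemma gaugeWeight_mul_dilDeriv_sq_le (hγ : 0 < γ)
    (D : Fin m ⊕ Fin k → GrushinSpace m k → ℝ) (p : GrushinSpace m k) :
    gaugeWeight γ p * dilDeriv γ D p ^ 2 ≤ ∑ i, D i p ^ 2 := by
  have hW := gaugeWeight_nonneg hγ p
  have h1 := Finset.sum_mul_sq_le_sq_mul_sq Finset.univ (fun i => gradLogGauge γ i p)
    (fun i => D i p)
  rw [sum_gradLogGauge_sq hγ] at h1
  have h0 : 0 ≤ ∑ i, D i p ^ 2 := Finset.sum_nonneg fun _ _ => sq_nonneg _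
  rw [dilDeriv, div_pow]
  rcases hW.eq_or_lt with h | h
  · simpa [← h] using h0
  · rw [sq (gaugeWeight γ p), mul_div_assoc', mul_div_mul_left _ _ h.ne', div_le_iff₀ h]
    linarith

lemma dilDeriv_grushinX (hγ : 0 < γ) (f : GrushinSpace m k → ℝ) {p : GrushinSpace m k}
    (hp : p.1 ≠ 0) :
    dilDeriv γ (fun i => grushinX γ i f) p = fderiv ℝ f p (dilField γ p) := by
  rw [dilDeriv, sum_gradLogGauge_mul_grushinX hγ, mul_div_cancel_left₀ _ (gaugeWeight_pos hγ hp).ne']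

lemma dilDeriv_sub (D D' : Fin m ⊕ Fin k → GrushinSpace m k → ℝ) (p : GrushinSpace m k) :
    dilDeriv γ (fun i => D i - D' i) p = dilDeriv γ D p - dilDeriv γ D' p := by
  simp only [dilDeriv, Pi.sub_apply, mul_sub, Finset.sum_sub_distrib, sub_div]

lemma aestronglyMeasurable_dilDeriv (hγ : 0 < γ) {ν : Measure (GrushinSpace m k)}
    {D : Fin m ⊕ Fin k → GrushinSpace m k → ℝ} (hD : ∀ i, AEStronglyMeasurable (D i) ν) :
    AEStronglyMeasurable (dilDeriv γ D) ν := by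
  refine AEMeasurable.aestronglyMeasurable ?_
  refine AEMeasurable.div ?_ (measurable_gaugeWeight hγ).aemeasurable
  exact Finset.aemeasurable_fun_sum _ fun i _ =>
    (measurable_gradLogGauge hγ i).aemeasurable.mul (hD i).aemeasurable

lemma memLp_sum_abs {Ω : Set (GrushinSpace m k)} {D : Fin m ⊕ Fin k → GrushinSpace m k → ℝ}
    (hD : ∀ i, MemLp (D i) 2 (volume.restrict Ω)) :
    MemLp (fun p => ∑ i, |D i p|) 2 (volume.restrict Ω) :=
  memLp_finsetSum _ fun i _ => (hD i).abs

section

variable {a b : ℝ} {u : GrushinSpace m k → ℝ} {Du : Fin m ⊕ Fin k → GrushinSpace m k → ℝ}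

lemma memLp_radial_mul (hγ : 0 < γ) (hu : MemLp u 2 (volume.restrict (annulus γ a b)))
    {H : ℝ → ℝ} (hH : Continuous H) :
    MemLp ((annulus γ a b).indicator fun p => H (logGauge γ p) * u p) 2 (invMeasure m k γ) := by
  obtain ⟨C1, hC1, h1⟩ := exists_sqrt_invDensity_le (m := m) (k := k) (γ := γ) a b
  obtain ⟨C2, hC2, h2⟩ := exists_sqrt_gaugeWeight_le (m := m) (k := k) hγ a b
  obtain ⟨C3, hC3, h3⟩ := exists_bound_radial (m := m) (k := k) (γ := γ) hH a b
  refine memLp_invMeasure_indicator hγ (measurableSet_annulus hγ a b) (C := C1 * C2 * C3)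
    ((hH.measurable.comp (measurable_logGauge hγ)).aestronglyMeasurable.mul hu.1) hu ?_
  filter_upwards [ae_annulus_mem hγ a b volume] with p hp
  rw [abs_mul, ← mul_assoc]
  gcongr
  · exact (h1 p hp).trans (by gcongr; exact h2 p hp)
  · exact h3 p hp

lemma memLp_radial_mul_dilDeriv (hγ : 0 < γ)
    (hDu : ∀ i, MemLp (Du i) 2 (volume.restrict (annulus γ a b)))
    {H : ℝ → ℝ} (hH : Continuous H) :
    MemLp ((annulus γ a b).indicator fun p => H (logGauge γ p) * dilDeriv γ Du p) 2
      (invMeasure m k γ) := by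
  obtain ⟨C1, hC1, h1⟩ := exists_sqrt_invDensity_le (m := m) (k := k) (γ := γ) a b
  obtain ⟨C3, hC3, h3⟩ := exists_bound_radial (m := m) (k := k) (γ := γ) hH a b
  refine memLp_invMeasure_indicator hγ (measurableSet_annulus hγ a b) (C := C1 * C3)
    ((hH.measurable.comp (measurable_logGauge hγ)).aestronglyMeasurable.mul
      (aestronglyMeasurable_dilDeriv hγ fun i => (hDu i).1)) (memLp_sum_abs hDu) ?_
  filter_upwards [ae_annulus_mem hγ a b volume] with p hp
  rw [abs_mul]
  calc √(invDensity γ p) * (|H (logGauge γ p)| * |dilDeriv γ Du p|)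
      ≤ (C1 * √(gaugeWeight γ p)) * (C3 * |dilDeriv γ Du p|) := by
        gcongr
        · exact h1 p hp
        · exact h3 p hp
    _ = C1 * C3 * (√(gaugeWeight γ p) * |dilDeriv γ Du p|) := by ring
    _ ≤ _ := by
        gcongr
        exact (sqrt_gaugeWeight_mul_dilDeriv_le hγ Du p).trans (le_abs_self _)

/-- Square integrability of the constant 1, from `memLp_radial_mul`, is the finiteness of the
measure. -/
lemma invMeasure_annulus_lt_top (hγ : 0 < γ) (a b : ℝ) :
    invMeasure m k γ (annulus γ a b) < ⊤ := by
  have hA := measurableSet_annulus (m := m) (k := k) hγ a b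
  have hv : volume (annulus γ a b : Set (GrushinSpace m k)) < ⊤ :=
    (measure_mono (annulus_subset_gaugeBall hγ a b)).trans_lt (volume_gaugeBall_lt_top hγ _)
  have : Fact (volume (annulus γ a b : Set (GrushinSpace m k)) < ⊤) := ⟨hv⟩
  have h := memLp_radial_mul (a := a) (b := b) hγ (u := fun _ : GrushinSpace m k => (1 : ℝ))
    (memLp_const 1) (H := fun _ => 1) continuous_const
  simp only [mul_one] at h
  rw [memLp_indicator_iff_restrict hA] at h
  have h2 := h.2
  rw [eLpNorm_const' _ (by norm_num) (by norm_num)] at h2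
  simp only [enorm_one, one_mul, Measure.restrict_apply_univ] at h2
  by_contra h3
  have h3 : invMeasure m k γ (annulus γ a b) = ⊤ := by simpa using h3
  rw [h3] at h2
  norm_num at h2

/-- Differentiation along dilations of pairings with radial multiples of `u`. -/
lemma IsHorizLimit.hasDerivAt_integral (hγ : 0 < γ) (hm : 1 ≤ m)
    (hu : IsHorizLimit γ (annulus γ a b) u Du) {ε : ℝ} (hε : 0 < ε) {H : ℝ → ℝ}
    (hH : ContDiff ℝ 1 H) {Φ : GrushinSpace m k → ℝ} (hΦ : MemLp Φ 2 (invMeasure m k γ))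
    (hΦ0 : ∀ p, p ∉ (annulus γ (a + ε) (b - ε) : Set (GrushinSpace m k)) → Φ p = 0) :
    HasDerivAt (fun h => ∫ p, Φ p * (annulus γ a b).indicator
        (fun p => H (logGauge γ p) * u p) (dil γ h p) ∂(invMeasure m k γ))
      (∫ p, Φ p * (annulus γ a b).indicator (fun p => deriv H (logGauge γ p) * u p +
        H (logGauge γ p) * dilDeriv γ Du p) p ∂(invMeasure m k γ)) 0 := by
  obtain ⟨f, hf, hf0, hf1⟩ := hu.exists_seq
  have hA := measurableSet_annulus (m := m) (k := k) hγ a b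
  have hA1 := measurableSet_annulus (m := m) (k := k) hγ (a + ε) (b - ε)
  have hfC1 : ∀ n, ContDiff ℝ 1 (f n) := fun n => (hf n).of_le (by exact_mod_cast le_top)
  have hfd : ∀ n, Continuous fun p => fderiv ℝ (f n) p (dilField γ p) := fun n =>
    ((hfC1 n).continuous_fderiv one_ne_zero).clm_apply
      (by unfold dilField; fun_prop)
  have hHd : Continuous (deriv H) := hH.continuous_deriv le_rfl
  have hS := measurable_logGauge (m := m) (k := k) hγ
  have hbd : ∀ g : GrushinSpace m k → ℝ, Continuous g →
      ∃ C, 0 ≤ C ∧ ∀ p ∈ (annulus γ a b : Set (GrushinSpace m k)), |g p| ≤ C := by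
    intro g hg
    obtain ⟨C, hC⟩ := (isCompact_closedShell (m := m) (k := k) hγ (a - 1)
      (b + 1)).exists_bound_of_continuousOn hg.continuousOn
    refine ⟨max C 0, le_max_right _ _, fun p hp => (hC p ?_).trans (le_max_left _ _)⟩
    rw [Set.mem_ofPred_eq, ← exp_logGauge hγ hp.1]
    exact ⟨Real.exp_le_exp.2 (by linarith [hp.2.1]), Real.exp_le_exp.2 (by linarith [hp.2.2])⟩
  obtain ⟨C1, hC1, h1⟩ := exists_sqrt_invDensity_le (m := m) (k := k) (γ := γ) a b
  obtain ⟨C2, hC2, h2⟩ := exists_sqrt_gaugeWeight_le (m := m) (k := k) hγ a b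
  obtain ⟨C3, hC3, h3⟩ := exists_bound_radial (m := m) (k := k) (γ := γ) hH.continuous a b
  obtain ⟨C4, hC4, h4⟩ := exists_bound_radial (m := m) (k := k) (γ := γ) hHd a b
  set Y : GrushinSpace m k → ℝ := (annulus γ a b).indicator (fun p => H (logGauge γ p) * u p)
    with hYdef
  set Ys : GrushinSpace m k → ℝ := (annulus γ a b).indicator (fun p =>
    deriv H (logGauge γ p) * u p + H (logGauge γ p) * dilDeriv γ Du p) with hYsdef
  have hY : MemLp Y 2 (invMeasure m k γ) := memLp_radial_mul hγ hu.memLp hH.continuous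
  have hYs : MemLp Ys 2 (invMeasure m k γ) := by
    have := (memLp_radial_mul hγ hu.memLp hHd).add
      (memLp_radial_mul_dilDeriv hγ hu.memLp_D hH.continuous)
    rw [← Set.indicator_add'] at this
    exact this
  have hΦ1 : Integrable Φ (invMeasure m k γ) := by
    have : Φ = (annulus γ (a + ε) (b - ε)).indicator Φ := by
      ext p
      by_cases hp : p ∈ (annulus γ (a + ε) (b - ε) : Set (GrushinSpace m k))
      · simp [hp]
      · simp [hp, hΦ0 p hp]
    rw [this, integrable_indicator_iff hA1]
    have hfin : IsFiniteMeasure ((invMeasure m k γ).restrict (annulus γ (a + ε) (b - ε))) :=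
      ⟨by simpa using invMeasure_annulus_lt_top hγ _ _⟩
    exact (hΦ.restrict _).integrable (by norm_num)
  have hsum : ∀ n, eLpNorm (fun p => |f n p - u p| + ∑ i, |(grushinX γ i (f n) - Du i) p|) 2
      (volume.restrict (annulus γ a b)) ≤ eLpNorm (f n - u) 2 (volume.restrict (annulus γ a b)) +
      ∑ i, eLpNorm (grushinX γ i (f n) - Du i) 2 (volume.restrict (annulus γ a b)) := by
    intro n
    have m1 : AEStronglyMeasurable (f n - u) (volume.restrict (annulus γ a b)) :=
      (hf n).continuous.aestronglyMeasurable.sub hu.memLp.1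
    have m2 : ∀ i, AEStronglyMeasurable (grushinX γ i (f n) - Du i)
        (volume.restrict (annulus γ a b)) := fun i =>
      (continuous_grushinX hγ (hfC1 n) i).aestronglyMeasurable.sub (hu.memLp_D i).1
    have e1 : (fun p => |f n p - u p| + ∑ i, |(grushinX γ i (f n) - Du i) p|) =
        (fun p => ‖(f n - u) p‖) + ∑ i, fun p => ‖(grushinX γ i (f n) - Du i) p‖ := by
      ext p; simp
    rw [e1]
    refine (eLpNorm_add_le m1.norm (Finset.aestronglyMeasurable_sum _ fun i _ => (m2 i).norm)
      (by norm_num)).trans (add_le_add (by rw [eLpNorm_norm]) ?_)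
    refine (eLpNorm_sum_le (fun i _ => (m2 i).norm) (by norm_num)).trans ?_
    exact Finset.sum_le_sum fun i _ => by rw [eLpNorm_norm]
  have hsuml : Tendsto (fun n => eLpNorm (f n - u) 2 (volume.restrict (annulus γ a b)) +
      ∑ i, eLpNorm (grushinX γ i (f n) - Du i) 2 (volume.restrict (annulus γ a b))) atTop
      (𝓝 0) := by
    have := hf0.add (tendsto_finsetSum Finset.univ fun i _ => hf1 i)
    simpa using this
  have hlim : ∀ (C : ℝ) (P : ℕ → GrushinSpace m k → ℝ) (Z : GrushinSpace m k → ℝ),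
      (∀ n, ∀ᵐ p ∂(volume.restrict (annulus γ a b)), √(invDensity γ p) * |(P n - Z) p| ≤
        C * |(|f n p - u p| + ∑ i, |(grushinX γ i (f n) - Du i) p|)|) →
      Tendsto (fun n => eLpNorm (P n - Z) 2 ((invMeasure m k γ).restrict (annulus γ a b))) atTop
        (𝓝 0) := by
    intro C P Z hPZ
    have hl := ENNReal.Tendsto.const_mul (a := ENNReal.ofReal C) hsuml
      (Or.inr ENNReal.ofReal_ne_top)
    rw [mul_zero] at hl
    refine tendsto_of_tendsto_of_tendsto_of_le_of_le tendsto_const_nhds hl (fun _ => zero_le)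
      fun n => ?_
    exact (eLpNorm_invMeasure_le hγ hA (hPZ n)).trans (by gcongr; exact hsum n)
  -- The approximants are H(s) f_n. Dilation by h translates s by h, so points of the annulus shrunk
  -- by ε stay in the original one for |h| < ε.
  have key := hasDerivAt_integral_mul_flow (μ := invMeasure m k γ) (T := dil γ)
    (A1 := annulus γ (a + ε) (b - ε)) (measurePreserving_dil hγ hm) hA (ε := ε)
    (fun h hh p hp => dil_mem_annulus hγ (by linarith [hh.1]) (by linarith [hh.2]) hp) hΦ hΦ1 hΦ0
    (Yn := fun n p => H (logGauge γ p) * f n p)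
    (Zn := fun n p => deriv H (logGauge γ p) * f n p + H (logGauge γ p) *
      fderiv ℝ (f n) p (dilField γ p)) ?_ ?_ ?_ ?_ ?_ hY hYs ?_ ?_ (h := 0) ⟨by linarith, hε⟩
  · simpa only [dil_zero] using key
  · exact fun n => (hH.continuous.measurable.comp hS).mul (hf n).continuous.measurable
  · exact fun n => ((hHd.measurable.comp hS).mul (hf n).continuous.measurable).add
      ((hH.continuous.measurable.comp hS).mul (hfd n).measurable)
  · intro n
    obtain ⟨C, hC, h⟩ := hbd (f n) (hf n).continuous
    refine ⟨C3 * C, fun p hp => ?_⟩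
    rw [abs_mul]
    exact mul_le_mul (h3 p hp) (h p hp) (abs_nonneg _) hC3
  · intro n
    obtain ⟨C, hC, h⟩ := hbd (f n) (hf n).continuous
    obtain ⟨C', hC', h'⟩ := hbd _ (hfd n)
    refine ⟨C4 * C + C3 * C', fun p hp => ?_⟩
    refine (abs_add_le _ _).trans (add_le_add ?_ ?_)
    · rw [abs_mul]
      exact mul_le_mul (h4 p hp) (h p hp) (abs_nonneg _) hC4
    · rw [abs_mul]
      exact mul_le_mul (h3 p hp) (h' p hp) (abs_nonneg _) hC3
  · intro n p hp h hh
    have d1 : HasDerivAt (fun h => H (logGauge γ (dil γ h p)))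
        (deriv H (logGauge γ (dil γ h p))) h := by
      have e : (fun h => H (logGauge γ (dil γ h p))) = fun h => H (logGauge γ p + h) := by
        ext h; rw [logGauge_dil hγ h hp.1]
      rw [e, logGauge_dil hγ h hp.1]
      exact (hH.differentiable one_ne_zero _).hasDerivAt.comp_const_add _ _
    exact d1.mul (hasDerivAt_comp_dil h p ((hfC1 n).differentiable one_ne_zero _))
  · refine hlim (C1 * C2 * C3) _ _ fun n => ?_
    filter_upwards [ae_annulus_mem hγ a b volume] with p hp
    have h0 : 0 ≤ ∑ i, |(grushinX γ i (f n) - Du i) p| :=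
      Finset.sum_nonneg fun _ _ => abs_nonneg _
    have h5 : 0 ≤ |f n p - u p| := abs_nonneg _
    rw [abs_of_nonneg (add_nonneg h5 h0)]
    simp only [Pi.sub_apply, hYdef, Set.indicator_of_mem hp]
    rw [← mul_sub, abs_mul]
    calc √(invDensity γ p) * (|H (logGauge γ p)| * |f n p - u p|)
        ≤ (C1 * C2) * (C3 * |f n p - u p|) := by
          gcongr
          · exact (h1 p hp).trans (by gcongr; exact h2 p hp)
          · exact h3 p hp
      _ = C1 * C2 * C3 * |f n p - u p| := by ring
      _ ≤ _ := by
          gcongr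
          simp only [Pi.sub_apply] at h0
          linarith
  · refine hlim (C1 * C2 * C4 + C1 * C3) _ _ fun n => ?_
    filter_upwards [ae_annulus_mem hγ a b volume, ae_restrict_of_ae (ae_fst_ne_zero hm)]
      with p hp hp1
    have h0 : 0 ≤ ∑ i, |(grushinX γ i (f n) - Du i) p| :=
      Finset.sum_nonneg fun _ _ => abs_nonneg _
    have h5 : 0 ≤ |f n p - u p| := abs_nonneg _
    rw [abs_of_nonneg (add_nonneg h5 h0)]
    have h6 := sqrt_gaugeWeight_mul_dilDeriv_le hγ (fun i => grushinX γ i (f n) - Du i) p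
    set B := dilDeriv γ (fun i => grushinX γ i (f n) - Du i) p with hB
    set sD := ∑ i, |(grushinX γ i (f n) - Du i) p|
    have e : ((fun p => deriv H (logGauge γ p) * f n p + H (logGauge γ p) *
        fderiv ℝ (f n) p (dilField γ p)) - Ys) p =
        deriv H (logGauge γ p) * (f n p - u p) + H (logGauge γ p) * B := by
      -- Off {z = 0} the classical derivative of f_n along the generator is `dilDeriv` of its
      -- horizontal gradient, so the error is linear in f_n - u and X f_n - Du.
      rw [hB, dilDeriv_sub, dilDeriv_grushinX hγ _ hp1]
      simp only [Pi.sub_apply, hYsdef, Set.indicator_of_mem hp]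
      ring
    rw [e]
    have hs := Real.sqrt_nonneg (invDensity γ p)
    calc _ ≤ √(invDensity γ p) * (|deriv H (logGauge γ p)| * |f n p - u p| +
          |H (logGauge γ p)| * |B|) := by
            gcongr
            refine (abs_add_le _ _).trans_eq ?_
            rw [abs_mul, abs_mul]
      _ = √(invDensity γ p) * (|deriv H (logGauge γ p)| * |f n p - u p|) +
          √(invDensity γ p) * (|H (logGauge γ p)| * |B|) := by ring
      _ ≤ (C1 * C2) * (C4 * |f n p - u p|) + (C1 * √(gaugeWeight γ p)) * (C3 * |B|) := by
          gcongr
          · exact (h1 p hp).trans (by gcongr; exact h2 p hp)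
          · exact h4 p hp
          · exact h1 p hp
          · exact h3 p hp
      _ = (C1 * C2 * C4) * |f n p - u p| + (C1 * C3) * (√(gaugeWeight γ p) * |B|) := by ring
      _ ≤ (C1 * C2 * C4) * |f n p - u p| + (C1 * C3) * sD := by gcongr
      _ ≤ _ := by
          have t1 : 0 ≤ C1 * C2 * C4 * sD := by positivity
          have t2 : 0 ≤ C1 * C3 * |f n p - u p| := by positivity
          nlinarith

end

end

/-! ### The normalised equation and its weak form against dilates of the solution. -/

noncomputable section

variable {m k : ℕ} {γ : ℝ}

lemma map_dil_restrict (h : ℝ) (Ω : Set (GrushinSpace m k)) :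
    Measure.map (dil γ h) (volume.restrict (dil γ h ⁻¹' Ω)) =
      ENNReal.ofReal (Real.exp (-(homDim m k γ) * h)) • volume.restrict Ω := by
  have := (dilEquiv (m := m) (k := k) γ h).measurableEmbedding.restrict_map volume Ω
  change (Measure.map (dil γ h) volume).restrict Ω = Measure.map (dil γ h) _ at this
  rw [map_dil_volume, Measure.restrict_smul] at this
  exact this.symm

lemma eLpNorm_comp_dil (h : ℝ) (Ω : Set (GrushinSpace m k)) (g : GrushinSpace m k → ℝ) :
    eLpNorm (g ∘ dil γ h) 2 (volume.restrict (dil γ h ⁻¹' Ω)) =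
      (ENNReal.ofReal (Real.exp (-(homDim m k γ) * h))) ^ (1 / 2 : ℝ) *
        eLpNorm g 2 (volume.restrict Ω) := by
  have h1 := (dilEquiv (m := m) (k := k) γ h).measurableEmbedding.eLpNorm_map_measure
    (p := 2) (g := g) (μ := volume.restrict (dil γ h ⁻¹' Ω))
  change eLpNorm g 2 (Measure.map (dil γ h) _) = eLpNorm (g ∘ dil γ h) _ _ at h1
  rw [← h1, map_dil_restrict, eLpNorm_smul_measure_of_ne_top (by norm_num)]
  simp

lemma memLp_comp_dil (h : ℝ) {Ω : Set (GrushinSpace m k)} {g : GrushinSpace m k → ℝ}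
    (hg : MemLp g 2 (volume.restrict Ω)) :
    MemLp (g ∘ dil γ h) 2 (volume.restrict (dil γ h ⁻¹' Ω)) := by
  have h1 := (dilEquiv (m := m) (k := k) γ h).measurableEmbedding.memLp_map_measure_iff
    (p := 2) (g := g) (μ := volume.restrict (dil γ h ⁻¹' Ω))
  change MemLp g 2 (Measure.map (dil γ h) _) ↔ MemLp (g ∘ dil γ h) _ _ at h1
  rw [← h1, map_dil_restrict]
  exact hg.smul_measure ENNReal.ofReal_ne_top

/-- Dilates of u serve as test functions in the weak form. The factor e^h is the homogeneity of the
fields. -/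
lemma IsHorizLimit.comp_dil {Ω : Set (GrushinSpace m k)} {u : GrushinSpace m k → ℝ}
    {Du : Fin m ⊕ Fin k → GrushinSpace m k → ℝ} (hu : IsHorizLimit γ Ω u Du) (h : ℝ) :
    IsHorizLimit γ (dil γ h ⁻¹' Ω) (u ∘ dil γ h) (fun i p => Real.exp h * Du i (dil γ h p)) := by
  obtain ⟨f, hf, hf0, hf1⟩ := hu.exists_seq
  refine ⟨memLp_comp_dil h hu.memLp, fun i => (memLp_comp_dil h (hu.memLp_D i)).const_mul _,
    fun n => f n ∘ dil γ h, fun n => (hf n).comp (contDiff_dil h), ?_, fun i => ?_⟩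
  · have e : ∀ n, f n ∘ dil γ h - u ∘ dil γ h = (f n - u) ∘ dil γ h := fun n => rfl
    simp only [e, eLpNorm_comp_dil]
    simpa using ENNReal.Tendsto.const_mul hf0 (Or.inr (by simp))
  · have e : ∀ n, grushinX γ i (f n ∘ dil γ h) - (fun p => Real.exp h * Du i (dil γ h p)) =
        Real.exp h • ((grushinX γ i (f n) - Du i) ∘ dil γ h) := by
      intro n
      ext p
      simp only [Pi.sub_apply, Pi.smul_apply, smul_eq_mul, Function.comp_apply]
      rw [grushinX_comp_dil h ((hf n).differentiable (by simp))]
      ring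
    simp only [e, eLpNorm_const_smul, eLpNorm_comp_dil]
    have := ENNReal.Tendsto.const_mul (a := ‖Real.exp h‖ₑ) (ENNReal.Tendsto.const_mul
      (a := (ENNReal.ofReal (Real.exp (-(homDim m k γ) * h))) ^ (1 / 2 : ℝ)) (hf1 i)
      (Or.inr (by simp))) (Or.inr (by simp))
    simpa using this

lemma integrable_mul_mul_of_L2 {X : Type*} [MeasurableSpace X] {ν : Measure X} {Ω : Set X}
    {F G c : X → ℝ} {C : ℝ} (hc : ∀ x, |c x| ≤ C) (hcm : Measurable c)
    (hcs : ∀ x, x ∉ Ω → c x = 0) (hF : MemLp F 2 (ν.restrict Ω)) (hG : MemLp G 2 (ν.restrict Ω)) :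
    Integrable (fun x => c x * F x * G x) ν := by
  have h1 : IntegrableOn (fun x => c x * F x * G x) Ω ν := by
    refine MemLp.integrable_mul_two (F := fun x => c x * F x) ?_ hG
    exact hF.of_le_mul (hcm.aestronglyMeasurable.mul hF.1) (c := C)
      (Eventually.of_forall fun x => by
        rw [norm_mul]; exact mul_le_mul_of_nonneg_right (hc x) (norm_nonneg _))
  rwa [integrableOn_iff_integrable_of_support_subset] at h1
  intro x hx
  by_contra h
  exact hx (by simp [hcs x h])

/-- The normalised function `ρ^{(Q-2)/2} u` on an annulus. -/
def normFn (γ a b : ℝ) (u : GrushinSpace m k → ℝ) : GrushinSpace m k → ℝ :=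
  (annulus γ a b).indicator fun p => Real.exp (halfDim m k γ * logGauge γ p) * u p

/-- The dilation derivative of `normFn`. -/
def normDeriv (γ a b : ℝ) (u : GrushinSpace m k → ℝ)
    (Du : Fin m ⊕ Fin k → GrushinSpace m k → ℝ) : GrushinSpace m k → ℝ :=
  (annulus γ a b).indicator fun p =>
    Real.exp (halfDim m k γ * logGauge γ p) * (dilDeriv γ Du p + halfDim m k γ * u p)

/-- The normalised second order term `ρ^{(Q-2)/2} ρ² ψ⁻¹ ∑ X_i X_i u`. -/
def normLap (γ a b : ℝ) (D2u : Fin m ⊕ Fin k → Fin m ⊕ Fin k → GrushinSpace m k → ℝ) :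
    GrushinSpace m k → ℝ :=
  (annulus γ a b).indicator fun p =>
    Real.exp (halfDim m k γ * logGauge γ p) * ((∑ i, D2u i i p) / gaugeWeight γ p)

/-- A solution on an annulus with `|∑ X_i X_i u| ≤ K ψ |u|`. -/
structure IsAnnulusSolution (γ K a b : ℝ) (u : GrushinSpace m k → ℝ)
    (Du : Fin m ⊕ Fin k → GrushinSpace m k → ℝ)
    (D2u : Fin m ⊕ Fin k → Fin m ⊕ Fin k → GrushinSpace m k → ℝ) : Prop where
  isLimit : IsS22Limit γ (annulus γ a b) u Du D2u
  bound : ∀ᵐ p ∂(volume.restrict (annulus γ a b)),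
    |∑ i, D2u i i p| ≤ K * Real.exp (2 * logGauge γ p) * gaugeWeight γ p * |u p|

section

variable {a b K : ℝ} {u : GrushinSpace m k → ℝ} {Du : Fin m ⊕ Fin k → GrushinSpace m k → ℝ}
  {D2u : Fin m ⊕ Fin k → Fin m ⊕ Fin k → GrushinSpace m k → ℝ}

lemma normFn_eq_zero {p : GrushinSpace m k} (hp : p ∉ (annulus γ a b : Set (GrushinSpace m k))) :
    normFn γ a b u p = 0 := Set.indicator_of_notMem hp _

lemma IsHorizLimit.memLp_normFn (hγ : 0 < γ) (hu : IsHorizLimit γ (annulus γ a b) u Du) :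
    MemLp (normFn γ a b u) 2 (invMeasure m k γ) :=
  memLp_radial_mul hγ hu.memLp (H := fun s => Real.exp (halfDim m k γ * s)) (by fun_prop)

lemma IsHorizLimit.memLp_normDeriv (hγ : 0 < γ) (hu : IsHorizLimit γ (annulus γ a b) u Du) :
    MemLp (normDeriv γ a b u Du) 2 (invMeasure m k γ) := by
  have h1 := (memLp_radial_mul_dilDeriv hγ hu.memLp_D
    (H := fun s => Real.exp (halfDim m k γ * s)) (by fun_prop)).add
    ((hu.memLp_normFn hγ).const_mul (halfDim m k γ))
  refine h1.ae_eq (Eventually.of_forall fun p => ?_)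
  by_cases hp : p ∈ (annulus γ a b : Set (GrushinSpace m k))
  · simp only [Pi.add_apply, normFn, normDeriv, Set.indicator_of_mem hp]
    ring
  · simp [normFn, normDeriv, Set.indicator_of_notMem hp]

/-- The weight in the bound for the right-hand side cancels the division in `normLap`. The factor
e^{2s} that is left is what makes the potential absorbable at small scales. -/
lemma IsAnnulusSolution.abs_normLap_le (hγ : 0 < γ) (hm : 1 ≤ m)
    (hu : IsAnnulusSolution γ K a b u Du D2u) :
    ∀ᵐ p : GrushinSpace m k, |normLap γ a b D2u p| ≤
      K * Real.exp (2 * logGauge γ p) * |normFn γ a b u p| := by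
  have h := (ae_restrict_iff' (measurableSet_annulus hγ a b)).1 hu.bound
  filter_upwards [h, ae_fst_ne_zero hm] with p hp hp1
  by_cases hpA : p ∈ (annulus γ a b : Set (GrushinSpace m k))
  · have hp := hp hpA
    have hW := gaugeWeight_pos hγ hp1
    simp only [normFn, normLap, Set.indicator_of_mem hpA]
    rw [abs_mul, abs_mul, Real.abs_exp, abs_div, abs_of_pos hW]
    calc _ ≤ Real.exp (halfDim m k γ * logGauge γ p) *
          (K * Real.exp (2 * logGauge γ p) * gaugeWeight γ p * |u p| / gaugeWeight γ p) := by
          gcongr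
      _ = _ := by field_simp
  · simp [normFn, normLap, Set.indicator_of_notMem hpA]

/-- Square integrability is taken from the equation: second derivatives in L² alone would not
survive division by a weight vanishing on {z = 0}, whereas |F| is at most a bounded multiple of |w|.
-/
lemma IsAnnulusSolution.memLp_normLap (hγ : 0 < γ) (hm : 1 ≤ m) (hK : 0 ≤ K)
    (hu : IsAnnulusSolution γ K a b u Du D2u) :
    MemLp (normLap γ a b D2u) 2 (invMeasure m k γ) := by
  have hA := measurableSet_annulus (m := m) (k := k) hγ a b
  have hmeas : AEStronglyMeasurable (normLap γ a b D2u) (invMeasure m k γ) := by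
    rw [normLap, aestronglyMeasurable_indicator_iff hA]
    refine AEStronglyMeasurable.mono_ac (invMeasure_absolutelyContinuous.restrict _) ?_
    refine AEMeasurable.aestronglyMeasurable ?_
    refine (Real.measurable_exp.comp ((measurable_logGauge hγ).const_mul _)).aemeasurable.mul ?_
    refine AEMeasurable.div ?_ (measurable_gaugeWeight hγ).aemeasurable
    exact Finset.aemeasurable_fun_sum _ fun i _ => (hu.isLimit.memLp_D2 i i).1.aemeasurable
  obtain ⟨C, hC0, hC⟩ := exists_bound_radial (m := m) (k := k) (γ := γ)
    (H := fun s => Real.exp (2 * s)) (by fun_prop) a b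
  refine (hu.isLimit.isHorizLimit.memLp_normFn hγ).of_le_mul hmeas (c := K * C) ?_
  filter_upwards [invMeasure_absolutelyContinuous.ae_le (hu.abs_normLap_le hγ hm)] with p hp
  by_cases hpA : p ∈ (annulus γ a b : Set (GrushinSpace m k))
  · refine hp.trans ?_
    rw [Real.norm_eq_abs]
    gcongr
    exact (le_abs_self _).trans (hC p hpA)
  · simp [normFn, normLap, Set.indicator_of_notMem hpA]

lemma deriv_eq_zero_of_notMem_Icc {G : ℝ → ℝ} {c d : ℝ} (hG : ∀ s, s ∉ Set.Icc c d → G s = 0)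
    {s : ℝ} (hs : s ∉ Set.Icc c d) : deriv G s = 0 := by
  have : G =ᶠ[𝓝 s] fun _ => 0 := by
    filter_upwards [isClosed_Icc.isOpen_compl.mem_nhds hs] with x hx using hG x hx
  rw [this.deriv_eq, deriv_const]

lemma exists_bound_of_support {G : ℝ → ℝ} {c d : ℝ} (hGc : Continuous G)
    (hG : ∀ s, s ∉ Set.Icc c d → G s = 0) : ∃ C, 0 ≤ C ∧ ∀ s, |G s| ≤ C := by
  obtain ⟨C, hC⟩ := (isCompact_Icc (a := c) (b := d)).exists_bound_of_continuousOn hGc.continuousOn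
  refine ⟨max C 0, le_max_right _ _, fun s => ?_⟩
  by_cases hs : s ∈ Set.Icc c d
  · exact (hC s hs).trans (le_max_left _ _)
  · simp [hG s hs]

lemma memLp_radial_smul (hγ : 0 < γ) {ν : Measure (GrushinSpace m k)} {G : ℝ → ℝ} {c d : ℝ}
    (hGc : Continuous G) (hG : ∀ s, s ∉ Set.Icc c d → G s = 0) {f : GrushinSpace m k → ℝ}
    (hf : MemLp f 2 ν) : MemLp (fun p => G (logGauge γ p) * f p) 2 ν := by
  obtain ⟨C, hC0, hC⟩ := exists_bound_of_support hGc hG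
  refine hf.of_le_mul (c := C)
    ((hGc.measurable.comp (measurable_logGauge hγ)).aestronglyMeasurable.mul hf.1)
    (Eventually.of_forall fun p => ?_)
  rw [norm_mul]
  exact mul_le_mul_of_nonneg_right (hC _) (norm_nonneg _)

/-- The weak form of the equation, tested against a radial multiple of a dilate of `u`. -/
lemma IsAnnulusSolution.weak_identity (hγ : 0 < γ) (hm : 1 ≤ m)
    (hu : IsAnnulusSolution γ K a b u Du D2u) {h c d : ℝ} (hd : d < 0)
    (hac : a < c) (hdb : d < b) (hac' : a < c + h) (hdb' : d + h < b) {G : ℝ → ℝ}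
    (hG : ContDiff ℝ 1 G) (hGs : ∀ s, s ∉ Set.Icc c d → G s = 0) :
    ∫ p, (G (logGauge γ p) * normLap γ a b D2u p * normFn γ a b u (dil γ h p) +
      deriv G (logGauge γ p) * (normDeriv γ a b u Du p - halfDim m k γ * normFn γ a b u p) *
        normFn γ a b u (dil γ h p)) ∂(invMeasure m k γ) =
    -(Real.exp ((1 + halfDim m k γ) * h) *
      ∑ i, ∫ p, G (logGauge γ p) * Du i p * Du i (dil γ h p)) := by
  have hη := contDiff_radial (m := m) (k := k) hγ hd hG hGs
  have hηc := hasCompactSupport_radial (m := m) (k := k) hγ hd hGs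
  have hts : tsupport (fun p : GrushinSpace m k => G (logGauge γ p)) ⊆
      annulus γ a b ∩ dil γ h ⁻¹' annulus γ a b := by
    refine (tsupport_radial_subset hγ hd hGs).trans (Set.subset_inter ?_ ?_)
    · exact closedShell_subset_annulus hγ hac hdb
    · rw [preimage_dil_annulus hγ]
      exact closedShell_subset_annulus hγ (by linarith) (by linarith)
  have hv := hu.isLimit.isHorizLimit.comp_dil h
  have hwf := fun i => hu.isLimit.weak_form hγ hv hη hηc hts i
  have hdG : Continuous (deriv G) := hG.continuous_deriv le_rfl
  have hdGs : ∀ s, s ∉ Set.Icc c d → deriv G s = 0 := fun s hs =>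
    deriv_eq_zero_of_notMem_Icc hGs hs
  obtain ⟨C1, hC1, h1⟩ := exists_bound_of_support hG.continuous hGs
  obtain ⟨C2, hC2⟩ : ∃ C, ∀ i p, |grushinX γ i (fun p : GrushinSpace m k => G (logGauge γ p)) p| ≤
      C := by
    have : ∀ i, ∃ C, ∀ p, |grushinX γ i (fun p : GrushinSpace m k => G (logGauge γ p)) p| ≤ C := by
      intro i
      apply (continuous_grushinX hγ hη i).bounded_above_of_compact_support
      have e : grushinX γ i (fun p : GrushinSpace m k => G (logGauge γ p)) =
          fun p => deriv G (logGauge γ p) * gradLogGauge γ i p :=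
        funext (grushinX_radial hγ hd hG hGs i)
      rw [e]
      exact (hasCompactSupport_radial (m := m) (k := k) hγ hd hdGs).mul_right
    choose C hC using this
    exact ⟨∑ i, |C i|, fun i p => (hC i p).trans ((le_abs_self _).trans
      (Finset.single_le_sum (f := fun i => |C i|) (fun _ _ => abs_nonneg _)
        (Finset.mem_univ i)))⟩
  set Ω := (annulus γ a b : Set (GrushinSpace m k)) ∩ dil γ h ⁻¹' annulus γ a b
  have hSs : ∀ p : GrushinSpace m k, p ∉ Ω → p ≠ 0 → logGauge γ p ∉ Set.Icc c d := by
    intro p hp hp0 hS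
    apply hp
    refine ⟨⟨hp0, by linarith [hS.1], by linarith [hS.2]⟩, ?_⟩
    rw [preimage_dil_annulus hγ]
    exact ⟨hp0, by linarith [hS.1], by linarith [hS.2]⟩
  have hs0 : ∀ p : GrushinSpace m k, p ∉ Ω → G (logGauge γ p) = 0 := fun p hp =>
    image_eq_zero_of_notMem_tsupport (f := fun p : GrushinSpace m k => G (logGauge γ p))
      fun h => hp (hts h)
  have hs1 : ∀ i, ∀ p : GrushinSpace m k, p ∉ Ω →
      grushinX γ i (fun p : GrushinSpace m k => G (logGauge γ p)) p = 0 := by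
    intro i p hp
    rw [grushinX_radial hγ hd hG hGs]
    by_cases hp0 : p = 0
    · simp [hp0, gradLogGauge_zero]
    · simp [hdGs _ (hSs p hp hp0)]
  have hL : Ω ⊆ annulus γ a b := Set.inter_subset_left
  have hR : Ω ⊆ dil γ h ⁻¹' annulus γ a b := Set.inter_subset_right
  have i1 : ∀ i, Integrable (fun p => G (logGauge γ p) * D2u i i p * (u ∘ dil γ h) p) := fun i =>
    integrable_mul_mul_of_L2 (fun _ => h1 _) hη.continuous.measurable hs0
      ((hu.isLimit.memLp_D2 i i).mono_measure (Measure.restrict_mono hL le_rfl))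
      (hv.memLp.mono_measure (Measure.restrict_mono hR le_rfl))
  have i2 : ∀ i, Integrable (fun p => grushinX γ i (fun p : GrushinSpace m k =>
      G (logGauge γ p)) p * Du i p * (u ∘ dil γ h) p) := fun i =>
    integrable_mul_mul_of_L2 (hC2 i) (continuous_grushinX hγ hη i).measurable (hs1 i)
      ((hu.isLimit.memLp_D i).mono_measure (Measure.restrict_mono hL le_rfl))
      (hv.memLp.mono_measure (Measure.restrict_mono hR le_rfl))
  -- The weak forms summed over all fields; the factor e^h is the scaling of the gradient of u∘δ_h.
  have e1 : ∑ i, (∫ p, G (logGauge γ p) * D2u i i p * (u ∘ dil γ h) p) +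
      ∑ i, (∫ p, grushinX γ i (fun p : GrushinSpace m k =>
      G (logGauge γ p)) p * Du i p * (u ∘ dil γ h) p) =
      -(Real.exp h * ∑ i, ∫ p, G (logGauge γ p) * Du i p * Du i (dil γ h p)) := by
    rw [← Finset.sum_add_distrib, Finset.mul_sum, ← Finset.sum_neg_distrib]
    refine Finset.sum_congr rfl fun i _ => ?_
    rw [hwf i, sub_add_cancel, ← integral_const_mul]
    congr 2
    ext p
    ring
  rw [← integral_finsetSum _ fun i _ => i1 i, ← integral_finsetSum _ fun i _ => i2 i,
    ← integral_add (integrable_finsetSum _ fun i _ => i1 i)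
      (integrable_finsetSum _ fun i _ => i2 i)] at e1
  rw [integral_invMeasure hγ, add_mul, one_mul, Real.exp_add, mul_comm (Real.exp h), mul_assoc,
    neg_mul_eq_mul_neg, ← e1, ← integral_const_mul]
  apply integral_congr_ae
  filter_upwards [ae_fst_ne_zero hm] with p hp1
  have hp0 : p ≠ 0 := fun h => hp1 (by simp [h])
  by_cases hp : p ∈ Ω
  · have hW := gaugeWeight_pos hγ hp1
    simp only [normFn, normLap, normDeriv, Set.indicator_of_mem (hL hp),
      Set.indicator_of_mem (show dil γ h p ∈ annulus γ a b from hR hp), Function.comp_apply,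
      grushinX_radial hγ hd hG hGs]
    rw [logGauge_dil hγ h hp0, invDensity, mul_add (halfDim m k γ), Real.exp_add]
    set E := Real.exp (halfDim m k γ * logGauge γ p) with hE
    -- The factor ρ^{-2q} of the density cancels the two normalising factors ρ^q, so only the weight
    -- remains in front of the unnormalised integrand. The dilated factor leaves an additional
    -- e^{qh}, which joins e^h.
    have hE1 : Real.exp (-2 * halfDim m k γ * logGauge γ p) * (E * E) = 1 := by
      rw [hE, ← Real.exp_add, ← Real.exp_add, Real.exp_eq_one_iff]
      ring
    -- The cutoff is radial, so its gradient sees u only through the dilation derivative, and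
    -- multiplication by the weight undoes the division in `dilDeriv`.
    have e2 : ∑ i, deriv G (logGauge γ p) * gradLogGauge γ i p * Du i p * u (dil γ h p) =
        deriv G (logGauge γ p) * (gaugeWeight γ p * dilDeriv γ Du p) * u (dil γ h p) := by
      rw [dilDeriv, mul_div_cancel₀ _ hW.ne', Finset.mul_sum, Finset.sum_mul]
      exact Finset.sum_congr rfl fun i _ => by ring
    have e3 : ∑ i, G (logGauge γ p) * D2u i i p * u (dil γ h p) =
        G (logGauge γ p) * (∑ i, D2u i i p) * u (dil γ h p) := by
      rw [Finset.mul_sum, Finset.sum_mul]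
    rw [e2, e3]
    have e4 : (∑ i, D2u i i p) = gaugeWeight γ p * ((∑ i, D2u i i p) / gaugeWeight γ p) := by
      rw [mul_div_cancel₀ _ hW.ne']
    conv_rhs => rw [e4]
    set f := (∑ i, D2u i i p) / gaugeWeight γ p
    linear_combination (gaugeWeight γ p * (G (logGauge γ p) * f +
      deriv G (logGauge γ p) * dilDeriv γ Du p) * Real.exp (halfDim m k γ * h) *
        u (dil γ h p)) * hE1
  · have hS := hSs p hp hp0
    simp [hGs _ hS, hdGs _ hS, hs1 _ p hp]

end

end

/-! ### Dilation symmetry and the Rellich identity. -/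

noncomputable section

variable {m k : ℕ} {γ : ℝ}

section

variable {a b K : ℝ} {u : GrushinSpace m k → ℝ} {Du : Fin m ⊕ Fin k → GrushinSpace m k → ℝ}
  {D2u : Fin m ⊕ Fin k → Fin m ⊕ Fin k → GrushinSpace m k → ℝ}

lemma ae_invMeasure_ne_zero (hm : 1 ≤ m) : ∀ᵐ p ∂(invMeasure m k γ), p ≠ 0 :=
  invMeasure_absolutelyContinuous.ae_le (ae_ne_zero hm)

lemma integral_invMeasure_comp_dil (hγ : 0 < γ) (hm : 1 ≤ m) (h : ℝ) (Y : GrushinSpace m k → ℝ) :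
    ∫ p, Y (dil γ h p) ∂(invMeasure m k γ) = ∫ p, Y p ∂(invMeasure m k γ) :=
  (measurePreserving_dil hγ hm h).integral_comp (dilEquiv (m := m) (k := k) γ h).measurableEmbedding Y

lemma memLp_comp_dil_invMeasure (hγ : 0 < γ) (hm : 1 ≤ m) (h : ℝ) {f : GrushinSpace m k → ℝ}
    (hf : MemLp f 2 (invMeasure m k γ)) : MemLp (fun p => f (dil γ h p)) 2 (invMeasure m k γ) :=
  hf.comp_measurePreserving (measurePreserving_dil hγ hm h)

/-- Symmetry of the second order operator, tested between `u` and its dilates. -/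
lemma IsAnnulusSolution.flow_identity (hγ : 0 < γ) (hm : 1 ≤ m) (hK : 0 ≤ K)
    (hu : IsAnnulusSolution γ K a b u Du D2u) {h c d : ℝ} (hd : d < 0) (hd' : d + h < 0)
    (hac : a < c) (hdb : d < b) (hac' : a < c + h) (hdb' : d + h < b)
    {G : ℝ → ℝ} (hG : ContDiff ℝ 1 G) (hGs : ∀ s, s ∉ Set.Icc c d → G s = 0) :
    ∫ p, G (logGauge γ p) * normLap γ a b D2u p * normFn γ a b u (dil γ h p) ∂(invMeasure m k γ) +
      ∫ p, deriv G (logGauge γ p) * normDeriv γ a b u Du p * normFn γ a b u (dil γ h p)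
        ∂(invMeasure m k γ) =
    ∫ p, normLap γ a b D2u p * (G (logGauge γ (dil γ (-h) p)) * normFn γ a b u (dil γ (-h) p))
        ∂(invMeasure m k γ) +
      ∫ p, normDeriv γ a b u Du p * (deriv G (logGauge γ (dil γ (-h) p)) *
        normFn γ a b u (dil γ (-h) p)) ∂(invMeasure m k γ) := by
  set q := halfDim m k γ with hq
  set w := normFn γ a b u with hwdef
  set ws := normDeriv γ a b u Du with hwsdef
  set F := normLap γ a b D2u with hFdef
  have hw : MemLp w 2 (invMeasure m k γ) := hu.isLimit.isHorizLimit.memLp_normFn hγ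
  have hws : MemLp ws 2 (invMeasure m k γ) := hu.isLimit.isHorizLimit.memLp_normDeriv hγ
  have hF : MemLp F 2 (invMeasure m k γ) := hu.memLp_normLap hγ hm hK
  have hdG : Continuous (deriv G) := hG.continuous_deriv le_rfl
  have hdGs : ∀ s, s ∉ Set.Icc c d → deriv G s = 0 := fun s hs =>
    deriv_eq_zero_of_notMem_Icc hGs hs
  -- The translated cutoff makes the second use of the weak identity, at -h, the image of the first
  -- under δ_h.
  set G' : ℝ → ℝ := fun s => G (s - h) with hG'
  have hG'c : ContDiff ℝ 1 G' := hG.comp (contDiff_id.sub contDiff_const)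
  have hG's : ∀ s, s ∉ Set.Icc (c + h) (d + h) → G' s = 0 := by
    intro s hs
    apply hGs
    intro h1
    exact hs ⟨by linarith [h1.1], by linarith [h1.2]⟩
  have hdG' : ∀ s, deriv G' s = deriv G (s - h) := fun s => deriv_comp_sub_const (f := G) h s
  have id1 := hu.weak_identity hγ hm hd hac hdb hac' hdb' hG hGs
  have id2 := hu.weak_identity hγ hm (h := -h) hd' hac' hdb' (by linarith) (by linarith) hG'c hG's
  -- The change of variables costs e^{-Qh}, and Q = 2(1+q) is exactly the ratio of the two
  -- prefactors. So the full gradient terms coincide, angular energy included, and disappear on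
  -- subtraction.
  have hE : Real.exp ((1 + q) * -h) * ∑ i, ∫ p, G' (logGauge γ p) * Du i p * Du i (dil γ (-h) p) =
      Real.exp ((1 + q) * h) * ∑ i, ∫ p, G (logGauge γ p) * Du i p * Du i (dil γ h p) := by
    rw [Finset.mul_sum, Finset.mul_sum]
    refine Finset.sum_congr rfl fun i _ => ?_
    have h1 := integral_comp_dil (γ := γ) h
      (fun p : GrushinSpace m k => G' (logGauge γ p) * Du i p * Du i (dil γ (-h) p))
    have h2 : ∫ p, G (logGauge γ p) * Du i p * Du i (dil γ h p) =
        ∫ p, G' (logGauge γ (dil γ h p)) * Du i (dil γ h p) * Du i (dil γ (-h) (dil γ h p)) := by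
      apply integral_congr_ae
      filter_upwards [ae_ne_zero hm] with p hp
      rw [logGauge_dil hγ h hp, dil_neg_dil]
      simp only [hG', add_sub_cancel_right]
      ring
    rw [h2, h1, ← mul_assoc, ← Real.exp_add]
    congr 2
    rw [hq, halfDim]
    ring
  rw [hE, ← id1] at id2
  have mGF := memLp_radial_smul hγ hG.continuous hGs hF
  have mGws := memLp_radial_smul hγ hdG hdGs hws
  have mGw := memLp_radial_smul hγ hdG hdGs hw
  have mwh := memLp_comp_dil_invMeasure hγ hm h hw
  have mG'F := memLp_radial_smul hγ hG'c.continuous hG's hF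
  have hdG's : ∀ s, s ∉ Set.Icc (c + h) (d + h) → deriv G' s = 0 := fun s hs =>
    deriv_eq_zero_of_notMem_Icc hG's hs
  have hdG'c : Continuous (deriv G') := hG'c.continuous_deriv le_rfl
  have mG'ws := memLp_radial_smul hγ hdG'c hdG's hws
  have mG'w := memLp_radial_smul hγ hdG'c hdG's hw
  have mwh' := memLp_comp_dil_invMeasure hγ hm (-h) hw
  have s1 : ∫ p, (G (logGauge γ p) * F p * w (dil γ h p) +
      deriv G (logGauge γ p) * (ws p - q * w p) * w (dil γ h p)) ∂(invMeasure m k γ) =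
      ∫ p, G (logGauge γ p) * F p * w (dil γ h p) ∂(invMeasure m k γ) +
      ∫ p, deriv G (logGauge γ p) * ws p * w (dil γ h p) ∂(invMeasure m k γ) -
      q * ∫ p, deriv G (logGauge γ p) * w p * w (dil γ h p) ∂(invMeasure m k γ) := by
    have i12 : Integrable (fun p => G (logGauge γ p) * F p * w (dil γ h p) +
        deriv G (logGauge γ p) * ws p * w (dil γ h p)) (invMeasure m k γ) :=
      (mGF.integrable_mul_two mwh).add (mGws.integrable_mul_two mwh)
    rw [← integral_const_mul, ← integral_add (mGF.integrable_mul_two mwh)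
      (mGws.integrable_mul_two mwh), ← integral_sub i12
      ((mGw.integrable_mul_two mwh).const_mul q)]
    congr 1
    ext p
    ring
  have s2 : ∫ p, (G' (logGauge γ p) * F p * w (dil γ (-h) p) +
      deriv G' (logGauge γ p) * (ws p - q * w p) * w (dil γ (-h) p)) ∂(invMeasure m k γ) =
      ∫ p, G' (logGauge γ p) * F p * w (dil γ (-h) p) ∂(invMeasure m k γ) +
      ∫ p, deriv G' (logGauge γ p) * ws p * w (dil γ (-h) p) ∂(invMeasure m k γ) -
      q * ∫ p, deriv G' (logGauge γ p) * w p * w (dil γ (-h) p) ∂(invMeasure m k γ) := by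
    have i12 : Integrable (fun p => G' (logGauge γ p) * F p * w (dil γ (-h) p) +
        deriv G' (logGauge γ p) * ws p * w (dil γ (-h) p)) (invMeasure m k γ) :=
      (mG'F.integrable_mul_two mwh').add (mG'ws.integrable_mul_two mwh')
    rw [← integral_const_mul, ← integral_add (mG'F.integrable_mul_two mwh')
      (mG'ws.integrable_mul_two mwh'), ← integral_sub i12
      ((mG'w.integrable_mul_two mwh').const_mul q)]
    congr 1
    ext p
    ring
  -- By invariance of the measure the terms carrying q also agree, so q drops out of the identity.
  have s3 : ∫ p, deriv G' (logGauge γ p) * w p * w (dil γ (-h) p) ∂(invMeasure m k γ) =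
      ∫ p, deriv G (logGauge γ p) * w p * w (dil γ h p) ∂(invMeasure m k γ) := by
    rw [← integral_invMeasure_comp_dil hγ hm h]
    apply integral_congr_ae
    filter_upwards [ae_invMeasure_ne_zero hm] with p hp
    rw [logGauge_dil hγ h hp, dil_neg_dil, hdG', add_sub_cancel_right]
    ring
  have s4 : ∫ p, F p * (G (logGauge γ (dil γ (-h) p)) * w (dil γ (-h) p)) ∂(invMeasure m k γ) =
      ∫ p, G' (logGauge γ p) * F p * w (dil γ (-h) p) ∂(invMeasure m k γ) := by
    apply integral_congr_ae
    filter_upwards [ae_invMeasure_ne_zero hm] with p hp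
    rw [logGauge_dil hγ (-h) hp, hG', ← sub_eq_add_neg]
    ring
  have s5 : ∫ p, ws p * (deriv G (logGauge γ (dil γ (-h) p)) * w (dil γ (-h) p))
      ∂(invMeasure m k γ) =
      ∫ p, deriv G' (logGauge γ p) * ws p * w (dil γ (-h) p) ∂(invMeasure m k γ) := by
    apply integral_congr_ae
    filter_upwards [ae_invMeasure_ne_zero hm] with p hp
    rw [logGauge_dil hγ (-h) hp, hdG', ← sub_eq_add_neg]
    ring
  rw [s1, s2, s3] at id2
  rw [s4, s5]
  linarith

lemma radial_mul_normFn (G : ℝ → ℝ) (p : GrushinSpace m k) :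
    (annulus γ a b).indicator (fun p => (Real.exp (halfDim m k γ * logGauge γ p) *
      G (logGauge γ p)) * u p) p = G (logGauge γ p) * normFn γ a b u p := by
  by_cases hp : p ∈ (annulus γ a b : Set (GrushinSpace m k))
  · simp only [normFn, Set.indicator_of_mem hp]; ring
  · simp [normFn, Set.indicator_of_notMem hp]

/-- Differentiation along the dilations of pairings with radial multiples of `normFn`. -/
lemma IsHorizLimit.hasDerivAt_normFn (hγ : 0 < γ) (hm : 1 ≤ m)
    (hu : IsHorizLimit γ (annulus γ a b) u Du) {ε : ℝ} (hε : 0 < ε) {G : ℝ → ℝ}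
    (hG : ContDiff ℝ 1 G) {Φ : GrushinSpace m k → ℝ} (hΦ : MemLp Φ 2 (invMeasure m k γ))
    (hΦ0 : ∀ p, p ∉ (annulus γ (a + ε) (b - ε) : Set (GrushinSpace m k)) → Φ p = 0) :
    HasDerivAt (fun h => ∫ p, Φ p * (G (logGauge γ (dil γ h p)) * normFn γ a b u (dil γ h p))
        ∂(invMeasure m k γ))
      (∫ p, Φ p * (deriv G (logGauge γ p) * normFn γ a b u p +
        G (logGauge γ p) * normDeriv γ a b u Du p) ∂(invMeasure m k γ)) 0 := by
  set q := halfDim m k γ with hq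
  have hH : ContDiff ℝ 1 fun s => Real.exp (q * s) * G s :=
    (Real.contDiff_exp.comp (contDiff_const.mul contDiff_id)).mul hG
  have key := hu.hasDerivAt_integral hγ hm hε hH hΦ hΦ0
  have hd : ∀ s, deriv (fun s => Real.exp (q * s) * G s) s =
      Real.exp (q * s) * (q * G s + deriv G s) := by
    intro s
    have h1 : HasDerivAt (fun s => Real.exp (q * s)) (Real.exp (q * s) * q) s := by
      simpa using ((hasDerivAt_id s).const_mul q).exp
    have h2 : HasDerivAt (fun s => Real.exp (q * s) * G s) _ s :=
      h1.mul (hG.differentiable one_ne_zero s).hasDerivAt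
    rw [h2.deriv]
    ring
  simp only [hq, radial_mul_normFn] at key
  convert key using 3 with p
  · by_cases hp : p ∈ (annulus γ a b : Set (GrushinSpace m k))
    · simp only [normFn, normDeriv, Set.indicator_of_mem hp]
      rw [hd]
      ring
    · simp [normFn, normDeriv, Set.indicator_of_notMem hp]

lemma indicator_radial_eq {c d : ℝ} {G : ℝ → ℝ} (hGs : ∀ s, s ∉ Set.Icc c d → G s = 0) {a' b' : ℝ}
    (hac : a' < c) (hdb : d < b') {p : GrushinSpace m k} (hp0 : p ≠ 0)
    (hp : p ∉ (annulus γ a' b' : Set (GrushinSpace m k))) : G (logGauge γ p) = 0 := by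
  apply hGs
  intro h
  exact hp ⟨hp0, by linarith [h.1], by linarith [h.2]⟩

/-- Pairings `∫ Φ · (G(S) w) ∘ δ_{-h}` with `Φ` not compactly supported. -/
lemma IsHorizLimit.hasDerivAt_normFn_neg (hγ : 0 < γ) (hm : 1 ≤ m)
    (hu : IsHorizLimit γ (annulus γ a b) u Du) {c d : ℝ} (hac : a < c) (hdb : d < b) {G : ℝ → ℝ}
    (hG : ContDiff ℝ 1 G) (hGs : ∀ s, s ∉ Set.Icc c d → G s = 0) {Φ : GrushinSpace m k → ℝ}
    (hΦ : MemLp Φ 2 (invMeasure m k γ)) :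
    HasDerivAt (fun h => ∫ p, Φ p * (G (logGauge γ (dil γ (-h) p)) *
        normFn γ a b u (dil γ (-h) p)) ∂(invMeasure m k γ))
      (-∫ p, Φ p * (deriv G (logGauge γ p) * normFn γ a b u p +
        G (logGauge γ p) * normDeriv γ a b u Du p) ∂(invMeasure m k γ)) 0 := by
  -- Two margins of size ε: one for truncating Φ to a smaller annulus, one for translating the
  -- support of G by |h| < ε. The truncation then changes neither the pairings near h = 0 nor the
  -- derivative.
  obtain ⟨ε, hε, h1, h2⟩ : ∃ ε, 0 < ε ∧ a + 2 * ε < c ∧ d < b - 2 * ε := by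
    refine ⟨min (c - a) (b - d) / 3, by have := lt_min (sub_pos.2 hac) (sub_pos.2 hdb); positivity,
      ?_, ?_⟩
    · have := lt_min (sub_pos.2 hac) (sub_pos.2 hdb)
      linarith [min_le_left (c - a) (b - d)]
    · have := lt_min (sub_pos.2 hac) (sub_pos.2 hdb)
      linarith [min_le_right (c - a) (b - d)]
  set A1 := (annulus γ (a + ε) (b - ε) : Set (GrushinSpace m k)) with hA1
  have hmA1 : MeasurableSet A1 := measurableSet_annulus hγ _ _
  have key := hu.hasDerivAt_normFn hγ hm hε hG (Φ := A1.indicator Φ) (hΦ.indicator hmA1)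
    (fun p hp => Set.indicator_of_notMem hp _)
  have hdGs : ∀ s, s ∉ Set.Icc c d → deriv G s = 0 := fun s hs =>
    deriv_eq_zero_of_notMem_Icc hGs hs
  have e1 : ∫ p, A1.indicator Φ p * (deriv G (logGauge γ p) * normFn γ a b u p +
        G (logGauge γ p) * normDeriv γ a b u Du p) ∂(invMeasure m k γ) =
      ∫ p, Φ p * (deriv G (logGauge γ p) * normFn γ a b u p +
        G (logGauge γ p) * normDeriv γ a b u Du p) ∂(invMeasure m k γ) := by
    apply integral_congr_ae
    filter_upwards [ae_invMeasure_ne_zero hm] with p hp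
    by_cases hpA : p ∈ A1
    · rw [Set.indicator_of_mem hpA]
    · rw [indicator_radial_eq hGs (by linarith) (by linarith) hp hpA,
        indicator_radial_eq hdGs (by linarith) (by linarith) hp hpA]
      simp
  rw [e1] at key
  have key2 := HasDerivAt.scomp (h := fun h : ℝ => -h) (0 : ℝ) (by simpa using key)
    (hasDerivAt_neg 0)
  simp only [neg_smul, one_smul] at key2
  refine key2.congr_of_eventuallyEq ?_
  filter_upwards [Ioo_mem_nhds (neg_lt_zero.2 hε) hε] with h hh
  apply integral_congr_ae
  filter_upwards [ae_invMeasure_ne_zero hm] with p hp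
  by_cases hpA : p ∈ A1
  · rw [Set.indicator_of_mem hpA]
  · rw [Set.indicator_of_notMem hpA, logGauge_dil hγ _ hp, hGs]
    · simp
    · intro hI
      exact hpA ⟨hp, by linarith [hI.1, hh.1, hh.2], by linarith [hI.2, hh.1, hh.2]⟩

/-- Here the cutoff stays with Φ and is not moved by the flow, so it need only be continuous; the
moving side carries the radial factor 1. -/
lemma IsHorizLimit.hasDerivAt_normFn_pos (hγ : 0 < γ) (hm : 1 ≤ m)
    (hu : IsHorizLimit γ (annulus γ a b) u Du) {c d : ℝ} (hd : d < 0) (hac : a < c) (hdb : d < b)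
    {G : ℝ → ℝ} (hG : Continuous G) (hGs : ∀ s, s ∉ Set.Icc c d → G s = 0)
    {Φ : GrushinSpace m k → ℝ} (hΦ : MemLp Φ 2 (invMeasure m k γ)) :
    HasDerivAt (fun h => ∫ p, G (logGauge γ p) * Φ p * normFn γ a b u (dil γ h p)
        ∂(invMeasure m k γ))
      (∫ p, G (logGauge γ p) * Φ p * normDeriv γ a b u Du p ∂(invMeasure m k γ)) 0 := by
  obtain ⟨ε, hε, h1, h2⟩ : ∃ ε, 0 < ε ∧ a + ε < c ∧ d < b - ε := by
    refine ⟨min (c - a) (b - d) / 2, by have := lt_min (sub_pos.2 hac) (sub_pos.2 hdb); positivity,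
      ?_, ?_⟩
    · have := lt_min (sub_pos.2 hac) (sub_pos.2 hdb)
      linarith [min_le_left (c - a) (b - d)]
    · have := lt_min (sub_pos.2 hac) (sub_pos.2 hdb)
      linarith [min_le_right (c - a) (b - d)]
  have key := hu.hasDerivAt_normFn hγ hm hε (G := fun _ => 1) contDiff_const
    (memLp_radial_smul hγ hG hGs hΦ) ?_
  · simpa using key
  · intro p hp
    by_cases hp0 : p = 0
    · rw [hp0, logGauge_zero hγ, hGs 0 (fun h => by linarith [h.2]), zero_mul]
    · rw [indicator_radial_eq hGs h1 h2 hp0 hp, zero_mul]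

/-- The integrated Rellich type identity for the normalised solution. -/
lemma IsAnnulusSolution.rellich (hγ : 0 < γ) (hm : 1 ≤ m) (hK : 0 ≤ K)
    (hu : IsAnnulusSolution γ K a b u Du D2u) {c d : ℝ} (hd : d < 0)
    (hac : a < c) (hdb : d < b) {G : ℝ → ℝ} (hG : ContDiff ℝ 2 G)
    (hGs : ∀ s, s ∉ Set.Icc c d → G s = 0) :
    ∫ p, (2 * G (logGauge γ p) * normLap γ a b D2u p * normDeriv γ a b u Du p +
      deriv G (logGauge γ p) * normLap γ a b D2u p * normFn γ a b u p +
      2 * deriv G (logGauge γ p) * normDeriv γ a b u Du p ^ 2 +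
      deriv (deriv G) (logGauge γ p) * normFn γ a b u p * normDeriv γ a b u Du p)
        ∂(invMeasure m k γ) = 0 := by
  have hl := hu.isLimit.isHorizLimit
  have hw := hl.memLp_normFn hγ
  have hws := hl.memLp_normDeriv hγ
  have hF := hu.memLp_normLap hγ hm hK
  have hG1 : ContDiff ℝ 1 G := hG.of_le (by norm_num)
  have hdG : ContDiff ℝ 1 (deriv G) := ((contDiff_succ_iff_deriv (n := 1)).1
    (by simpa [one_add_one_eq_two] using hG)).2.2
  have hdGs : ∀ s, s ∉ Set.Icc c d → deriv G s = 0 := fun s hs =>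
    deriv_eq_zero_of_notMem_Icc hGs hs
  have hddGs : ∀ s, s ∉ Set.Icc c d → deriv (deriv G) s = 0 := fun s hs =>
    deriv_eq_zero_of_notMem_Icc hdGs hs
  have hddG : Continuous (deriv (deriv G)) := hdG.continuous_deriv le_rfl
  -- The four pairings of `flow_identity` are differentiated at h = 0. Each derivative falls on the
  -- dilated copy of w, so no second derivative of w along the flow is ever needed.
  have d1 := hl.hasDerivAt_normFn_pos hγ hm hd hac hdb hG1.continuous hGs hF
  have d2 := hl.hasDerivAt_normFn_pos hγ hm hd hac hdb hdG.continuous hdGs hws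
  have d3 := hl.hasDerivAt_normFn_neg hγ hm hac hdb hG1 hGs hF
  have d4 := hl.hasDerivAt_normFn_neg hγ hm hac hdb hdG hdGs hws
  have hev : ∀ᶠ h : ℝ in 𝓝 0, d + h < 0 ∧ a < c + h ∧ d + h < b := by
    have c1 : Tendsto (fun h : ℝ => d + h) (𝓝 0) (𝓝 d) := by
      have := (continuous_const_add d).tendsto 0
      rwa [add_zero] at this
    have c2 : Tendsto (fun h : ℝ => c + h) (𝓝 0) (𝓝 c) := by
      have := (continuous_const_add c).tendsto 0
      rwa [add_zero] at this
    exact (c1.eventually_lt_const hd).and ((c2.eventually_const_lt hac).and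
      (c1.eventually_lt_const hdb))
  have heq := (d3.add d4).congr_of_eventuallyEq (hev.mono fun h hh =>
    hu.flow_identity hγ hm hK hd hh.1 hac hdb hh.2.1 hh.2.2 hG1 hGs)
  have huniq := (d1.add d2).unique heq
  have mGF := memLp_radial_smul hγ hG1.continuous hGs hF
  have mG'F := memLp_radial_smul hγ hdG.continuous hdGs hF
  have mG'ws := memLp_radial_smul hγ hdG.continuous hdGs hws
  have mG''w := memLp_radial_smul hγ hddG hddGs hw
  have mGws := memLp_radial_smul hγ hG1.continuous hGs hws
  have mG'w := memLp_radial_smul hγ hdG.continuous hdGs hw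
  have i1 := mGF.integrable_mul_two hws
  have i2 := mG'ws.integrable_mul_two hws
  have i3 : Integrable (fun p => normLap γ a b D2u p * (deriv G (logGauge γ p) *
      normFn γ a b u p + G (logGauge γ p) * normDeriv γ a b u Du p)) (invMeasure m k γ) :=
    hF.integrable_mul_two (mG'w.add mGws)
  have i4 : Integrable (fun p => normDeriv γ a b u Du p * (deriv (deriv G) (logGauge γ p) *
      normFn γ a b u p + deriv G (logGauge γ p) * normDeriv γ a b u Du p)) (invMeasure m k γ) :=
    hws.integrable_mul_two (mG''w.add mG'ws)
  have i12 : Integrable (fun p => G (logGauge γ p) * normLap γ a b D2u p * normDeriv γ a b u Du p +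
      deriv G (logGauge γ p) * normDeriv γ a b u Du p * normDeriv γ a b u Du p)
      (invMeasure m k γ) := i1.add i2
  have i34 : Integrable (fun p => normLap γ a b D2u p * (deriv G (logGauge γ p) *
      normFn γ a b u p + G (logGauge γ p) * normDeriv γ a b u Du p) +
      normDeriv γ a b u Du p * (deriv (deriv G) (logGauge γ p) *
      normFn γ a b u p + deriv G (logGauge γ p) * normDeriv γ a b u Du p)) (invMeasure m k γ) :=
    i3.add i4
  have : 0 = (∫ p, G (logGauge γ p) * normLap γ a b D2u p * normDeriv γ a b u Du p
      ∂(invMeasure m k γ) + ∫ p, deriv G (logGauge γ p) * normDeriv γ a b u Du p *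
        normDeriv γ a b u Du p ∂(invMeasure m k γ)) + (∫ p, normLap γ a b D2u p *
        (deriv G (logGauge γ p) * normFn γ a b u p +
        G (logGauge γ p) * normDeriv γ a b u Du p) ∂(invMeasure m k γ) +
      ∫ p, normDeriv γ a b u Du p *
        (deriv (deriv G) (logGauge γ p) * normFn γ a b u p +
        deriv G (logGauge γ p) * normDeriv γ a b u Du p) ∂(invMeasure m k γ)) := by
    linarith
  rw [this, ← integral_add i1 i2, ← integral_add i3 i4, ← integral_add i12 i34]
  congr 1
  ext p
  ring

/-- Integration by parts along the dilations. -/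
lemma IsHorizLimit.radial_ibp (hγ : 0 < γ) (hm : 1 ≤ m)
    (hl : IsHorizLimit γ (annulus γ a b) u Du) {c d : ℝ} (hd : d < 0)
    (hac : a < c) (hdb : d < b) {G : ℝ → ℝ} (hG : ContDiff ℝ 1 G)
    (hGs : ∀ s, s ∉ Set.Icc c d → G s = 0) :
    ∫ p, (2 * G (logGauge γ p) * normFn γ a b u p * normDeriv γ a b u Du p +
      deriv G (logGauge γ p) * normFn γ a b u p ^ 2) ∂(invMeasure m k γ) = 0 := by
  have hw := hl.memLp_normFn hγ
  have hws := hl.memLp_normDeriv hγ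
  have hdG : Continuous (deriv G) := hG.continuous_deriv le_rfl
  have hdGs : ∀ s, s ∉ Set.Icc c d → deriv G s = 0 := fun s hs =>
    deriv_eq_zero_of_notMem_Icc hGs hs
  have d1 := hl.hasDerivAt_normFn_pos hγ hm hd hac hdb hG.continuous hGs hw
  have d2 := hl.hasDerivAt_normFn_neg hγ hm hac hdb hG hGs hw
  -- Invariance of the measure moves the dilation from one factor to the other; the two expressions
  -- are then differentiated at h = 0 and compared.
  have heq : (fun h => ∫ p, G (logGauge γ p) * normFn γ a b u p * normFn γ a b u (dil γ h p)
        ∂(invMeasure m k γ)) = fun h => ∫ p, normFn γ a b u p * (G (logGauge γ (dil γ (-h) p)) *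
        normFn γ a b u (dil γ (-h) p)) ∂(invMeasure m k γ) := by
    ext h
    rw [← integral_invMeasure_comp_dil hγ hm h (fun p => normFn γ a b u p *
      (G (logGauge γ (dil γ (-h) p)) * normFn γ a b u (dil γ (-h) p)))]
    congr 1
    ext p
    rw [dil_neg_dil]
    ring
  rw [heq] at d1
  have huniq := d1.unique d2
  have mGw := memLp_radial_smul hγ hG.continuous hGs hw
  have mGws := memLp_radial_smul hγ hG.continuous hGs hws
  have mG'w := memLp_radial_smul hγ hdG hdGs hw
  have i1 := mGw.integrable_mul_two hws
  have i2 : Integrable (fun p => normFn γ a b u p * (deriv G (logGauge γ p) *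
      normFn γ a b u p + G (logGauge γ p) * normDeriv γ a b u Du p)) (invMeasure m k γ) :=
    hw.integrable_mul_two (mG'w.add mGws)
  have : 0 = ∫ p, G (logGauge γ p) * normFn γ a b u p * normDeriv γ a b u Du p
      ∂(invMeasure m k γ) + ∫ p, normFn γ a b u p * (deriv G (logGauge γ p) * normFn γ a b u p +
        G (logGauge γ p) * normDeriv γ a b u Du p) ∂(invMeasure m k γ) := by
    linarith
  rw [this, ← integral_add i1 i2]
  congr 1
  ext p
  ring

end

end

/-! ### The Caccioppoli inequality and the Carleman estimate. -/

noncomputable section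

variable {m k : ℕ} {γ : ℝ}

section

variable {a b K : ℝ} {u : GrushinSpace m k → ℝ} {Du : Fin m ⊕ Fin k → GrushinSpace m k → ℝ}
  {D2u : Fin m ⊕ Fin k → Fin m ⊕ Fin k → GrushinSpace m k → ℝ}

lemma integrable_radial_mul_mul (hγ : 0 < γ) {ν : Measure (GrushinSpace m k)} {G : ℝ → ℝ} {c d : ℝ}
    (hGc : Continuous G) (hG : ∀ s, s ∉ Set.Icc c d → G s = 0) {f g : GrushinSpace m k → ℝ}
    (hf : MemLp f 2 ν) (hg : MemLp g 2 ν) :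
    Integrable (fun p => G (logGauge γ p) * f p * g p) ν :=
  (memLp_radial_smul hγ hGc hG hf).integrable_mul_two hg

/-- The combination ws - q w is ρ^q times the dilation derivative of u, so the left side is the
radial part of the horizontal energy; the angular part is discarded. -/
lemma integral_sq_normDeriv_sub_le (hγ : 0 < γ) (hl : IsHorizLimit γ (annulus γ a b) u Du)
    {c d : ℝ} (hd : d < 0) (hac : a < c) (hdb : d < b) {G : ℝ → ℝ} (hG : Continuous G)
    (hGs : ∀ s, s ∉ Set.Icc c d → G s = 0) (hG0 : ∀ s, 0 ≤ G s) :
    ∫ p, G (logGauge γ p) * (normDeriv γ a b u Du p - halfDim m k γ * normFn γ a b u p) ^ 2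
      ∂(invMeasure m k γ) ≤ ∑ i, ∫ p, G (logGauge γ p) * Du i p * Du i p := by
  obtain ⟨C, hC0, hC⟩ := exists_bound_of_support hG hGs
  have hz : ∀ p : GrushinSpace m k, p ∉ (annulus γ a b : Set (GrushinSpace m k)) →
      G (logGauge γ p) = 0 := by
    intro p hp
    by_cases hp0 : p = 0
    · rw [hp0, logGauge_zero hγ, hGs 0 fun h => by linarith [h.2]]
    · exact indicator_radial_eq hGs hac hdb hp0 hp
  have hi : ∀ i, Integrable (fun p => G (logGauge γ p) * Du i p * Du i p) := fun i =>
    integrable_mul_mul_of_L2 (fun _ => hC _) (hG.measurable.comp (measurable_logGauge hγ)) hz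
      (hl.memLp_D i) (hl.memLp_D i)
  rw [integral_invMeasure hγ, ← integral_finsetSum _ fun i _ => hi i]
  refine integral_mono_of_nonneg (Eventually.of_forall fun p => ?_)
    (integrable_finsetSum _ fun i _ => hi i) (Eventually.of_forall fun p => ?_)
  · have := invDensity_nonneg hγ p
    have := hG0 (logGauge γ p)
    simp only [Pi.zero_apply]
    positivity
  · simp only
    by_cases hp : p ∈ (annulus γ a b : Set (GrushinSpace m k))
    · simp only [normFn, normDeriv, Set.indicator_of_mem hp, invDensity]
      have hE : Real.exp (-2 * halfDim m k γ * logGauge γ p) *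
          Real.exp (halfDim m k γ * logGauge γ p) ^ 2 = 1 := by
        rw [← Real.exp_nat_mul, ← Real.exp_add, Real.exp_eq_one_iff]
        push_cast
        ring
      have h1 := gaugeWeight_mul_dilDeriv_sq_le hγ Du p
      have h2 : ∑ i, G (logGauge γ p) * Du i p * Du i p =
          G (logGauge γ p) * ∑ i, Du i p ^ 2 := by
        rw [Finset.mul_sum]
        exact Finset.sum_congr rfl fun i _ => by ring
      rw [h2]
      refine le_trans (le_of_eq ?_) (mul_le_mul_of_nonneg_left h1 (hG0 _))
      linear_combination (gaugeWeight γ p * G (logGauge γ p) * dilDeriv γ Du p ^ 2) * hE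
    · simp [hz p hp]

/-- A Caccioppoli type inequality for the dilation derivative. -/
lemma IsAnnulusSolution.caccioppoli (hγ : 0 < γ) (hm : 1 ≤ m) (hK : 0 ≤ K)
    (hu : IsAnnulusSolution γ K a b u Du D2u) {c d : ℝ} (hd : d < 0)
    (hac : a < c) (hdb : d < b) {ζ : ℝ → ℝ} (hζ : ContDiff ℝ 1 ζ)
    (hζs : ∀ s, s ∉ Set.Icc c d → ζ s = 0) :
    ∫ p, ζ (logGauge γ p) ^ 2 * normDeriv γ a b u Du p * normDeriv γ a b u Du p
      ∂(invMeasure m k γ) ≤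
    ∫ p, ((4 * K + 2 * halfDim m k γ ^ 2) * ζ (logGauge γ p) ^ 2 +
      8 * deriv ζ (logGauge γ p) ^ 2) * normFn γ a b u p * normFn γ a b u p
        ∂(invMeasure m k γ) := by
  have hl := hu.isLimit.isHorizLimit
  set q := halfDim m k γ with hq
  set w := normFn γ a b u with hwdef
  set ws := normDeriv γ a b u Du with hwsdef
  set F := normLap γ a b D2u with hFdef
  have hw : MemLp w 2 (invMeasure m k γ) := hl.memLp_normFn hγ
  have hws : MemLp ws 2 (invMeasure m k γ) := hl.memLp_normDeriv hγ
  have hF : MemLp F 2 (invMeasure m k γ) := hu.memLp_normLap hγ hm hK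
  have hdζ : Continuous (deriv ζ) := hζ.continuous_deriv le_rfl
  have hdζs : ∀ s, s ∉ Set.Icc c d → deriv ζ s = 0 := fun s hs =>
    deriv_eq_zero_of_notMem_Icc hζs hs
  have hG : ContDiff ℝ 1 fun s => ζ s ^ 2 := hζ.pow 2
  have hGs : ∀ s, s ∉ Set.Icc c d → ζ s ^ 2 = 0 := fun s hs => by simp [hζs s hs]
  have hGd : ∀ s, deriv (fun s => ζ s ^ 2) s = 2 * ζ s * deriv ζ s := by
    intro s
    have h2 : HasDerivAt (fun s => ζ s ^ 2) _ s :=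
      (hζ.differentiable one_ne_zero s).hasDerivAt.pow 2
    rw [h2.deriv]
    simp
  -- At h = 0 the test function is ζ² u, as in the classical Caccioppoli argument.
  have id1 := hu.weak_identity hγ hm (h := 0) hd hac hdb (by linarith) (by linarith) hG hGs
  have id2 := integral_sq_normDeriv_sub_le hγ hl hd hac hdb hG.continuous hGs fun s => sq_nonneg _
  simp only [dil_zero, mul_zero, Real.exp_zero, one_mul] at id1
  rw [← hq, ← hwdef, ← hwsdef] at id2
  have hy : MemLp (fun p => ws p - q * w p) 2 (invMeasure m k γ) := hws.sub (hw.const_mul q)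
  have hcG : Continuous fun s => ζ s ^ 2 := hG.continuous
  have hcG' : Continuous fun s => deriv (fun s => ζ s ^ 2) s := by
    simp only [hGd]
    exact (continuous_const.mul hζ.continuous).mul hdζ
  have hG's : ∀ s, s ∉ Set.Icc c d → deriv (fun s => ζ s ^ 2) s = 0 := fun s hs =>
    deriv_eq_zero_of_notMem_Icc hGs hs
  have i1 : Integrable (fun p => ζ (logGauge γ p) ^ 2 * (ws p - q * w p) ^ 2)
      (invMeasure m k γ) := by
    refine (integrable_radial_mul_mul hγ hcG hGs hy hy).congr (Eventually.of_forall fun p => ?_)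
    simp only
    ring
  have i2 : Integrable (fun p => ζ (logGauge γ p) ^ 2 * F p * w p +
      deriv (fun s => ζ s ^ 2) (logGauge γ p) * (ws p - q * w p) * w p) (invMeasure m k γ) :=
    (integrable_radial_mul_mul hγ hcG hGs hF hw).add
      (integrable_radial_mul_mul hγ hcG' hG's hy hw)
  have i3 := integrable_radial_mul_mul hγ hcG hGs hws hws
  have i4 : Integrable (fun p => ((4 * K + 2 * q ^ 2) * ζ (logGauge γ p) ^ 2 +
      8 * deriv ζ (logGauge γ p) ^ 2) * w p * w p) (invMeasure m k γ) :=
    integrable_radial_mul_mul hγ (c := c) (d := d) (G := fun s => (4 * K + 2 * q ^ 2) * ζ s ^ 2 + 8 * deriv ζ s ^ 2)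
      ((continuous_const.mul hcG).add (continuous_const.mul (hdζ.pow 2)))
      (fun s hs => by simp [hζs s hs, hdζs s hs]) hw hw
  -- With y = ws - q w, the square 2(ζy + 2ζ'w)² uses half of the 4ζ²y² to absorb the cross term, at
  -- the cost 8ζ'²w². The remaining 2ζ²y² dominates ζ²ws² - 2q²ζ²w², and the potential costs 4Kζ²w².
  have key : ∫ p, ((4 * (ζ (logGauge γ p) ^ 2 * (ws p - q * w p) ^ 2)) +
      4 * (ζ (logGauge γ p) ^ 2 * F p * w p +
      deriv (fun s => ζ s ^ 2) (logGauge γ p) * (ws p - q * w p) * w p)) ∂(invMeasure m k γ) ≤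
      0 := by
    rw [integral_add (i1.const_mul 4) (i2.const_mul 4), integral_const_mul, integral_const_mul, id1]
    linarith
  have key2 := integral_mono_ae (i3.sub i4) ((i1.const_mul 4).add (i2.const_mul 4)) ?_
  · rw [integral_sub' i3 i4] at key2
    have := key2.trans key
    linarith
  · filter_upwards [invMeasure_absolutelyContinuous.ae_le (hu.abs_normLap_le hγ hm)] with p hp
    simp only [Pi.sub_apply, Pi.add_apply, hGd]
    set s := logGauge γ p
    rw [← hwdef, ← hFdef] at hp
    by_cases hs : s ∈ Set.Icc c d
    · have hE : Real.exp (2 * s) ≤ 1 := Real.exp_le_one_iff.2 (by linarith [hs.2])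
      have hF1 : |F p| ≤ K * |w p| := by
        refine hp.trans ?_
        rw [mul_assoc]
        refine mul_le_mul_of_nonneg_left ?_ hK
        exact mul_le_of_le_one_left (abs_nonneg _) hE
      have hFw : -(K * w p ^ 2) ≤ F p * w p := by
        have h1 : |F p * w p| ≤ K * w p ^ 2 := by
          rw [abs_mul, ← sq_abs (w p), sq, ← mul_assoc]
          exact mul_le_mul_of_nonneg_right hF1 (abs_nonneg _)
        exact (abs_le.1 h1).1
      have h1 := mul_le_mul_of_nonneg_left hFw (sq_nonneg (ζ s))
      set y := ws p - q * w p with hydef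
      have hwsy : ws p = y + q * w p := by rw [hydef]; ring
      rw [hwsy]
      nlinarith [sq_nonneg (ζ s * y + 2 * deriv ζ s * w p), mul_nonneg (sq_nonneg (ζ s)) (sq_nonneg (y - q * w p))]
    · simp [hζs s hs, hdζs s hs]

/-- The pointwise inequality behind the Carleman estimate. -/
lemma carleman_pointwise {α E K x x1 x2 w ws F : ℝ} (hα : 1 ≤ α) (hE : 0 < E) (hE4 : E ≤ 1 / 4)
    (hαK : K ^ 2 ≤ α ^ 3) (hF : |F| ≤ K * E ^ 2 * |w|) :
    1 / 8 * α ^ 3 * E * (x * w) ^ 2 - (16 * x1 ^ 2 * ws ^ 2 + 4 * x2 ^ 2 * w ^ 2) ≤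
      (x * F + 2 * x1 * ws + x2 * w) * (2 * (α * (E - 1)) * (x * ws + (α * (E - 1) * x + x1) * w) +
        α * E * (x * w)) +
      (4 * (α * (E - 1)) ^ 2 + 2 * (α * E)) * (x * ws + (α * (E - 1) * x + x1) * w) ^ 2 +
      (2 * (α * (E - 1)) ^ 2 * (α * E) - (α * E) ^ 2 - 2 * (α * (E - 1)) * (α * E) -
        1 / 2 * (α * E)) * (x * w) ^ 2 := by
  have hF2 : F ^ 2 ≤ α ^ 3 * E ^ 4 * w ^ 2 := by
    have h1 : F ^ 2 ≤ (K * E ^ 2 * |w|) ^ 2 := by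
      rw [← sq_abs F]
      exact pow_le_pow_left₀ (abs_nonneg _) hF 2
    rw [mul_pow, mul_pow, sq_abs] at h1
    refine h1.trans ?_
    have : (E ^ 2) ^ 2 = E ^ 4 := by ring
    rw [this]
    gcongr
  -- With φ = α(e^s - s) and E = e^s: g = φ' and A = φ'' = g'. The letters x, x1, x2 stand for the
  -- cutoff χ and its derivatives, vs is e^{-φ} times the derivative of e^φ χ w, and e collects the
  -- cutoff errors.
  set g := α * (E - 1) with hg
  set A := α * E with hA
  set vs := x * ws + (g * x + x1) * w
  set v := x * w with hv
  set e := 2 * x1 * ws + x2 * w with he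
  have hα0 : 0 < α := by linarith
  have hA0 : 0 < A := by positivity
  have hA4 : A ≤ α / 4 := by rw [hA]; nlinarith
  have hg0 : g ≤ -(3 / 4) * α := by rw [hg]; nlinarith
  have hg2 : 9 / 16 * α ^ 2 ≤ g ^ 2 := by nlinarith
  -- This is where K² ≤ α³ enters: the surplus E³ ≤ 1/64 makes the potential a small fraction of the
  -- bulk term.
  have hxF : (x * F) ^ 2 ≤ 1 / 64 * α ^ 2 * A * v ^ 2 := by
    have h1 : (x * F) ^ 2 ≤ x ^ 2 * (α ^ 3 * E ^ 4 * w ^ 2) := by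
      rw [mul_pow]
      exact mul_le_mul_of_nonneg_left hF2 (sq_nonneg _)
    have h3 : E ^ 3 ≤ 1 / 64 := by
      calc E ^ 3 ≤ (1 / 4) ^ 3 := pow_le_pow_left₀ hE.le hE4 3
        _ = 1 / 64 := by norm_num
    have h4 : x ^ 2 * (α ^ 3 * E ^ 4 * w ^ 2) = E ^ 3 * (α ^ 2 * A * v ^ 2) := by
      rw [hA, hv]; ring
    have h5 : 0 ≤ α ^ 2 * A * v ^ 2 := by positivity
    have h6 := mul_le_mul_of_nonneg_right h3 h5
    linarith
  have he2 : e ^ 2 ≤ 8 * x1 ^ 2 * ws ^ 2 + 2 * x2 ^ 2 * w ^ 2 := by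
    rw [he]
    nlinarith [sq_nonneg (2 * x1 * ws - x2 * w)]
  have hH2 : (x * F + e) ^ 2 ≤ 2 * (x * F) ^ 2 + 2 * e ^ 2 := by
    nlinarith [sq_nonneg (x * F - e)]
  have hHe : x * F + 2 * x1 * ws + x2 * w = x * F + e := by rw [he]; ring
  rw [hHe]
  set H := x * F + e
  -- Completing the squares in `c1` and `c2` removes the products of H with vs and with v and costs
  -- 3/4 H² together with A²v²/2. The first cost is split into potential and cutoff errors; the
  -- second is included in `c3`.
  have c1 : 0 ≤ (2 * g * vs + H / 2) ^ 2 := sq_nonneg _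
  have c2 : 0 ≤ 1 / 2 * (A * v + H) ^ 2 := by positivity
  have c3 : 1 / 4 * α ^ 2 * A * v ^ 2 ≤
      (2 * g ^ 2 * A - A ^ 2 - 2 * g * A - 1 / 2 * A - 1 / 2 * A ^ 2) * v ^ 2 := by
    apply mul_le_mul_of_nonneg_right _ (sq_nonneg v)
    have h1 : 1 / 4 * α ^ 2 ≤ 2 * g ^ 2 - A - 2 * g - 1 / 2 - 1 / 2 * A := by
      linarith [sq_nonneg α]
    have h2 := mul_le_mul_of_nonneg_left h1 hA0.le
    linarith
  have c4 : 0 ≤ 2 * A * vs ^ 2 := by positivity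
  have c5 : 1 / 8 * α ^ 3 * E * v ^ 2 = 1 / 8 * α ^ 2 * A * v ^ 2 := by rw [hA]; ring
  have c6 : 0 ≤ α ^ 2 * A * v ^ 2 := by positivity
  have c7 : 0 ≤ 16 * x1 ^ 2 * ws ^ 2 + 4 * x2 ^ 2 * w ^ 2 := by positivity
  rw [c5]
  clear_value H v vs A g
  linarith

/-- The exponential Carleman weight `exp (2 α (e^s - s))`. -/
def carlemanWeight (α s : ℝ) : ℝ := Real.exp (2 * α * (Real.exp s - s))

lemma carlemanWeight_pos (α s : ℝ) : 0 < carlemanWeight α s := Real.exp_pos _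

lemma hasDerivAt_carlemanWeight (α s : ℝ) :
    HasDerivAt (carlemanWeight α) (2 * (α * (Real.exp s - 1)) * carlemanWeight α s) s := by
  have h : HasDerivAt (fun s => 2 * α * (Real.exp s - s)) (2 * α * (Real.exp s - 1)) s :=
    ((Real.hasDerivAt_exp s).sub (hasDerivAt_id s)).const_mul _
  exact h.exp.congr_deriv (by rw [carlemanWeight]; ring)

lemma contDiff_carlemanWeight (α : ℝ) {n : WithTop ℕ∞} : ContDiff ℝ n (carlemanWeight α) :=
  Real.contDiff_exp.comp (contDiff_const.mul (Real.contDiff_exp.sub contDiff_id))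

/-- The Carleman estimate. -/
lemma IsAnnulusSolution.carleman (hγ : 0 < γ) (hm : 1 ≤ m) (hK : 0 ≤ K)
    (hu : IsAnnulusSolution γ K a b u Du D2u) {c d : ℝ} (hd : d < 0) (hd4 : Real.exp d ≤ 1 / 4)
    (hac : a < c) (hdb : d < b) {χ : ℝ → ℝ} (hχ : ContDiff ℝ 2 χ)
    (hχs : ∀ s, s ∉ Set.Icc c d → χ s = 0) {α : ℝ} (hα : 1 ≤ α) (hαK : K ^ 2 ≤ α ^ 3) :
    ∫ p, (1 / 8 * α ^ 3 * Real.exp (logGauge γ p) * carlemanWeight α (logGauge γ p) *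
      χ (logGauge γ p) ^ 2) * normFn γ a b u p * normFn γ a b u p ∂(invMeasure m k γ) ≤
    ∫ p, ((16 * carlemanWeight α (logGauge γ p) * deriv χ (logGauge γ p) ^ 2) *
        normDeriv γ a b u Du p * normDeriv γ a b u Du p +
      (4 * carlemanWeight α (logGauge γ p) * deriv (deriv χ) (logGauge γ p) ^ 2) *
        normFn γ a b u p * normFn γ a b u p) ∂(invMeasure m k γ) := by
  have hl := hu.isLimit.isHorizLimit
  set w := normFn γ a b u with hwdef
  set ws := normDeriv γ a b u Du with hwsdef
  set F := normLap γ a b D2u with hFdef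
  have hw : MemLp w 2 (invMeasure m k γ) := hl.memLp_normFn hγ
  have hws : MemLp ws 2 (invMeasure m k γ) := hl.memLp_normDeriv hγ
  have hF : MemLp F 2 (invMeasure m k γ) := hu.memLp_normLap hγ hm hK
  have hχ1 : ContDiff ℝ 1 χ := hχ.of_le (by norm_num)
  have hdχ : ContDiff ℝ 1 (deriv χ) := ((contDiff_succ_iff_deriv (n := 1)).1
    (by simpa [one_add_one_eq_two] using hχ)).2.2
  have hdχs : ∀ s, s ∉ Set.Icc c d → deriv χ s = 0 := fun s hs =>
    deriv_eq_zero_of_notMem_Icc hχs hs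
  have hddχs : ∀ s, s ∉ Set.Icc c d → deriv (deriv χ) s = 0 := fun s hs =>
    deriv_eq_zero_of_notMem_Icc hdχs hs
  have hddχ : Continuous (deriv (deriv χ)) := hdχ.continuous_deriv le_rfl
  have hPc : Continuous (carlemanWeight α) := (contDiff_carlemanWeight α (n := 0)).continuous
  set g : ℝ → ℝ := fun s => α * (Real.exp s - 1) with hg
  set A : ℝ → ℝ := fun s => α * Real.exp s with hA
  set P := carlemanWeight α with hP
  have dg : ∀ s, HasDerivAt g (A s) s := fun s =>
    ((Real.hasDerivAt_exp s).sub_const 1).const_mul α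
  have dA : ∀ s, HasDerivAt A (A s) s := fun s => (Real.hasDerivAt_exp s).const_mul α
  have dP : ∀ s, HasDerivAt P (2 * g s * P s) s := fun s => hasDerivAt_carlemanWeight α s
  have dχ : ∀ s, HasDerivAt χ (deriv χ s) s := fun s =>
    (hχ1.differentiable one_ne_zero s).hasDerivAt
  have ddχ : ∀ s, HasDerivAt (deriv χ) (deriv (deriv χ) s) s := fun s =>
    (hdχ.differentiable one_ne_zero s).hasDerivAt
  have cg : ContDiff ℝ 2 g := contDiff_const.mul (Real.contDiff_exp.sub contDiff_const)
  have cA : ContDiff ℝ 2 A := contDiff_const.mul Real.contDiff_exp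
  have cP : ContDiff ℝ 2 P := contDiff_carlemanWeight α
  -- With G = φ' e^{2φ} χ², the multiplier 2G ws + G'w of the Rellich identity is e^{2φ} χ times 2g
  -- vs + A χ w.
  set G : ℝ → ℝ := fun s => g s * (P s * (χ s * χ s)) with hG
  set G1 : ℝ → ℝ := fun s => P s * (A s * (χ s * χ s) + 2 * (g s * g s) * (χ s * χ s) +
    2 * g s * (χ s * deriv χ s)) with hG1
  have dG : ∀ s, HasDerivAt G (G1 s) s := fun s =>
    ((dg s).mul ((dP s).mul ((dχ s).mul (dχ s)))).congr_deriv (by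
      simp only [hG1, Pi.mul_apply]; ring)
  have dG1 : ∀ s, HasDerivAt G1 (2 * g s * P s * (A s * (χ s * χ s) + 2 * (g s * g s) *
      (χ s * χ s) + 2 * g s * (χ s * deriv χ s)) + P s * (A s * (χ s * χ s) +
      2 * A s * (χ s * deriv χ s) + 4 * (g s * A s) * (χ s * χ s) + 4 * (g s * g s) *
      (χ s * deriv χ s) + 2 * A s * (χ s * deriv χ s) + 2 * g s * (deriv χ s * deriv χ s +
      χ s * deriv (deriv χ) s))) s := fun s =>
    ((dP s).mul ((((dA s).mul ((dχ s).mul (dχ s))).add ((((dg s).mul (dg s)).const_mul 2).mul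
      ((dχ s).mul (dχ s)))).add (((dg s).const_mul 2).mul ((dχ s).mul (ddχ s))))).congr_deriv (by
      simp only [Pi.mul_apply, Pi.add_apply]; ring)
  -- X is dictated by the w ws terms: adding 2X w ws + X' w² to the Rellich integrand gives exactly
  -- P times the quadratic form bounded below in `carleman_pointwise`.
  set X : ℝ → ℝ := fun s => P s * (g s * ((g s * χ s + deriv χ s) * (g s * χ s + deriv χ s)) +
    A s * (χ s * (g s * χ s + deriv χ s)) - (2 * (g s * A s) - g s * (g s * g s) + 1 / 2 * A s) *
      (χ s * χ s)) with hX
  have dη : ∀ s, HasDerivAt (fun s => g s * χ s + deriv χ s)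
      (A s * χ s + g s * deriv χ s + deriv (deriv χ) s) s := fun s =>
    ((dg s).mul (dχ s)).add (ddχ s)
  have dX : ∀ s, HasDerivAt X (2 * g s * P s * (g s * ((g s * χ s + deriv χ s) *
      (g s * χ s + deriv χ s)) + A s * (χ s * (g s * χ s + deriv χ s)) -
      (2 * (g s * A s) - g s * (g s * g s) + 1 / 2 * A s) * (χ s * χ s)) +
      P s * (A s * ((g s * χ s + deriv χ s) * (g s * χ s + deriv χ s)) +
      2 * g s * ((g s * χ s + deriv χ s) * (A s * χ s + g s * deriv χ s + deriv (deriv χ) s)) +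
      A s * (χ s * (g s * χ s + deriv χ s)) + A s * (deriv χ s * (g s * χ s + deriv χ s)) +
      A s * (χ s * (A s * χ s + g s * deriv χ s + deriv (deriv χ) s)) -
      (2 * A s * A s + 2 * g s * A s - 3 * g s * g s * A s + 1 / 2 * A s) * (χ s * χ s) -
      (2 * (g s * A s) - g s * (g s * g s) + 1 / 2 * A s) * (2 * χ s * deriv χ s))) s := fun s =>
    ((dP s).mul ((((dg s).mul ((dη s).mul (dη s))).add ((dA s).mul ((dχ s).mul (dη s)))).sub
      (((((dg s).mul (dA s)).const_mul 2).sub ((dg s).mul ((dg s).mul (dg s)))).add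
      ((dA s).const_mul (1 / 2)) |>.mul ((dχ s).mul (dχ s))))).congr_deriv (by
      simp only [Pi.mul_apply, Pi.add_apply, Pi.sub_apply]; ring)
  have hGs : ∀ s, s ∉ Set.Icc c d → G s = 0 := fun s hs => by simp [hG, hχs s hs]
  have hXs : ∀ s, s ∉ Set.Icc c d → X s = 0 := fun s hs => by simp [hX, hχs s hs, hdχs s hs]
  have cG : ContDiff ℝ 2 G := cg.mul (cP.mul (hχ.mul hχ))
  have cX : ContDiff ℝ 1 X := by
    have cg1 : ContDiff ℝ 1 g := cg.of_le (by norm_num)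
    have cA1 : ContDiff ℝ 1 A := cA.of_le (by norm_num)
    have cP1 : ContDiff ℝ 1 P := cP.of_le (by norm_num)
    have cη : ContDiff ℝ 1 fun s => g s * χ s + deriv χ s := (cg1.mul hχ1).add hdχ
    exact cP1.mul (((cg1.mul (cη.mul cη)).add (cA1.mul (hχ1.mul cη))).sub
      ((((contDiff_const.mul (cg1.mul cA1)).sub (cg1.mul (cg1.mul cg1))).add
        (contDiff_const.mul cA1)).mul (hχ1.mul hχ1)))
  have eG1 : deriv G = G1 := funext fun s => (dG s).deriv
  have hR := hu.rellich hγ hm hK hd hac hdb cG hGs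
  have hI := hl.radial_ibp hγ hm hd hac hdb cX hXs
  have hG1s : ∀ s, s ∉ Set.Icc c d → deriv G s = 0 := fun s hs =>
    deriv_eq_zero_of_notMem_Icc hGs hs
  have hG2s : ∀ s, s ∉ Set.Icc c d → deriv (deriv G) s = 0 := fun s hs =>
    deriv_eq_zero_of_notMem_Icc hG1s hs
  have hX1s : ∀ s, s ∉ Set.Icc c d → deriv X s = 0 := fun s hs =>
    deriv_eq_zero_of_notMem_Icc hXs hs
  have cG1 : ContDiff ℝ 1 (deriv G) := ((contDiff_succ_iff_deriv (n := 1)).1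
    (by simpa [one_add_one_eq_two] using cG)).2.2
  have cX1 : Continuous (deriv X) := cX.continuous_deriv le_rfl
  have cG2 : Continuous (deriv (deriv G)) := cG1.continuous_deriv le_rfl
  have iR : Integrable (fun p => 2 * G (logGauge γ p) * F p * ws p +
      deriv G (logGauge γ p) * F p * w p + 2 * deriv G (logGauge γ p) * ws p ^ 2 +
      deriv (deriv G) (logGauge γ p) * w p * ws p) (invMeasure m k γ) := by
    have j1 := (integrable_radial_mul_mul hγ cG.continuous hGs hF hws).const_mul 2
    have j2 := integrable_radial_mul_mul hγ cG1.continuous hG1s hF hw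
    have j3 := (integrable_radial_mul_mul hγ cG1.continuous hG1s hws hws).const_mul 2
    have j4 := integrable_radial_mul_mul hγ cG2 hG2s hw hws
    refine (((j1.add j2).add j3).add j4).congr (Eventually.of_forall fun p => ?_)
    simp only [Pi.add_apply]
    ring
  have iI : Integrable (fun p => 2 * X (logGauge γ p) * w p * ws p +
      deriv X (logGauge γ p) * w p ^ 2) (invMeasure m k γ) := by
    have j1 := (integrable_radial_mul_mul hγ cX.continuous hXs hw hws).const_mul 2
    have j2 := integrable_radial_mul_mul hγ cX1 hX1s hw hw
    refine (j1.add j2).congr (Eventually.of_forall fun p => ?_)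
    simp only [Pi.add_apply]
    ring
  have iL : Integrable (fun p => (1 / 8 * α ^ 3 * Real.exp (logGauge γ p) * P (logGauge γ p) *
      χ (logGauge γ p) ^ 2) * w p * w p) (invMeasure m k γ) :=
    integrable_radial_mul_mul hγ (c := c) (d := d) (G := fun s => 1 / 8 * α ^ 3 * Real.exp s * P s * χ s ^ 2)
      (((continuous_const.mul Real.continuous_exp).mul hPc).mul (hχ.continuous.pow 2))
      (fun s hs => by simp [hχs s hs]) hw hw
  have iT : Integrable (fun p => (16 * P (logGauge γ p) * deriv χ (logGauge γ p) ^ 2) *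
        ws p * ws p +
      (4 * P (logGauge γ p) * deriv (deriv χ) (logGauge γ p) ^ 2) *
        w p * w p) (invMeasure m k γ) :=
    (integrable_radial_mul_mul hγ (c := c) (d := d) (G := fun s => 16 * P s * deriv χ s ^ 2)
      ((continuous_const.mul hPc).mul (hdχ.continuous.pow 2))
      (fun s hs => by simp [hdχs s hs]) hws hws).add
    (integrable_radial_mul_mul hγ (c := c) (d := d) (G := fun s => 4 * P s * deriv (deriv χ) s ^ 2)
      ((continuous_const.mul hPc).mul (hddχ.pow 2))
      (fun s hs => by simp [hddχs s hs]) hw hw)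
  -- The right-hand side integrates to zero by the Rellich identity and the radial integration by
  -- parts, so a pointwise comparison suffices.
  have hle := integral_mono_ae (iL.sub iT) (iR.add iI) ?_
  · rw [integral_sub' iL iT, integral_add' iR iI, hR, hI] at hle
    linarith
  · filter_upwards [invMeasure_absolutelyContinuous.ae_le (hu.abs_normLap_le hγ hm)] with p hp
    rw [← hwdef, ← hFdef] at hp
    simp only [Pi.sub_apply, Pi.add_apply]
    set s := logGauge γ p
    by_cases hs : s ∈ Set.Icc c d
    · rw [eG1, (dG1 s).deriv, (dX s).deriv]
      have hE4 : Real.exp s ≤ 1 / 4 := (Real.exp_le_exp.2 hs.2).trans hd4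
      have hF' : |F p| ≤ K * Real.exp s ^ 2 * |w p| := by
        rw [← Real.exp_nat_mul]
        exact_mod_cast hp
      have := mul_le_mul_of_nonneg_left (carleman_pointwise (x := χ s) (x1 := deriv χ s)
        (x2 := deriv (deriv χ) s) (ws := ws p) hα (Real.exp_pos s) hE4 hαK hF')
        (carlemanWeight_pos α s).le
      rw [← hP] at this
      change P s * (_ - _) ≤ P s * ((_ + _ + _) * (2 * g s * (_ + (g s * _ + _) * _) + A s * _) +
        (4 * g s ^ 2 + 2 * A s) * (_ + (g s * _ + _) * _) ^ 2 +
        (2 * g s ^ 2 * A s - A s ^ 2 - 2 * g s * A s - _ * A s) * _) at this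
      simp only [hG, hG1, hX]
      clear_value P g A s w ws F
      nlinarith
    · simp [hGs s hs, hXs s hs, hG1s s hs, hG2s s hs, hX1s s hs, hχs s hs, hdχs s hs,
        hddχs s hs]

end

end

/-! ### Cut-off functions of the logarithmic variable. -/

noncomputable section

lemma deriv_smoothTransition_eq_zero {x : ℝ} (hx : x ∉ Set.Icc (0 : ℝ) 1) :
    deriv Real.smoothTransition x = 0 := by
  rw [Set.mem_Icc, not_and_or, not_le, not_le] at hx
  rcases hx with hx | hx
  · have : Real.smoothTransition =ᶠ[𝓝 x] fun _ => 0 := by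
      filter_upwards [Iio_mem_nhds hx] with y hy using Real.smoothTransition.zero_of_nonpos hy.le
    rw [this.deriv_eq, deriv_const]
  · have : Real.smoothTransition =ᶠ[𝓝 x] fun _ => 1 := by
      filter_upwards [Ioi_mem_nhds hx] with y hy using Real.smoothTransition.one_of_one_le hy.le
    rw [this.deriv_eq, deriv_const]

lemma contDiff_two_deriv {f : ℝ → ℝ} (hf : ContDiff ℝ 2 f) : ContDiff ℝ 1 (deriv f) :=
  ((contDiff_succ_iff_deriv (n := 1)).1 (by simpa [one_add_one_eq_two] using hf)).2.2

lemma deriv_comp_affine {f : ℝ → ℝ} (hf : Differentiable ℝ f) (κ c s : ℝ) :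
    deriv (fun s => f (κ * s + c)) s = κ * deriv f (κ * s + c) := by
  have h1 : HasDerivAt (fun s : ℝ => κ * s + c) κ s := by
    simpa using ((hasDerivAt_id s).const_mul κ).add_const c
  have h2 : HasDerivAt (fun s => f (κ * s + c)) _ s :=
    HasDerivAt.comp s (hf _).hasDerivAt h1
  rw [h2.deriv, mul_comm]

/-- A cut-off equal to one on `[l - 1, L]` and vanishing off `[l - 2, L + 1/3]`, with derivatives
bounded independently of `l`, `L`. -/
lemma exists_cutoff : ∃ M : ℝ, 0 ≤ M ∧ ∀ l L : ℝ, l - 1 < L → ∃ χ : ℝ → ℝ, ContDiff ℝ 2 χ ∧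
    (∀ s, s ∉ Set.Icc (l - 2) (L + 1 / 3) → χ s = 0) ∧
    (∀ s ∈ Set.Icc (l - 1) L, χ s = 1) ∧
    (∀ s, |deriv χ s| ≤ M) ∧ (∀ s, |deriv (deriv χ) s| ≤ M) ∧
    (∀ s, s ∉ Set.Icc (l - 2) (l - 1) → s ∉ Set.Icc L (L + 1 / 3) →
      deriv χ s = 0 ∧ deriv (deriv χ) s = 0) := by
  set f := Real.smoothTransition with hf
  have hfc : ContDiff ℝ 2 f := Real.smoothTransition.contDiff
  have hfd : ContDiff ℝ 1 (deriv f) := contDiff_two_deriv hfc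
  have hfs : ∀ x, x ∉ Set.Icc (0 : ℝ) 1 → deriv f x = 0 := fun x hx =>
    deriv_smoothTransition_eq_zero hx
  have hfss : ∀ x, x ∉ Set.Icc (0 : ℝ) 1 → deriv (deriv f) x = 0 := fun x hx =>
    deriv_eq_zero_of_notMem_Icc hfs hx
  obtain ⟨M1, hM1, h1⟩ := exists_bound_of_support hfd.continuous hfs
  obtain ⟨M2, hM2, h2⟩ := exists_bound_of_support (hfd.continuous_deriv le_rfl) hfss
  -- The outer transition has slope 3, so its second derivative is scaled by 9.
  refine ⟨9 * (M1 + M2), by positivity, fun l L hlL => ?_⟩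
  set f1 : ℝ → ℝ := fun s => f (1 * s + (2 - l)) with hf1
  set f2 : ℝ → ℝ := fun s => f (-3 * s + (1 + 3 * L)) with hf2
  have c1 : ContDiff ℝ 2 f1 := hfc.comp ((contDiff_const.mul contDiff_id).add contDiff_const)
  have c2 : ContDiff ℝ 2 f2 := hfc.comp ((contDiff_const.mul contDiff_id).add contDiff_const)
  have d1 : deriv f1 = fun s => 1 * deriv f (1 * s + (2 - l)) :=
    funext fun s => deriv_comp_affine (hfc.differentiable two_ne_zero) _ _ _
  have d2 : deriv f2 = fun s => -3 * deriv f (-3 * s + (1 + 3 * L)) :=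
    funext fun s => deriv_comp_affine (hfc.differentiable two_ne_zero) _ _ _
  have dd1 : ∀ s, deriv (deriv f1) s = deriv (deriv f) (1 * s + (2 - l)) := by
    intro s
    rw [d1]
    simp only [one_mul]
    simpa using deriv_comp_affine (hfd.differentiable one_ne_zero) 1 (2 - l) s
  have dd2 : ∀ s, deriv (deriv f2) s = 9 * deriv (deriv f) (-3 * s + (1 + 3 * L)) := by
    intro s
    rw [d2, deriv_const_mul_field, deriv_comp_affine (hfd.differentiable one_ne_zero)]
    ring
  -- As l - 1 < L, near every point at least one of the two transitions is identically 1, so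
  -- products of their derivatives never occur.
  have e1 : ∀ s, s < L → (fun s => f1 s * f2 s) =ᶠ[𝓝 s] f1 := by
    intro s hs
    filter_upwards [Iio_mem_nhds hs] with x hx
    have : f2 x = 1 := Real.smoothTransition.one_of_one_le (by linarith [Set.mem_Iio.1 hx])
    rw [this, mul_one]
  have e2 : ∀ s, l - 1 < s → (fun s => f1 s * f2 s) =ᶠ[𝓝 s] f2 := by
    intro s hs
    filter_upwards [Ioi_mem_nhds hs] with x hx
    have : f1 x = 1 := Real.smoothTransition.one_of_one_le (by linarith [Set.mem_Ioi.1 hx])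
    rw [this, one_mul]
  refine ⟨fun s => f1 s * f2 s, c1.mul c2, ?_, ?_, ?_, ?_, ?_⟩
  · intro s hs
    rw [Set.mem_Icc, not_and_or, not_le, not_le] at hs
    rcases hs with hs | hs
    · have : f1 s = 0 := Real.smoothTransition.zero_of_nonpos (by linarith)
      simp [this]
    · have : f2 s = 0 := Real.smoothTransition.zero_of_nonpos (by linarith)
      simp [this]
  · intro s hs
    have h1 : f1 s = 1 := Real.smoothTransition.one_of_one_le (by linarith [hs.1])
    have h2 : f2 s = 1 := Real.smoothTransition.one_of_one_le (by linarith [hs.2])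
    simp [h1, h2]
  · intro s
    rcases lt_or_ge s L with hs | hs
    · rw [(e1 s hs).deriv_eq, d1]
      simp only [one_mul]
      linarith [h1 (s + (2 - l))]
    · rw [(e2 s (by linarith)).deriv_eq, d2]
      simp only [abs_mul]
      have := h1 (-3 * s + (1 + 3 * L))
      rw [abs_neg, abs_of_pos (by norm_num : (0 : ℝ) < 3)]
      linarith
  · intro s
    rcases lt_or_ge s L with hs | hs
    · rw [(e1 s hs).deriv.deriv_eq, dd1]
      linarith [h2 (1 * s + (2 - l))]
    · rw [(e2 s (by linarith)).deriv.deriv_eq, dd2, abs_mul]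
      have := h2 (-3 * s + (1 + 3 * L))
      rw [abs_of_pos (by norm_num : (0 : ℝ) < 9)]
      linarith
  · intro s hs1 hs2
    rcases lt_or_ge s L with hs | hs
    · rw [(e1 s hs).deriv_eq, (e1 s hs).deriv.deriv_eq, dd1, d1]
      have : 1 * s + (2 - l) ∉ Set.Icc (0 : ℝ) 1 := by
        intro h
        exact hs1 ⟨by linarith [h.1], by linarith [h.2]⟩
      simp only [hfs _ this, hfss _ this, mul_zero, and_self]
    · rw [(e2 s (by linarith)).deriv_eq, (e2 s (by linarith)).deriv.deriv_eq, dd2, d2]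
      have : -3 * s + (1 + 3 * L) ∉ Set.Icc (0 : ℝ) 1 := by
        intro h
        exact hs2 ⟨by linarith [h.2], by linarith [h.1]⟩
      simp only [hfs _ this, hfss _ this, mul_zero, and_self]

/-- Bump functions equal to one on `[x - κ⁻¹, x + κ⁻¹]`, vanishing off `[x - 3κ⁻¹, x + 3κ⁻¹]`. -/
lemma exists_bump : ∃ M : ℝ, 0 ≤ M ∧ ∀ κ x : ℝ, 0 < κ → ∃ ζ : ℝ → ℝ, ContDiff ℝ 1 ζ ∧
    (∀ s, s ∉ Set.Icc (x - 3 / κ) (x + 3 / κ) → ζ s = 0) ∧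
    (∀ s ∈ Set.Icc (x - 1 / κ) (x + 1 / κ), ζ s = 1) ∧ (∀ s, |ζ s| ≤ 1) ∧
    (∀ s, |deriv ζ s| ≤ κ * M) := by
  let f : ContDiffBump (0 : ℝ) := ⟨1, 3, by norm_num, by norm_num⟩
  have hfc : ContDiff ℝ 1 f := f.contDiff
  have hfs : ∀ y, y ∉ Set.Icc (-3 : ℝ) 3 → f y = 0 := by
    intro y hy
    apply f.zero_of_le_dist
    rw [dist_zero_right, Real.norm_eq_abs]
    by_contra h
    have := abs_lt.1 (not_le.1 h)
    exact hy ⟨this.1.le, this.2.le⟩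
  obtain ⟨M, hM, h⟩ := exists_bound_of_support (hfc.continuous_deriv le_rfl)
    fun s hs => deriv_eq_zero_of_notMem_Icc hfs hs
  refine ⟨M, hM, fun κ x hκ => ⟨fun s => f (κ * s + -(κ * x)),
    hfc.comp ((contDiff_const.mul contDiff_id).add contDiff_const), ?_, ?_, ?_, ?_⟩⟩
  · intro s hs
    apply hfs
    intro hI
    apply hs
    have e : s = (κ * s + -(κ * x)) / κ + x := by field_simp; ring
    constructor
    · have := div_le_div_of_nonneg_right hI.1 hκ.le
      rw [neg_div] at this
      linarith
    · have := div_le_div_of_nonneg_right hI.2 hκ.le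
      linarith
  · intro s hs
    apply f.one_of_mem_closedBall
    rw [mem_closedBall_zero_iff, Real.norm_eq_abs, abs_le]
    have h1 := mul_le_mul_of_nonneg_left hs.1 hκ.le
    have h2 := mul_le_mul_of_nonneg_left hs.2 hκ.le
    rw [mul_sub, mul_one_div_cancel hκ.ne'] at h1
    rw [mul_add, mul_one_div_cancel hκ.ne'] at h2
    change -1 ≤ _ ∧ _ ≤ (1 : ℝ)
    constructor <;> linarith
  · intro s
    rw [abs_of_nonneg f.nonneg]
    exact f.le_one
  · intro s
    rw [deriv_comp_affine (hfc.differentiable one_ne_zero), abs_mul, abs_of_pos hκ]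
    exact mul_le_mul_of_nonneg_left (h _) hκ.le

end

/-! ### From supremum bounds to weighted energy bounds. -/

noncomputable section

variable {m k : ℕ} {γ : ℝ} {a b K : ℝ} {u : GrushinSpace m k → ℝ}
  {Du : Fin m ⊕ Fin k → GrushinSpace m k → ℝ}
  {D2u : Fin m ⊕ Fin k → Fin m ⊕ Fin k → GrushinSpace m k → ℝ}

/-- A positive upper bound for the volume of the unit gauge ball. -/
def unitVol (m k : ℕ) (γ : ℝ) : ℝ := (volume (gaugeBall γ 1 : Set (GrushinSpace m k))).toReal + 1

lemma unitVol_pos : 0 < unitVol m k γ := by unfold unitVol; positivity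

lemma gaugeBall_mono {r s : ℝ} (h : r ≤ s) :
    (gaugeBall γ r : Set (GrushinSpace m k)) ⊆ gaugeBall γ s := fun _ hp => lt_of_lt_of_le hp h

lemma toReal_volume_gaugeBall_le (hγ : 0 < γ) {r : ℝ} (hr : r ≤ 1) :
    (volume (gaugeBall γ r : Set (GrushinSpace m k))).toReal ≤ unitVol m k γ :=
  (ENNReal.toReal_mono (volume_gaugeBall_lt_top hγ 1).ne (measure_mono (gaugeBall_mono hr))).trans
    (by unfold unitVol; linarith)

/-- By scaling, the volume is r^Q times that of the unit ball, and Q ≥ m ≥ 1 with r ≤ 1. Its purpose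
is to make prescribed mass force a lower bound on the radius. -/
lemma toReal_volume_gaugeBall_le_mul (hγ : 0 < γ) (hm : 1 ≤ m) {r : ℝ} (hr0 : 0 < r) (hr : r ≤ 1) :
    (volume (gaugeBall γ r : Set (GrushinSpace m k))).toReal ≤ r * unitVol m k γ := by
  have hpre : (gaugeBall γ r : Set (GrushinSpace m k)) =
      dil γ (-Real.log r) ⁻¹' gaugeBall γ 1 := by
    ext p
    simp only [gaugeBall, Set.mem_ofPred_eq, Set.mem_preimage]
    by_cases hp : p = 0
    · have h0 : dil γ (-Real.log r) (0 : GrushinSpace m k) = 0 := dil_zero_right _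
      rw [hp, h0, grushinGauge_zero hγ]
      simp [hr0]
    · rw [← exp_logGauge hγ (dil_ne_zero _ hp), logGauge_dil hγ _ hp, Real.exp_add,
        exp_logGauge hγ hp, Real.exp_neg, Real.exp_log hr0, ← div_eq_mul_inv, div_lt_one hr0]
  have hmap := congrArg (fun ν => ν (gaugeBall γ 1 : Set (GrushinSpace m k)))
    (map_dil_volume (m := m) (k := k) (γ := γ) (-Real.log r))
  simp only [Measure.smul_apply, smul_eq_mul] at hmap
  rw [Measure.map_apply (measurable_dil _) (measurableSet_gaugeBall hγ 1), ← hpre] at hmap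
  rw [hmap, ENNReal.toReal_mul, ENNReal.toReal_ofReal (Real.exp_nonneg _)]
  have hQ : 1 ≤ homDim m k γ := by
    unfold homDim
    have : (1 : ℝ) ≤ m := by exact_mod_cast hm
    have : 0 ≤ (γ + 1) * k := by positivity
    linarith
  have h1 : Real.exp (-homDim m k γ * -Real.log r) ≤ r := by
    conv_rhs => rw [← Real.exp_log hr0]
    apply Real.exp_le_exp.2
    have := Real.log_nonpos hr0.le hr
    nlinarith
  exact mul_le_mul h1 (by unfold unitVol; linarith) ENNReal.toReal_nonneg hr0.le

lemma integrable_invDensity_mul (hγ : 0 < γ) {Y : GrushinSpace m k → ℝ}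
    (hY : Integrable Y (invMeasure m k γ)) : Integrable fun p => invDensity γ p * Y p := by
  rw [invMeasure, integrable_withDensity_iff_integrable_smul'
    (measurable_invDensity hγ).ennreal_ofReal (by simp)] at hY
  simpa [ENNReal.toReal_ofReal (invDensity_nonneg hγ _)] using hY

lemma invDensity_mul_normFn_sq (p : GrushinSpace m k)
    (hp : p ∈ (annulus γ a b : Set (GrushinSpace m k))) :
    invDensity γ p * (normFn γ a b u p * normFn γ a b u p) = gaugeWeight γ p * (u p * u p) := by
  rw [normFn, Set.indicator_of_mem hp, invDensity]
  have : Real.exp (-2 * halfDim m k γ * logGauge γ p) *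
      (Real.exp (halfDim m k γ * logGauge γ p) * Real.exp (halfDim m k γ * logGauge γ p)) = 1 := by
    rw [← Real.exp_add, ← Real.exp_add, Real.exp_eq_one_iff]
    ring
  linear_combination gaugeWeight γ p * (u p * u p) * this

lemma integrable_indicator_gaugeBall (hγ : 0 < γ) (r C : ℝ) :
    Integrable ((gaugeBall γ r : Set (GrushinSpace m k)).indicator fun _ => C) := by
  rw [integrable_indicator_iff (measurableSet_gaugeBall hγ r)]
  exact integrableOn_const (volume_gaugeBall_lt_top hγ r).ne

lemma integral_indicator_gaugeBall (hγ : 0 < γ) (r C : ℝ) :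
    ∫ p, (gaugeBall γ r : Set (GrushinSpace m k)).indicator (fun _ => C) p =
      (volume (gaugeBall γ r : Set (GrushinSpace m k))).toReal * C := by
  rw [integral_indicator (measurableSet_gaugeBall hγ r), setIntegral_const, smul_eq_mul]
  rfl

/-- A radially weighted `L²` norm is controlled by a supremum bound on the support. -/
lemma integral_radial_normFn_sq_le (hγ : 0 < γ) {θ : ℝ → ℝ} {c d Θ N : ℝ}
    (hθs : ∀ s, s ∉ Set.Icc c d → θ s = 0) (hθ0 : ∀ s, 0 ≤ θ s) (hθ : ∀ s, θ s ≤ Θ) (hd : d < 0)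
    (hN : ∀ᵐ p : GrushinSpace m k, p ≠ 0 → logGauge γ p ∈ Set.Icc c d → |u p| ≤ N) :
    ∫ p, θ (logGauge γ p) * normFn γ a b u p * normFn γ a b u p ∂(invMeasure m k γ) ≤
      Θ * N ^ 2 * Real.exp (-2 * c) * unitVol m k γ := by
  have hΘ : 0 ≤ Θ := (hθ0 0).trans (hθ 0)
  have hC : 0 ≤ Θ * N ^ 2 * Real.exp (-2 * c) := by positivity
  rw [integral_invMeasure hγ]
  calc _ ≤ ∫ p, (gaugeBall γ 1 : Set (GrushinSpace m k)).indicator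
        (fun _ => Θ * N ^ 2 * Real.exp (-2 * c)) p := by
        refine integral_mono_of_nonneg (Eventually.of_forall fun p => ?_)
          (integrable_indicator_gaugeBall hγ 1 _) ?_
        · have := mul_nonneg (mul_nonneg (invDensity_nonneg hγ p) (hθ0 (logGauge γ p)))
            (mul_self_nonneg (normFn γ a b u p))
          simp only [Pi.zero_apply]
          linarith
        · filter_upwards [hN] with p hp
          have hz : ∀ x : ℝ, x = 0 → x ≤ (gaugeBall γ 1 : Set (GrushinSpace m k)).indicator
              (fun _ => Θ * N ^ 2 * Real.exp (-2 * c)) p := by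
            rintro x rfl
            exact Set.indicator_nonneg (fun _ _ => hC) _
          by_cases hpA : p ∈ (annulus γ a b : Set (GrushinSpace m k))
          swap
          · exact hz _ (by rw [normFn_eq_zero hpA]; ring)
          by_cases hS : logGauge γ p ∈ Set.Icc c d
          swap
          · exact hz _ (by rw [hθs _ hS]; ring)
          have hp0 : p ≠ 0 := hpA.1
          have hmem : p ∈ (gaugeBall γ 1 : Set (GrushinSpace m k)) := by
            change grushinGauge γ p < 1
            rw [← exp_logGauge hγ hp0]
            exact Real.exp_lt_one_iff.2 (hS.2.trans_lt hd)
          rw [Set.indicator_of_mem hmem]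
          have h1 := invDensity_mul_normFn_sq (u := u) p hpA
          -- The weight is ψ ρ^{-2} with ψ ≤ 1, and ρ ≥ e^c on the support.
          have h2 : gaugeWeight γ p ≤ Real.exp (-2 * c) :=
            (gaugeWeight_le hγ hp0).trans (Real.exp_le_exp.2 (by linarith [hS.1]))
          have h3 : u p * u p ≤ N ^ 2 := by
            rw [← sq, ← sq_abs]
            exact pow_le_pow_left₀ (abs_nonneg _) (hp hp0 hS) 2
          calc _ = θ (logGauge γ p) * (gaugeWeight γ p * (u p * u p)) := by rw [← h1]; ring
            _ ≤ Θ * (Real.exp (-2 * c) * N ^ 2) :=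
              mul_le_mul (hθ _) (mul_le_mul h2 h3 (mul_self_nonneg _) (Real.exp_nonneg _))
                (mul_nonneg (gaugeWeight_nonneg hγ p) (mul_self_nonneg _)) hΘ
            _ = _ := by ring
    _ = (volume (gaugeBall γ 1 : Set (GrushinSpace m k))).toReal *
        (Θ * N ^ 2 * Real.exp (-2 * c)) := integral_indicator_gaugeBall hγ 1 _
    _ ≤ _ := by
        rw [mul_comm]
        exact mul_le_mul_of_nonneg_left (toReal_volume_gaugeBall_le hγ le_rfl) hC

/-- The local energy of a bounded solution. -/
lemma IsAnnulusSolution.local_energy_le (hγ : 0 < γ) (hm : 1 ≤ m) (hK : 0 ≤ K)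
    (hu : IsAnnulusSolution γ K a b u Du D2u) {c d : ℝ} (hd : d < 0)
    (hac : a < c) (hdb : d < b) {ζ : ℝ → ℝ} (hζ : ContDiff ℝ 1 ζ)
    (hζs : ∀ s, s ∉ Set.Icc c d → ζ s = 0) (hζ1 : ∀ s, |ζ s| ≤ 1) {M N : ℝ}
    (hζM : ∀ s, |deriv ζ s| ≤ M)
    (hN : ∀ᵐ p : GrushinSpace m k, p ≠ 0 → logGauge γ p ∈ Set.Icc c d → |u p| ≤ N) :
    16 * ∫ p, ζ (logGauge γ p) ^ 2 * normDeriv γ a b u Du p * normDeriv γ a b u Du p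
      ∂(invMeasure m k γ) +
    4 * ∫ p, ζ (logGauge γ p) ^ 2 * normFn γ a b u p * normFn γ a b u p ∂(invMeasure m k γ) ≤
      (64 * K + 32 * halfDim m k γ ^ 2 + 128 * M ^ 2 + 4) * N ^ 2 * Real.exp (-2 * c) *
        unitVol m k γ := by
  have hsq : ∀ s, ζ s ^ 2 ≤ 1 := fun s => by
    rw [← sq_abs]; exact pow_le_one₀ (abs_nonneg _) (hζ1 s)
  have hdsq : ∀ s, deriv ζ s ^ 2 ≤ M ^ 2 := fun s => by
    rw [← sq_abs (deriv ζ s)]; exact pow_le_pow_left₀ (abs_nonneg _) (hζM s) 2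
  have hds : ∀ s, s ∉ Set.Icc c d → deriv ζ s = 0 := fun s hs =>
    deriv_eq_zero_of_notMem_Icc hζs hs
  have h1 := hu.caccioppoli hγ hm hK hd hac hdb hζ hζs
  have h2 := integral_radial_normFn_sq_le (a := a) (b := b) hγ (θ := fun s => ζ s ^ 2) (Θ := 1)
    (fun s hs => by simp [hζs s hs]) (fun s => sq_nonneg _) hsq hd hN
  have h3 := integral_radial_normFn_sq_le (a := a) (b := b) hγ
    (θ := fun s => (4 * K + 2 * halfDim m k γ ^ 2) * ζ s ^ 2 + 8 * deriv ζ s ^ 2)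
    (Θ := 4 * K + 2 * halfDim m k γ ^ 2 + 8 * M ^ 2)
    (fun s hs => by simp [hζs s hs, hds s hs]) (fun s => by positivity)
    (fun s => by
      have : 0 ≤ 4 * K + 2 * halfDim m k γ ^ 2 := by positivity
      nlinarith [hsq s, hdsq s]) hd hN
  -- The coefficients 16 and 4 are those of the error terms in the Carleman estimate: 16 times the
  -- Caccioppoli bound plus 4 times the trivial one.
  have h4 := h1.trans h3
  linarith

end

/-! ### The Carleman inequality between a small and a large gauge sphere. -/

noncomputable section

variable {m k : ℕ} {γ : ℝ} {a b K : ℝ} {u : GrushinSpace m k → ℝ}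
  {Du : Fin m ⊕ Fin k → GrushinSpace m k → ℝ}
  {D2u : Fin m ⊕ Fin k → Fin m ⊕ Fin k → GrushinSpace m k → ℝ}

/-- The function e^s - s decreases on s ≤ 0; this follows from 1 + x ≤ e^x at x = s - t and e^t ≤ 1.
-/
lemma carlemanWeight_anti {α s t : ℝ} (hα : 0 ≤ α) (hst : s ≤ t) (ht : t ≤ 0) :
    carlemanWeight α t ≤ carlemanWeight α s := by
  apply Real.exp_le_exp.2
  have h1 : Real.exp s = Real.exp t * Real.exp (s - t) := by rw [← Real.exp_add]; ring_nf
  have h2 := Real.add_one_le_exp (s - t)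
  have h3 : Real.exp t ≤ 1 := Real.exp_le_one_iff.2 ht
  have h4 : Real.exp t - t ≤ Real.exp s - s := by
    rw [h1]
    nlinarith [Real.exp_pos t]
  nlinarith

lemma integral_radial_le_add (hγ : 0 < γ) {ν : Measure (GrushinSpace m k)} {G ζ ξ : ℝ → ℝ}
    {c d c1 d1 c2 d2 A B : ℝ} (hG : Continuous G) (hGs : ∀ s, s ∉ Set.Icc c d → G s = 0)
    (hζ : Continuous ζ) (hζs : ∀ s, s ∉ Set.Icc c1 d1 → ζ s = 0)
    (hξ : Continuous ξ) (hξs : ∀ s, s ∉ Set.Icc c2 d2 → ξ s = 0)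
    (h : ∀ s, G s ≤ A * ζ s ^ 2 + B * ξ s ^ 2) {f : GrushinSpace m k → ℝ} (hf : MemLp f 2 ν) :
    ∫ p, G (logGauge γ p) * f p * f p ∂ν ≤
      A * ∫ p, ζ (logGauge γ p) ^ 2 * f p * f p ∂ν + B * ∫ p, ξ (logGauge γ p) ^ 2 * f p * f p ∂ν := by
  have i1 : Integrable (fun p => ζ (logGauge γ p) ^ 2 * f p * f p) ν :=
    integrable_radial_mul_mul hγ (G := fun s => ζ s ^ 2) (c := c1) (d := d1) (hζ.pow 2)
      (fun s hs => by simp [hζs s hs]) hf hf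
  have i2 : Integrable (fun p => ξ (logGauge γ p) ^ 2 * f p * f p) ν :=
    integrable_radial_mul_mul hγ (G := fun s => ξ s ^ 2) (c := c2) (d := d2) (hξ.pow 2)
      (fun s hs => by simp [hξs s hs]) hf hf
  rw [← integral_const_mul, ← integral_const_mul, ← integral_add (i1.const_mul A) (i2.const_mul B)]
  refine integral_mono (integrable_radial_mul_mul hγ hG hGs hf hf)
    ((i1.const_mul A).add (i2.const_mul B)) fun p => ?_
  have := mul_le_mul_of_nonneg_right (h (logGauge γ p)) (mul_self_nonneg (f p))
  simp only
  linarith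

/-- The left-hand side of the Carleman estimate controls the mass on an intermediate ball. -/
lemma IsHorizLimit.mass_le_carleman (hγ : 0 < γ) (hm : 1 ≤ m)
    (hl : IsHorizLimit γ (annulus γ a b) u Du) {χ : ℝ → ℝ} {c d r R1 α N : ℝ}
    (hχ : Continuous χ) (hχs : ∀ s, s ∉ Set.Icc c d → χ s = 0) (hα : 1 ≤ α)
    (hr : 0 < r) (hrR : r < R1) (hR1 : R1 ≤ 1) (har : a < Real.log r) (hRb : Real.log R1 ≤ b)
    (hχ1 : ∀ s ∈ Set.Icc (Real.log r) (Real.log R1), χ s = 1)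
    (hN : ∀ᵐ p : GrushinSpace m k, p ∈ (gaugeBall γ r : Set (GrushinSpace m k)) → |u p| ≤ N) :
    1 / 8 * α ^ 3 * carlemanWeight α (Real.log R1) *
      ((∫ p in gaugeBall γ R1, u p ^ 2 * angleFn γ p) - N ^ 2 * unitVol m k γ) ≤
    ∫ p, (1 / 8 * α ^ 3 * Real.exp (logGauge γ p) * carlemanWeight α (logGauge γ p) *
      χ (logGauge γ p) ^ 2) * normFn γ a b u p * normFn γ a b u p ∂(invMeasure m k γ) := by
  set A := 1 / 8 * α ^ 3 * carlemanWeight α (Real.log R1) with hA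
  have hA0 : 0 ≤ A := by have := carlemanWeight_pos α (Real.log R1); positivity
  set w := normFn γ a b u with hw
  set G : ℝ → ℝ := fun s => 1 / 8 * α ^ 3 * Real.exp s * carlemanWeight α s * χ s ^ 2 with hG
  have hG0 : ∀ s, 0 ≤ G s := fun s => by have := carlemanWeight_pos α s; positivity
  have hPc : Continuous (carlemanWeight α) := (contDiff_carlemanWeight α (n := 0)).continuous
  have hF : Integrable (fun p => invDensity γ p * (G (logGauge γ p) * w p * w p)) :=
    integrable_invDensity_mul hγ (integrable_radial_mul_mul hγ (c := c) (d := d)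
      (((continuous_const.mul Real.continuous_exp).mul hPc).mul (hχ.pow 2))
      (fun s hs => by simp [hχs s hs]) (hl.memLp_normFn hγ) (hl.memLp_normFn hγ))
  have hF0 : ∀ p, 0 ≤ invDensity γ p * (G (logGauge γ p) * w p * w p) := fun p => by
    rw [mul_assoc]
    exact mul_nonneg (invDensity_nonneg hγ p) (mul_nonneg (hG0 _) (mul_self_nonneg _))
  -- The ball B_{R1} is split into B_r, where |u| ≤ N, and the shell where χ = 1.
  have key : ∫ p, (gaugeBall γ R1 : Set (GrushinSpace m k)).indicator
      (fun p => A * (u p ^ 2 * angleFn γ p)) p ≤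
      ∫ p, ((gaugeBall γ r : Set (GrushinSpace m k)).indicator (fun _ => A * N ^ 2) p +
        invDensity γ p * (G (logGauge γ p) * w p * w p)) := by
    have hAN : 0 ≤ A * N ^ 2 := by positivity
    refine integral_mono_of_nonneg (Eventually.of_forall fun p => ?_)
      ((integrable_indicator_gaugeBall hγ r _).add hF) ?_
    · exact Set.indicator_nonneg (fun p _ => mul_nonneg hA0
        (mul_nonneg (sq_nonneg _) (angleFn_nonneg hγ p))) _
    · filter_upwards [hN, ae_ne_zero hm] with p hp hp0
      have hI : 0 ≤ (gaugeBall γ r : Set (GrushinSpace m k)).indicator (fun _ => A * N ^ 2) p :=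
        Set.indicator_nonneg (fun _ _ => hAN) _
      by_cases hpR : p ∈ (gaugeBall γ R1 : Set (GrushinSpace m k))
      swap
      · rw [Set.indicator_of_notMem hpR]
        exact add_nonneg hI (hF0 p)
      rw [Set.indicator_of_mem hpR]
      by_cases hpr : p ∈ (gaugeBall γ r : Set (GrushinSpace m k))
      · rw [Set.indicator_of_mem hpr]
        have h1 : u p ^ 2 ≤ N ^ 2 := by
          rw [← sq_abs]
          exact pow_le_pow_left₀ (abs_nonneg _) (hp hpr) 2
        have h2 : u p ^ 2 * angleFn γ p ≤ N ^ 2 :=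
          (mul_le_of_le_one_right (sq_nonneg _) (angleFn_le_one hγ p)).trans h1
        have := mul_le_mul_of_nonneg_left h2 hA0
        linarith [hF0 p]
      · have hρ := grushinGauge_pos hγ hp0
        have hS1 : Real.log r ≤ logGauge γ p := Real.log_le_log hr (not_lt.1 hpr)
        have hS2 : logGauge γ p < Real.log R1 := Real.log_lt_log hρ hpR
        have hpA : p ∈ (annulus γ a b : Set (GrushinSpace m k)) :=
          ⟨hp0, har.trans_le hS1, hS2.trans_le hRb⟩
        have hR10 : Real.log R1 ≤ 0 := Real.log_nonpos (hr.trans hrR).le hR1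
        have e1 := invDensity_mul_normFn_sq (u := u) p hpA
        have e2 : G (logGauge γ p) =
            1 / 8 * α ^ 3 * Real.exp (logGauge γ p) * carlemanWeight α (logGauge γ p) := by
          simp only [hG]
          rw [hχ1 _ ⟨hS1, hS2.le⟩]
          ring
        have e3 : invDensity γ p * (G (logGauge γ p) * w p * w p) =
            1 / 8 * α ^ 3 * Real.exp (logGauge γ p) * carlemanWeight α (logGauge γ p) *
              (gaugeWeight γ p * (u p * u p)) := by
          rw [← e1, e2]; ring
        have e4 : carlemanWeight α (Real.log R1) ≤ carlemanWeight α (logGauge γ p) :=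
          carlemanWeight_anti (by linarith) hS2.le hR10
        -- The mass carries ψ = weight · ρ² while the Carleman integrand carries only weight · ρ;
        -- this is enough because ρ ≤ 1.
        have e5 : Real.exp (2 * logGauge γ p) ≤ Real.exp (logGauge γ p) :=
          Real.exp_le_exp.2 (by linarith)
        have e6 : carlemanWeight α (Real.log R1) * Real.exp (2 * logGauge γ p) ≤
            carlemanWeight α (logGauge γ p) * Real.exp (logGauge γ p) :=
          mul_le_mul e4 e5 (Real.exp_nonneg _) (carlemanWeight_pos _ _).le
        have e7 : 0 ≤ 1 / 8 * α ^ 3 * (gaugeWeight γ p * (u p * u p)) := by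
          have := mul_nonneg (gaugeWeight_nonneg hγ p) (mul_self_nonneg (u p))
          positivity
        have e8 := mul_le_mul_of_nonneg_left e6 e7
        rw [e3, angleFn_eq hγ hp0]
        calc _ = 1 / 8 * α ^ 3 * (gaugeWeight γ p * (u p * u p)) *
              (carlemanWeight α (Real.log R1) * Real.exp (2 * logGauge γ p)) := by rw [hA]; ring
          _ ≤ _ := e8
          _ = 0 + 1 / 8 * α ^ 3 * Real.exp (logGauge γ p) * carlemanWeight α (logGauge γ p) *
              (gaugeWeight γ p * (u p * u p)) := by ring
          _ ≤ _ := by gcongr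
  rw [integral_indicator (measurableSet_gaugeBall hγ R1), integral_const_mul,
    integral_add (integrable_indicator_gaugeBall hγ r _) hF, integral_indicator_gaugeBall hγ] at key
  rw [integral_invMeasure hγ]
  have hv := toReal_volume_gaugeBall_le (m := m) (k := k) hγ (hrR.le.trans hR1)
  have := mul_le_mul_of_nonneg_right hv (show 0 ≤ A * N ^ 2 by positivity)
  linarith

/-- The Carleman estimate, applied to a bounded solution with a cutoff between the spheres of
radii comparable to `r` and to `R₀`. -/
lemma exists_carleman_bounded (hγ : 0 < γ) (hm : 1 ≤ m) :
    ∃ D : ℝ, 0 < D ∧ ∀ {K r R₀ : ℝ} {u : GrushinSpace m k → ℝ}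
      {Du : Fin m ⊕ Fin k → GrushinSpace m k → ℝ}
      {D2u : Fin m ⊕ Fin k → Fin m ⊕ Fin k → GrushinSpace m k → ℝ}, 0 ≤ K → 0 < r → r < R₀ / 9 →
      R₀ ≤ 1 / 8 → IsAnnulusSolution γ K (Real.log r - 5) (Real.log (2 * R₀)) u Du D2u →
      ∀ {N K₀ α : ℝ},
      (∀ᵐ p : GrushinSpace m k, p ∈ (gaugeBall γ r : Set (GrushinSpace m k)) → |u p| ≤ N) →
      (∀ᵐ p : GrushinSpace m k, p ∈ (gaugeBall γ (2 * R₀) : Set (GrushinSpace m k)) →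
        |u p| ≤ K₀) → 1 ≤ α → K ^ 2 ≤ α ^ 3 →
      1 / 8 * α ^ 3 * carlemanWeight α (Real.log (R₀ / 4)) *
        ((∫ p in gaugeBall γ (R₀ / 4), u p ^ 2 * angleFn γ p) - N ^ 2 * unitVol m k γ) ≤
      D * (K + 1) * (carlemanWeight α (Real.log r - 3) * N ^ 2 *
          Real.exp (-2 * (Real.log r - 4)) +
        carlemanWeight α (Real.log R₀) * K₀ ^ 2 * Real.exp (-2 * (Real.log R₀ - 1 / 3))) := by
  obtain ⟨M, hM0, hM⟩ := exists_cutoff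
  obtain ⟨M', hM'0, hM'⟩ := exists_bump
  set E := (64 + 32 * halfDim m k γ ^ 2 + 128 * (6 * M') ^ 2 + 4) * unitVol m k γ with hE
  have hV := unitVol_pos (m := m) (k := k) (γ := γ)
  have hE0 : 0 ≤ E := by positivity
  refine ⟨M ^ 2 * E + 1, by positivity, ?_⟩
  intro K r R₀ u Du D2u hK hr hrR hR8 hu N K₀ α hN hK₀ hα hαK
  have hR0 : 0 < R₀ := by linarith
  have hl := hu.isLimit.isHorizLimit
  set L := Real.log R₀ with hL
  set l := Real.log r - 1 with hl'
  have hlog2a : (0.6931471803 : ℝ) < Real.log 2 := Real.log_two_gt_d9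
  have hb : Real.log (2 * R₀) = Real.log 2 + L := Real.log_mul (by norm_num) hR0.ne'
  have hL2 : L < -2 := by
    have h1 : L ≤ Real.log (1 / 8) := Real.log_le_log hR0 hR8
    have h2 : Real.log (1 / 8) = -(3 * Real.log 2) := by
      rw [one_div, Real.log_inv, show (8 : ℝ) = 2 ^ 3 by norm_num, Real.log_pow]; norm_num
    linarith
  have hlL : Real.log r < L := Real.log_lt_log hr (by linarith)
  have hLe : Real.exp (L + 1 / 3) ≤ 1 / 4 := by
    have h1 : L + 1 / 3 ≤ Real.log (2 * R₀) := by rw [hb]; linarith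
    calc Real.exp (L + 1 / 3) ≤ Real.exp (Real.log (2 * R₀)) := Real.exp_le_exp.2 h1
      _ = 2 * R₀ := Real.exp_log (by linarith)
      _ ≤ 1 / 4 := by linarith
  obtain ⟨χ, hχ, hχs, hχ1, hχd, hχdd, hχz⟩ := hM l L (by linarith)
  -- This bump equals 1 on the inner transition layer [l-2, l-1] of χ and is supported in [l-3, l],
  -- inside B_r because l = log r - 1.
  obtain ⟨ζ, hζ, hζs, hζ1, hζb, hζd⟩ := hM' 2 (l - 3 / 2) (by norm_num)
  -- This bump equals 1 on the outer layer [L, L + 1/3] and is supported in [L - 1/3, L + 2/3],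
  -- which stays below log(2R₀) because log 2 > 2/3.
  obtain ⟨ξ, hξ, hξs, hξ1, hξb, hξd⟩ := hM' 6 (L + 1 / 6) (by norm_num)
  rw [show l - 3 / 2 - 3 / 2 = l - 3 by ring, show l - 3 / 2 + 3 / 2 = l by ring] at hζs
  rw [show l - 3 / 2 - 1 / 2 = l - 2 by ring, show l - 3 / 2 + 1 / 2 = l - 1 by ring] at hζ1
  rw [show L + 1 / 6 - 3 / 6 = L - 1 / 3 by ring, show L + 1 / 6 + 3 / 6 = L + 2 / 3 by ring] at hξs
  rw [show L + 1 / 6 - 1 / 6 = L by ring, show L + 1 / 6 + 1 / 6 = L + 1 / 3 by ring] at hξ1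
  have hζd' : ∀ s, |deriv ζ s| ≤ 6 * M' := fun s => (hζd s).trans (by linarith)
  have hNζ : ∀ᵐ p : GrushinSpace m k, p ≠ 0 → logGauge γ p ∈ Set.Icc (l - 3) l → |u p| ≤ N := by
    filter_upwards [hN] with p hp hp0 hS
    refine hp ?_
    change grushinGauge γ p < r
    rw [← exp_logGauge hγ hp0]
    calc _ < Real.exp (Real.log r) := Real.exp_lt_exp.2 (by linarith [hS.2])
      _ = r := Real.exp_log hr
  have hNξ : ∀ᵐ p : GrushinSpace m k, p ≠ 0 → logGauge γ p ∈ Set.Icc (L - 1 / 3) (L + 2 / 3) →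
      |u p| ≤ K₀ := by
    filter_upwards [hK₀] with p hp hp0 hS
    refine hp ?_
    change grushinGauge γ p < 2 * R₀
    rw [← exp_logGauge hγ hp0]
    calc _ < Real.exp (Real.log (2 * R₀)) := Real.exp_lt_exp.2 (by rw [hb]; linarith [hS.2])
      _ = 2 * R₀ := Real.exp_log (by linarith)
  have hc := hu.carleman hγ hm hK (by linarith : L + 1 / 3 < 0) hLe
    (by linarith : Real.log r - 5 < l - 2) (by rw [hb]; linarith) hχ hχs hα hαK
  have h1 := hl.mass_le_carleman hγ hm hχ.continuous hχs hα hr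
    (by linarith : r < R₀ / 4) (by linarith) (by linarith)
    (Real.log_le_log (by linarith) (by linarith : R₀ / 4 ≤ 2 * R₀))
    (fun s hs => hχ1 s ⟨by linarith [hs.1], hs.2.trans
      (Real.log_le_log (by linarith) (by linarith))⟩) hN
  have e1 := hu.local_energy_le hγ hm hK (by linarith : l < 0) (by linarith)
    (by rw [hb]; linarith) hζ hζs hζb hζd' hNζ
  have e2 := hu.local_energy_le hγ hm hK (by linarith : L + 2 / 3 < 0) (by linarith)
    (by rw [hb]; linarith) hξ hξs hξb hξd hNξ
  have hd1 : ContDiff ℝ 1 (deriv χ) := contDiff_two_deriv hχ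
  have hPc : Continuous (carlemanWeight α) := (contDiff_carlemanWeight α (n := 0)).continuous
  -- The weight is decreasing, so on each transition layer it is replaced by its value at the left
  -- endpoint.
  have hcut : ∀ (B : ℝ → ℝ), (∀ s, |B s| ≤ M) →
      (∀ s, s ∉ Set.Icc (l - 2) (l - 1) → s ∉ Set.Icc L (L + 1 / 3) → B s = 0) →
      ∀ s, carlemanWeight α s * B s ^ 2 ≤ M ^ 2 * carlemanWeight α (l - 2) * ζ s ^ 2 +
        M ^ 2 * carlemanWeight α L * ξ s ^ 2 := by
    intro B hB hBz s
    have p1 := carlemanWeight_pos α (l - 2)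
    have p2 := carlemanWeight_pos α L
    have hB2 : B s ^ 2 ≤ M ^ 2 := by
      rw [← sq_abs]; exact pow_le_pow_left₀ (abs_nonneg _) (hB s) 2
    by_cases hs1 : s ∈ Set.Icc (l - 2) (l - 1)
    · have := mul_le_mul (carlemanWeight_anti (α := α) (by linarith) hs1.1 (by linarith [hs1.2]))
        hB2 (sq_nonneg _) p1.le
      rw [hζ1 s hs1]
      have h0 : 0 ≤ M ^ 2 * carlemanWeight α L * ξ s ^ 2 := by positivity
      linarith
    by_cases hs2 : s ∈ Set.Icc L (L + 1 / 3)
    · have := mul_le_mul (carlemanWeight_anti (α := α) (by linarith) hs2.1 (by linarith [hs2.2]))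
        hB2 (sq_nonneg _) p2.le
      rw [hξ1 s hs2]
      have h0 : 0 ≤ M ^ 2 * carlemanWeight α (l - 2) * ζ s ^ 2 := by positivity
      linarith
    · rw [hBz s hs1 hs2]
      have : 0 ≤ M ^ 2 * carlemanWeight α (l - 2) * ζ s ^ 2 +
        M ^ 2 * carlemanWeight α L * ξ s ^ 2 := by positivity
      linarith
  have cut1 := hcut (deriv χ) hχd fun s a1 a2 => (hχz s a1 a2).1
  have cut2 := hcut (deriv (deriv χ)) hχdd fun s a1 a2 => (hχz s a1 a2).2
  have hχs1 : ∀ s, s ∉ Set.Icc (l - 2) (L + 1 / 3) → deriv χ s = 0 := fun s hs =>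
    deriv_eq_zero_of_notMem_Icc hχs hs
  have hχs2 : ∀ s, s ∉ Set.Icc (l - 2) (L + 1 / 3) → deriv (deriv χ) s = 0 := fun s hs =>
    deriv_eq_zero_of_notMem_Icc hχs1 hs
  have hw := hl.memLp_normFn hγ
  have hws := hl.memLp_normDeriv hγ
  have cG1 : Continuous fun s => 16 * carlemanWeight α s * deriv χ s ^ 2 :=
    (continuous_const.mul hPc).mul (hd1.continuous.pow 2)
  have cG2 : Continuous fun s => 4 * carlemanWeight α s * deriv (deriv χ) s ^ 2 :=
    (continuous_const.mul hPc).mul ((hd1.continuous_deriv le_rfl).pow 2)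
  have zG1 : ∀ s, s ∉ Set.Icc (l - 2) (L + 1 / 3) →
      16 * carlemanWeight α s * deriv χ s ^ 2 = 0 := fun s hs => by simp [hχs1 s hs]
  have zG2 : ∀ s, s ∉ Set.Icc (l - 2) (L + 1 / 3) →
      4 * carlemanWeight α s * deriv (deriv χ) s ^ 2 = 0 := fun s hs => by simp [hχs2 s hs]
  have f1 := integral_radial_le_add hγ cG1 zG1 hζ.continuous hζs hξ.continuous hξs
    (A := 16 * (M ^ 2 * carlemanWeight α (l - 2))) (B := 16 * (M ^ 2 * carlemanWeight α L))
    (fun s => by linarith [cut1 s]) hws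
  have f2 := integral_radial_le_add hγ cG2 zG2 hζ.continuous hζs hξ.continuous hξs
    (A := 4 * (M ^ 2 * carlemanWeight α (l - 2))) (B := 4 * (M ^ 2 * carlemanWeight α L))
    (fun s => by linarith [cut2 s]) hw
  rw [integral_add (integrable_radial_mul_mul hγ cG1 zG1 hws hws)
    (integrable_radial_mul_mul hγ cG2 zG2 hw hw)] at hc
  have hEK : (64 * K + 32 * halfDim m k γ ^ 2 + 128 * (6 * M') ^ 2 + 4) * unitVol m k γ ≤
      E * (K + 1) := by
    rw [hE]
    have : 0 ≤ (64 + (32 * halfDim m k γ ^ 2 + 128 * (6 * M') ^ 2 + 4) * K) * unitVol m k γ := by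
      positivity
    linarith
  have hP1 := carlemanWeight_pos α (l - 2)
  have hP2 := carlemanWeight_pos α L
  have g1 := mul_le_mul_of_nonneg_left (e1.trans (show _ ≤ E * (K + 1) *
    (N ^ 2 * Real.exp (-2 * (l - 3))) by
      have := mul_le_mul_of_nonneg_right hEK
        (show 0 ≤ N ^ 2 * Real.exp (-2 * (l - 3)) by positivity)
      linarith)) (show 0 ≤ M ^ 2 * carlemanWeight α (l - 2) by positivity)
  have g2 := mul_le_mul_of_nonneg_left (e2.trans (show _ ≤ E * (K + 1) *
    (K₀ ^ 2 * Real.exp (-2 * (L - 1 / 3))) by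
      have := mul_le_mul_of_nonneg_right hEK
        (show 0 ≤ K₀ ^ 2 * Real.exp (-2 * (L - 1 / 3)) by positivity)
      linarith)) (show 0 ≤ M ^ 2 * carlemanWeight α L by positivity)
  rw [show Real.log r - 3 = l - 2 by ring, show Real.log r - 4 = l - 3 by ring]
  have hfin : M ^ 2 * E * (K + 1) * (carlemanWeight α (l - 2) * N ^ 2 * Real.exp (-2 * (l - 3)) +
      carlemanWeight α L * K₀ ^ 2 * Real.exp (-2 * (L - 1 / 3))) ≤
      (M ^ 2 * E + 1) * (K + 1) * (carlemanWeight α (l - 2) * N ^ 2 * Real.exp (-2 * (l - 3)) +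
      carlemanWeight α L * K₀ ^ 2 * Real.exp (-2 * (L - 1 / 3))) := by
    gcongr
    linarith
  refine h1.trans (hc.trans (le_trans ?_ hfin))
  linarith

end

/-! ### Choice of the Carleman parameter, and the conclusion. -/

noncomputable section

set_option maxHeartbeats 800000 in
/-- Optimising the Carleman parameter gives a quantitative lower bound. -/
lemma exists_lower_bound_of_carleman {D K₀ J v : ℝ} (hD : 0 < D) (hK₀ : 0 < K₀) (hJ : 0 < J)
    (hv : 0 < v) : ∃ C₁ C₂ : ℝ, 0 < C₁ ∧ 0 < C₂ ∧ ∀ {K r R₀ N : ℝ}, 0 ≤ K → 0 ≤ N → 0 < r →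
      r < R₀ / 9 → R₀ ≤ 1 / 8 → J ≤ K₀ ^ 2 * (R₀ * v) →
      (∀ α : ℝ, 1 ≤ α → K ^ 2 ≤ α ^ 3 →
        1 / 8 * α ^ 3 * carlemanWeight α (Real.log (R₀ / 4)) * (J - N ^ 2 * v) ≤
        D * (K + 1) * (carlemanWeight α (Real.log r - 3) * N ^ 2 *
          Real.exp (-2 * (Real.log r - 4)) +
        carlemanWeight α (Real.log R₀) * K₀ ^ 2 * Real.exp (-2 * (Real.log R₀ - 1 / 3)))) →
      C₁ * (r / R₀) ^ (C₂ * (K ^ ((2 : ℝ) / 3) + 1)) ≤ N := by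
  -- This is the lower bound that J forces on R₀; it keeps the negative powers of R₀ out of the
  -- constants.
  set ε := J / (K₀ ^ 2 * v) with hε
  have hε0 : 0 < ε := by positivity
  -- Chosen so that a gain of B in the ratio of the weights brings the outer error down to α³PJ/32,
  -- where P is the weight at R₀/4: half of the lower bound α³PJ/16 for the left side.
  set B := 192 * D * K₀ ^ 2 / (ε ^ 2 * J) with hB
  have hB0 : 0 < B := by positivity
  set c := J / (64 * D) * Real.exp (-8) * ε ^ 2 with hc
  have hc0 : 0 < c := by positivity
  refine ⟨min (√c) (√(J / (2 * v))), 4 * (1 + B), by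
    apply lt_min <;> apply Real.sqrt_pos.2 <;> positivity, by positivity, ?_⟩
  intro K r R₀ N hK hN hr hrR hR8 hJR hmain
  have hR0 : 0 < R₀ := by linarith
  have hεR : ε ≤ R₀ := by
    rw [hε, div_le_iff₀ (by positivity)]
    linarith
  set y := K ^ ((2 : ℝ) / 3) with hy
  have hy0 : 0 ≤ y := Real.rpow_nonneg hK _
  have hy3 : y ^ 3 = K ^ 2 := by
    rw [hy, ← Real.rpow_natCast, ← Real.rpow_mul hK, ← Real.rpow_natCast]
    norm_num
  -- The smallest convenient parameter with both α³ ≥ K² + 1 and α ≥ B.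
  set α := (1 + B) * (y + 1) with hα
  have hαy : y + 1 ≤ α := by rw [hα]; linarith [mul_nonneg hB0.le hy0]
  have hαB : B ≤ α := by rw [hα]; linarith [mul_nonneg hB0.le hy0]
  have hα1 : 1 ≤ α := by linarith
  have hα3 : K ^ 2 + 1 ≤ α ^ 3 := by
    have h1 : (y + 1) ^ 3 ≤ α ^ 3 := pow_le_pow_left₀ (by positivity) hαy 3
    have h2 : K ^ 2 + 1 ≤ (y + 1) ^ 3 := by rw [← hy3]; linarith [mul_nonneg hy0 hy0]
    exact h2.trans h1
  -- The Caccioppoli factor K + 1 is thus paid for by the α³ on the left, so it does not enter the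
  -- constants.
  have hKα : K + 1 ≤ 2 * α ^ 3 := by nlinarith [sq_nonneg (K - 1)]
  have hα30 : 0 < α ^ 3 := by positivity
  have hm := hmain α hα1 (by linarith)
  set L := Real.log R₀ with hL
  set t := Real.log (r / R₀) with ht
  have htr : Real.log r = t + L := by rw [ht, Real.log_div hr.ne' hR0.ne']; ring
  have hlog2 : (0.6931471803 : ℝ) < Real.log 2 := Real.log_two_gt_d9
  have hlog4 : Real.log 4 = 2 * Real.log 2 := by
    rw [show (4 : ℝ) = 2 ^ 2 by norm_num, Real.log_pow]; norm_num
  have ht2 : t < -3 / 2 := by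
    have h1 : t ≤ Real.log (1 / 8) := by
      apply Real.log_le_log (by positivity)
      rw [div_le_iff₀ hR0]
      linarith
    have h2 : Real.log (1 / 8) = -(3 * Real.log 2) := by
      rw [one_div, Real.log_inv, show (8 : ℝ) = 2 ^ 3 by norm_num, Real.log_pow]; norm_num
    linarith
  have hq : Real.log (R₀ / 4) = L - Real.log 4 := Real.log_div hR0.ne' (by norm_num)
  have hqe : Real.exp (Real.log (R₀ / 4)) = R₀ / 4 := Real.exp_log (by positivity)
  have hLe : Real.exp L = R₀ := Real.exp_log hR0
  set Pq := carlemanWeight α (Real.log (R₀ / 4)) with hPq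
  have hPq0 : 0 < Pq := carlemanWeight_pos _ _
  have hPL0 := carlemanWeight_pos α L
  have hPr0 := carlemanWeight_pos α (Real.log r - 3)
  have hrpow : (r / R₀) ^ (4 * (1 + B) * (y + 1)) = Real.exp (4 * α * t) := by
    rw [Real.rpow_def_of_pos (by positivity), ← ht, hα]
    ring_nf
  rw [hrpow]
  -- If B_r may carry half of the mass, N is already bounded below by a constant; this accounts for
  -- the minimum in the choice of C₁.
  by_cases hcase : J / 2 ≤ N ^ 2 * v
  · have h1 : √(J / (2 * v)) ≤ N := by
      rw [Real.sqrt_le_left hN, div_le_iff₀ (by positivity)]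
      linarith
    have h2 : Real.exp (4 * α * t) ≤ 1 := by
      rw [Real.exp_le_one_iff]
      exact mul_nonpos_of_nonneg_of_nonpos (by linarith) (by linarith)
    calc _ ≤ √(J / (2 * v)) * 1 :=
          mul_le_mul (min_le_right _ _) h2 (Real.exp_nonneg _) (Real.sqrt_nonneg _)
      _ ≤ N := by rwa [mul_one]
  have hcase' : J / 2 ≤ J - N ^ 2 * v := by linarith [not_le.1 hcase]
  have h1 : α ^ 3 * Pq * J / 16 ≤ 1 / 8 * α ^ 3 * Pq * (J - N ^ 2 * v) := by
    have := mul_le_mul_of_nonneg_left hcase' (show 0 ≤ 1 / 8 * α ^ 3 * Pq by positivity)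
    linarith
  have hexpL : Real.exp (-2 * (L - 1 / 3)) ≤ 3 / ε ^ 2 := by
    have e1 : Real.exp (-2 * (L - 1 / 3)) = Real.exp (2 / 3) / R₀ ^ 2 := by
      rw [← hLe, ← Real.exp_nat_mul, ← Real.exp_sub]
      congr 1
      push_cast
      ring
    have e2 : Real.exp (2 / 3) ≤ 3 :=
      (Real.exp_le_exp.2 (by norm_num)).trans Real.exp_one_lt_three.le
    rw [e1]
    gcongr
  -- Passing from R₀ to R₀/4 raises e^s - s by log 4 - 3R₀/4 ≥ 1, so the weight grows by at least
  -- e^{2α} ≥ B.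
  have hratio : carlemanWeight α L * B ≤ Pq := by
    have e1 : carlemanWeight α L * Real.exp (2 * α) ≤ Pq := by
      rw [hPq, carlemanWeight, carlemanWeight, ← Real.exp_add, hqe, hLe, hq, hlog4]
      apply Real.exp_le_exp.2
      have := mul_le_mul_of_nonneg_left (by linarith :
        R₀ - L + 1 ≤ R₀ / 4 - (L - 2 * Real.log 2)) (by linarith : 0 ≤ 2 * α)
      linarith
    have e2 : B ≤ Real.exp (2 * α) := by linarith [Real.add_one_le_exp (2 * α)]
    exact (mul_le_mul_of_nonneg_left e2 hPL0.le).trans e1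
  have h2 : D * (K + 1) * (carlemanWeight α L * K₀ ^ 2 * Real.exp (-2 * (L - 1 / 3))) ≤
      α ^ 3 * Pq * J / 32 := by
    calc _ ≤ D * (2 * α ^ 3) * (carlemanWeight α L * K₀ ^ 2 * (3 / ε ^ 2)) := by gcongr
      _ = α ^ 3 * J / 32 * (carlemanWeight α L * B) := by rw [hB]; field_simp; ring
      _ ≤ α ^ 3 * J / 32 * Pq := by gcongr
      _ = _ := by ring
  have h3 : D * (K + 1) * (carlemanWeight α (Real.log r - 3) * N ^ 2 *
      Real.exp (-2 * (Real.log r - 4))) ≤ α ^ 3 * (2 * D * (carlemanWeight α (Real.log r - 3) *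
      N ^ 2 * Real.exp (-2 * (Real.log r - 4)))) := by
    calc _ ≤ D * (2 * α ^ 3) * (carlemanWeight α (Real.log r - 3) * N ^ 2 *
      Real.exp (-2 * (Real.log r - 4))) := by gcongr
      _ = _ := by ring
  have h4 : Pq * J / 32 ≤ 2 * D * (carlemanWeight α (Real.log r - 3) * N ^ 2 *
      Real.exp (-2 * (Real.log r - 4))) := by
    refine le_of_mul_le_mul_left ?_ hα30
    linarith
  -- The natural factor would be e^{2αt} up to e^{6α}. Since t < -3/2, the shift by 3 is swallowed
  -- by tripling the exponent.
  have h5 : carlemanWeight α (Real.log r - 3) * Real.exp (6 * α * t) ≤ Pq := by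
    rw [hPq, carlemanWeight, carlemanWeight, ← Real.exp_add, hqe]
    apply Real.exp_le_exp.2
    have e1 : Real.exp (Real.log r - 3) ≤ R₀ / 4 := by
      calc _ ≤ Real.exp (Real.log r) := Real.exp_le_exp.2 (by linarith)
        _ = r := Real.exp_log hr
        _ ≤ R₀ / 4 := by linarith
    rw [hq, hlog4]
    have := mul_le_mul_of_nonneg_left (by linarith : Real.exp (Real.log r - 3) -
      (Real.log r - 3) + 3 * t ≤ R₀ / 4 - (L - 2 * Real.log 2)) (by linarith : 0 ≤ 2 * α)
    linarith
  have h6 : Real.exp (-2 * (Real.log r - 4)) * (Real.exp (-8) * R₀ ^ 2 * Real.exp (2 * t)) = 1 := by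
    rw [← hLe, ← Real.exp_nat_mul, ← Real.exp_add, ← Real.exp_add, ← Real.exp_add,
      Real.exp_eq_one_iff, htr]
    push_cast
    ring
  have h7 : Real.exp (6 * α * t) * J / 32 ≤
      2 * D * (N ^ 2 * Real.exp (-2 * (Real.log r - 4))) := by
    refine le_of_mul_le_mul_left ?_ hPr0
    have := mul_le_mul_of_nonneg_right h5 (show 0 ≤ J / 32 by positivity)
    linarith
  have h8 : J / (64 * D) * Real.exp (6 * α * t) * (Real.exp (-8) * R₀ ^ 2 * Real.exp (2 * t)) ≤
      N ^ 2 := by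
    have := mul_le_mul_of_nonneg_right h7
      (show 0 ≤ 1 / (2 * D) * (Real.exp (-8) * R₀ ^ 2 * Real.exp (2 * t)) by positivity)
    have e : 2 * D * (N ^ 2 * Real.exp (-2 * (Real.log r - 4))) *
        (1 / (2 * D) * (Real.exp (-8) * R₀ ^ 2 * Real.exp (2 * t))) =
        N ^ 2 * (Real.exp (-2 * (Real.log r - 4)) *
          (Real.exp (-8) * R₀ ^ 2 * Real.exp (2 * t))) := by
      field_simp
    rw [e, h6, mul_one] at this
    refine le_trans (le_of_eq ?_) this
    field_simp
    ring
  -- The factor e^{2t} = (r/R₀)² comes from the bound ρ^{-2} for the weight near the inner sphere.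
  -- As α ≥ 1 and t < 0, it is at least e^{2αt}, which turns 6α into 8α.
  have h9 : c * Real.exp (8 * α * t) ≤ N ^ 2 := by
    refine le_trans ?_ h8
    have e1 : Real.exp (8 * α * t) = Real.exp (6 * α * t) * Real.exp (2 * α * t) := by
      rw [← Real.exp_add]; ring_nf
    have e2 : Real.exp (2 * α * t) ≤ Real.exp (2 * t) := Real.exp_le_exp.2 (by
      have := mul_nonpos_of_nonneg_of_nonpos (by linarith : 0 ≤ α - 1) (by linarith : t ≤ 0)
      linarith)
    rw [hc, e1]
    calc _ = J / (64 * D) * Real.exp (6 * α * t) *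
          (Real.exp (-8) * ε ^ 2 * Real.exp (2 * α * t)) := by ring
      _ ≤ _ := by gcongr
  have h10 : √c * Real.exp (4 * α * t) ≤ N := by
    refine le_of_sq_le_sq ?_ hN
    rw [mul_pow, Real.sq_sqrt hc0.le, ← Real.exp_nat_mul]
    refine le_trans (le_of_eq ?_) h9
    congr 2
    push_cast
    ring
  exact (mul_le_mul_of_nonneg_right (min_le_left _ _) (Real.exp_nonneg _)).trans h10

/-- A lower bound by a power forces an upper bound on the exponents of vanishing. -/
lemma exponent_le_of_isBigO {f : ℝ → ℝ} {C X ℓ R δ : ℝ} (hC : 0 < C) (hR : 0 < R) (hδ : 0 < δ)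
    (hf : ∀ r, 0 < r → r < δ → C * (r / R) ^ X ≤ f r)
    (h : f =O[𝓝[>] 0] fun r : ℝ => r ^ ℓ) : ℓ ≤ X := by
  by_contra! hX
  obtain ⟨A, hA⟩ := h.bound
  have ht : Tendsto (fun r : ℝ => A * r ^ (ℓ - X)) (𝓝[>] 0) (𝓝 0) := by
    have h1 : Tendsto (fun r : ℝ => r ^ (ℓ - X)) (𝓝 0) (𝓝 0) := by
      have := (Real.continuousAt_rpow_const 0 (ℓ - X) (Or.inr (sub_nonneg.2 hX.le))).tendsto
      rwa [Real.zero_rpow (sub_pos.2 hX).ne'] at this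
    simpa using (h1.mono_left nhdsWithin_le_nhds).const_mul A
  have hpos : 0 < C * (1 / R) ^ X := by positivity
  have hsm := ht.eventually (gt_mem_nhds hpos)
  have hIoo : ∀ᶠ r in 𝓝[>] (0 : ℝ), r ∈ Set.Ioo 0 δ := Ioo_mem_nhdsGT hδ
  obtain ⟨r, hr1, hr2, hr3, hr4⟩ := (hA.and (hsm.and hIoo)).exists
  have h1 := hf r hr3 hr4
  have hrX : 0 < r ^ X := Real.rpow_pos_of_pos hr3 _
  have e1 : C * (r / R) ^ X = C * (1 / R) ^ X * r ^ X := by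
    rw [mul_assoc, ← Real.mul_rpow (by positivity) hr3.le]
    congr 2
    ring
  have e2 : r ^ ℓ = r ^ (ℓ - X) * r ^ X := by
    rw [← Real.rpow_add hr3]; ring_nf
  have h2 : f r ≤ A * r ^ ℓ := by
    refine (le_abs_self _).trans (hr1.trans (le_of_eq ?_))
    rw [Real.norm_of_nonneg (Real.rpow_nonneg hr3.le _)]
  have h3 := mul_lt_mul_of_pos_right hr2 hrX
  rw [e2] at h2
  linarith

variable {m k : ℕ} {γ : ℝ} {u : GrushinSpace m k → ℝ}
  {Du : Fin m ⊕ Fin k → GrushinSpace m k → ℝ}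
  {D2u : Fin m ⊕ Fin k → Fin m ⊕ Fin k → GrushinSpace m k → ℝ}

lemma IsS22Limit.mono {s t : Set (GrushinSpace m k)} (hst : s ⊆ t)
    (h : IsS22Limit γ t u Du D2u) : IsS22Limit γ s u Du D2u := by
  obtain ⟨f, h0, h1, h2, h3⟩ := h.exists_seq
  have hle : volume.restrict s ≤ volume.restrict t := Measure.restrict_mono hst le_rfl
  exact ⟨h.memLp.mono_measure hle, fun i => (h.memLp_D i).mono_measure hle,
    fun i j => (h.memLp_D2 i j).mono_measure hle, f, h0, tendsto_eLpNorm_restrict_mono hst h1,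
    fun i => tendsto_eLpNorm_restrict_mono hst (h2 i),
    fun i j => tendsto_eLpNorm_restrict_mono hst (h3 i j)⟩

lemma isAnnulusSolution_of_ball (hγ : 0 < γ) {K a b R : ℝ} {V : GrushinSpace m k → ℝ}
    (hb : Real.exp b ≤ R) (h : IsS22Limit γ (gaugeBall γ R) u Du D2u)
    (heq : ∀ᵐ p ∂(volume.restrict (gaugeBall γ R)), -∑ i, D2u i i p = V p * u p)
    (hV : ∀ᵐ p ∂(volume.restrict (gaugeBall γ R)), |V p| ≤ K * angleFn γ p) :
    IsAnnulusSolution γ K a b u Du D2u := by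
  have hsub : (annulus γ a b : Set (GrushinSpace m k)) ⊆ gaugeBall γ R :=
    (annulus_subset_gaugeBall hγ a b).trans (gaugeBall_mono hb)
  refine ⟨h.mono hsub, ?_⟩
  filter_upwards [ae_restrict_of_ae_restrict_of_subset hsub heq,
    ae_restrict_of_ae_restrict_of_subset hsub hV, ae_restrict_mem (measurableSet_annulus hγ a b)]
    with p h1 h2 hp
  rw [← abs_neg, h1, abs_mul]
  refine mul_le_mul_of_nonneg_right (h2.trans (le_of_eq ?_)) (abs_nonneg _)
  rw [angleFn_eq hγ hp.1]
  ring

lemma setIntegral_sq_mul_angleFn_le (hγ : 0 < γ) (hm : 1 ≤ m) {r K₀ : ℝ} (hr : 0 < r)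
    (hr1 : r ≤ 1) (hu : ∀ᵐ p ∂(volume.restrict (gaugeBall γ r)), |u p| ≤ K₀) :
    ∫ p in gaugeBall γ r, u p ^ 2 * angleFn γ p ≤ K₀ ^ 2 * (r * unitVol m k γ) := by
  calc _ ≤ ∫ _ in (gaugeBall γ r : Set (GrushinSpace m k)), K₀ ^ 2 := by
        refine integral_mono_of_nonneg (Eventually.of_forall fun p =>
          mul_nonneg (sq_nonneg _) (angleFn_nonneg hγ p))
          (integrableOn_const (volume_gaugeBall_lt_top hγ r).ne) ?_
        filter_upwards [hu] with p hp
        have h1 : u p ^ 2 ≤ K₀ ^ 2 := by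
          rw [← sq_abs]; exact pow_le_pow_left₀ (abs_nonneg _) hp 2
        exact (mul_le_of_le_one_right (sq_nonneg _) (angleFn_le_one hγ p)).trans h1
    _ = (volume (gaugeBall γ r : Set (GrushinSpace m k))).toReal * K₀ ^ 2 := by
        rw [setIntegral_const, smul_eq_mul]; rfl
    _ ≤ r * unitVol m k γ * K₀ ^ 2 := by
        gcongr
        exact toReal_volume_gaugeBall_le_mul hγ hm hr hr1
    _ = _ := by ring

lemma ae_abs_le_toReal_eLpNorm_top {X : Type*} [MeasurableSpace X] {μ : Measure X} {f : X → ℝ}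
    (hf : eLpNorm f ⊤ μ ≠ ⊤) : ∀ᵐ x ∂μ, |f x| ≤ (eLpNorm f ⊤ μ).toReal := by
  have h := ae_le_eLpNormEssSup (f := f) (μ := μ)
  rw [← eLpNorm_exponent_top] at h
  filter_upwards [h] with x hx
  have := ENNReal.toReal_mono hf hx
  simpa using this

end

theorem theorem1p3 (m k : ℕ) (hm : 1 ≤ m) (γ : ℝ) (hγ : 0 < γ) :
    -- the radius `Rs` depends only on `m`, `k`, `γ`
    ∃ Rs : ℝ, 0 < Rs ∧
    -- the constants depend only on `m`, `k`, `γ`, `K₀` and the value `J` of the integral below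
    ∀ K₀ J : ℝ, 0 < K₀ → 0 < J → ∃ C₁ C₂ : ℝ, 0 < C₁ ∧ 0 < C₂ ∧
    ∀ R R₀ : ℝ, 0 < R → R₀ = min Rs (R / 2) →
    ∀ K : ℝ, 0 ≤ K → ∀ u V : GrushinSpace m k → ℝ,
      MemS22 γ (gaugeBall γ R) u →
      (∀ᵐ p ∂(volume.restrict (gaugeBall γ R)), |u p| ≤ K₀) →
      (∀ᵐ p ∂(volume.restrict (gaugeBall γ R)), |V p| ≤ K * angleFn γ p) →
      IsGrushinSolution γ (gaugeBall γ R) V u →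
      ∫ p in gaugeBall γ (R₀ / 4), u p ^ 2 * angleFn γ p = J →
      (∀ r : ℝ, 0 < r → r < R₀ / 9 →
        ENNReal.ofReal (C₁ * (r / R₀) ^ (C₂ * (K ^ ((2 : ℝ) / 3) + 1))) ≤
          eLpNorm u ⊤ (volume.restrict (gaugeBall γ r))) ∧
      -- consequently the vanishing order of `u` at the origin is at most `C₂ (K^{2/3} + 1)`
      (∀ ℓ : ℝ,
        (fun r : ℝ => (eLpNorm u ⊤ (volume.restrict (gaugeBall γ r))).toReal)
          =O[𝓝[>] 0] (fun r : ℝ => r ^ ℓ) →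
        ℓ ≤ C₂ * (K ^ ((2 : ℝ) / 3) + 1)) := by
  obtain ⟨D, hD, hcar⟩ := exists_carleman_bounded (k := k) hγ hm
  -- The radius 1/8 gives 2R₀ ≤ 1/4, so that e^s ≤ 1/4 on the support of the cutoff, as the Carleman
  -- estimate requires.
  refine ⟨1 / 8, by norm_num, fun K₀ J hK₀ hJ => ?_⟩
  have hv := unitVol_pos (m := m) (k := k) (γ := γ)
  obtain ⟨C₁, C₂, hC₁, hC₂, hlow⟩ := exists_lower_bound_of_carleman hD hK₀ hJ hv
  refine ⟨C₁, C₂, hC₁, hC₂, ?_⟩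
  rintro R R₀ hR hR₀ K hK u V - hu hV ⟨Du, D2u, hlim, heq⟩ hint
  have hR0 : 0 < R₀ := by rw [hR₀]; exact lt_min (by norm_num) (by linarith)
  have hR8 : R₀ ≤ 1 / 8 := by rw [hR₀]; exact min_le_left _ _
  have hR2 : 2 * R₀ ≤ R := by
    have := min_le_right (1 / 8) (R / 2)
    rw [← hR₀] at this
    linarith
  have hbound : ∀ {s : ℝ}, s ≤ R →
      ∀ᵐ p ∂(volume.restrict (gaugeBall γ s : Set (GrushinSpace m k))), |u p| ≤ K₀ := fun hs =>
    ae_restrict_of_ae_restrict_of_subset (gaugeBall_mono hs) hu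
  -- The mass J sits on B_{R₀/4}, whose volume is at most a constant times R₀, so R₀ cannot be
  -- small.
  have hJR : J ≤ K₀ ^ 2 * (R₀ * unitVol m k γ) := by
    have h1 := setIntegral_sq_mul_angleFn_le hγ hm (r := R₀ / 4) (by linarith) (by linarith)
      (hbound (by linarith))
    rw [hint] at h1
    refine h1.trans ?_
    gcongr
    linarith
  have hfin : ∀ {s : ℝ}, s ≤ R →
      eLpNorm u ⊤ (volume.restrict (gaugeBall γ s : Set (GrushinSpace m k))) ≠ ⊤ := fun hs => by
    rw [eLpNorm_exponent_top]
    exact ((eLpNormEssSup_le_of_ae_bound (C := K₀) (hbound hs)).trans_lt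
      ENNReal.ofReal_lt_top).ne
  have hmain : ∀ r : ℝ, 0 < r → r < R₀ / 9 →
      C₁ * (r / R₀) ^ (C₂ * (K ^ ((2 : ℝ) / 3) + 1)) ≤
        (eLpNorm u ⊤ (volume.restrict (gaugeBall γ r : Set (GrushinSpace m k)))).toReal := by
    intro r hr hrR
    have hrR' : r ≤ R := by linarith
    have hsol : IsAnnulusSolution γ K (Real.log r - 5) (Real.log (2 * R₀)) u Du D2u :=
      isAnnulusSolution_of_ball hγ (by rwa [Real.exp_log (by linarith)]) hlim heq hV
    refine hlow hK ENNReal.toReal_nonneg hr hrR hR8 hJR fun α hα hαK => ?_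
    rw [← hint]
    exact hcar hK hr hrR hR8 hsol
      ((ae_restrict_iff' (measurableSet_gaugeBall hγ r)).1
        (ae_abs_le_toReal_eLpNorm_top (hfin hrR')))
      ((ae_restrict_iff' (measurableSet_gaugeBall hγ (2 * R₀))).1 (hbound hR2)) hα hαK
  refine ⟨fun r hr hrR => ?_, fun ℓ hℓ => ?_⟩
  · exact ENNReal.ofReal_le_of_le_toReal (hmain r hr hrR)
  · exact exponent_le_of_isBigO hC₁ hR0 (by positivity : 0 < R₀ / 9) hmain hℓ
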